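/- Let $\gamma\in\mathbb{R}$ and let $\mathcal{D}_\gamma$ be the set of smooth, compactly supported vector fields $u:\mathbb{R}^3\to\mathbb{R}^3$ with $u(0)=0$ if $\gamma\le-\tfrac12$. In spherical coordinates $x=\rho(\cos\theta,\sin\theta\cos\varphi,\sin\theta\sin\varphi)$ put $e_\varphi=(0,-\sin\varphi,\cos\varphi)$ (off the axis $x_2=x_3=0$; on it swirl parts are taken to be $0$) and let $u_\varphi e_\varphi$, with $u_\varphi=u\cdot e_\varphi$, be the swirl part of $u$. Consider the inequality $$C\int_{\mathbb{R}^3}|u|^2|x|^{2\gamma-2}\,dx\le\int_{\mathbb{R}^3}|\nabla u|^2|x|^{2\gamma}\,dx,\qquad(*)$$ where the integrals take values in $[0,\infty]$. (1) The largest constant $C$ for which $(*)$ holds for all divergence-free, swirl-free ($u_\varphi e_\varphi\equiv0$) fields $u\in\mathcal{D}_\gamma$ is $$C_{\gamma,0}=\left(\gamma+\tfrac12\right)^2+2+\min_{x\ge0}\left(x+\frac{8(\gamma-1)}{x+2+(\gamma-\frac32)^2}\right),$$ and the minimum is attained. Explicitly, $C_{\gamma,0}=\left(2\sqrt{\gamma-1}+\sqrt2\right)^2$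 if $\tfrac32\le\gamma\le\gamma_0$, and $C_{\gamma,0}=\left(\gamma+\tfrac12\right)^2\dfrac{4+(\gamma-\frac32)^2}{2+(\gamma-\frac32)^2}$ otherwise, where $$\gamma_0=\tfrac32+\left(4+\tfrac{4\sqrt{31}}{3^{3/2}}\right)^{1/3}-\frac{4}{3\left(4+\frac{4\sqrt{31}}{3^{3/2}}\right)^{1/3}}\approx2.8646556,$$ with $|\gamma_0-2.8646556|<10^{-7}$. (2) Let $g$ be a scalar function independent of $\varphi$ such that $\mathbf{g}=g\,e_\varphi$ is not identically zero and belongs to $\mathcal{D}_\gamma$, and let $\mathcal{G}$ be the set of divergence-free $u\in\mathcal{D}_\gamma$ with swirl part $\mathbf{g}$. If $\int|\nabla\mathbf{g}|^2|x|^{2\gamma}dx<\infty$, then $0<\int|\mathbf{g}|^2|x|^{2\gamma-2}dx<\infty$, and the largest constant $C$ for which $(*)$ holds for all $u\in\mathcal{G}$ is $$C_{\gamma,g}=\min\left\{C_{\gamma,0},\ \frac{\int_{\mathbb{R}^3}|\nabla\mathbf{g}|^2|x|^{2\gamma}dx}{\int_{\mathbb{R}^3}|\mathbf{g}|^2|x|^{2\gamma-2}dx}\right\}.$$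 If $\int|\nabla\mathbf{g}|^2|x|^{2\gamma}dx=\infty$, then the right-hand side of $(*)$ is infinite for every $u\in\mathcal{G}$, so that $(*)$ holds trivially for every $C$. -/

import Mathlib

open MeasureTheory Set
open scoped ENNReal ContDiff

noncomputable section

namespace HardyLeray

/-- Euclidean three-space; the coordinates `x 0, x 1, x 2` are $x_1, x_2, x_3$. -/
abbrev E3 : Type := EuclideanSpace ℝ (Fin 3)

/-- Smooth compactly supported vector fields on `ℝ³` that vanish at the origin
when `γ ≤ 1 - 3/2 = -1/2`. -/
def testFields (γ : ℝ) : Set (E3 → E3) :=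
  {u | ContDiff ℝ ∞ u ∧ HasCompactSupport u ∧ (γ ≤ -(1 / 2) → u 0 = 0)}

/-- The partial derivative `∂ⱼ u`. -/
def pderiv (j : Fin 3) (u : E3 → E3) (x : E3) : E3 :=
  fderiv ℝ u x (EuclideanSpace.single j 1)

/-- The divergence of a vector field. -/
def divergence (u : E3 → E3) (x : E3) : ℝ := ∑ j, pderiv j u x j

/-- `|∇u|² = ∑ᵢⱼ (∂ⱼ uᵢ)²`. -/
def gradSq (u : E3 → E3) (x : E3) : ℝ := ∑ i, ∑ j, (pderiv j u x i) ^ 2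

/-- `∫ |u|² |x|^(2γ-2) dx`, with values in `[0, ∞]`. -/
def hardyIntegral (γ : ℝ) (u : E3 → E3) : ℝ≥0∞ :=
  ∫⁻ x, ENNReal.ofReal (‖u x‖ ^ 2 * ‖x‖ ^ (2 * γ - 2))

/-- `∫ |∇u|² |x|^(2γ) dx`, with values in `[0, ∞]`. -/
def gradIntegral (γ : ℝ) (u : E3 → E3) : ℝ≥0∞ :=
  ∫⁻ x, ENNReal.ofReal (gradSq u x * ‖x‖ ^ (2 * γ))

/-- The Hardy–Leray inequality with weight `γ` and constant `C` for the field `u`. -/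
def HardyLerayIneq (γ C : ℝ) (u : E3 → E3) : Prop :=
  ENNReal.ofReal C * hardyIntegral γ u ≤ gradIntegral γ u

/-- The azimuthal unit vector `e_φ = (0, -sin φ, cos φ)` at
`x = ρ (cos θ, sin θ cos φ, sin θ sin φ)`. On the axis `x 1 = x 2 = 0`, where `φ` is not
defined, it is set to be `0`. -/
def ePhi (x : E3) : E3 :=
  (Real.sqrt (x 1 ^ 2 + x 2 ^ 2))⁻¹ • !₂[0, -(x 2), x 1]

/-- The swirl component `u_φ = u · e_φ`. -/
def swirlComponent (u : E3 → E3) (x : E3) : ℝ := inner ℝ (u x) (ePhi x)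

/-- The swirl part `u_φ e_φ`. -/
def swirlPart (u : E3 → E3) (x : E3) : E3 := swirlComponent u x • ePhi x

/-- The scalar function `g` does not depend on `φ`: it has the same value at any two points
with the same `ρ` and `θ`, that is, on each circle around the `x 0`-axis. -/
def IndepOfPhi (g : E3 → ℝ) : Prop :=
  ∀ x y : E3, x 0 = y 0 → x 1 ^ 2 + x 2 ^ 2 = y 1 ^ 2 + y 2 ^ 2 → g x = g y

/-- The function whose minimum over `x ≥ 0` enters the constant. -/
def auxFun (γ x : ℝ) : ℝ := x + 8 * (γ - 1) / (x + 2 + (γ - 3 / 2) ^ 2)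

/-- The constant `C_{γ,0} = (γ+1/2)² + 2 + min_{x ≥ 0} auxFun γ x`. -/
def constSwirlFree (γ : ℝ) : ℝ := (γ + 1 / 2) ^ 2 + 2 + sInf (auxFun γ '' Ici 0)

/-- The threshold `γ₀`. -/
def gammaZero : ℝ :=
  3 / 2 + (4 + 4 * Real.sqrt 31 / (3 : ℝ) ^ (3 / 2 : ℝ)) ^ (1 / 3 : ℝ)
    - 4 / (3 * (4 + 4 * Real.sqrt 31 / (3 : ℝ) ^ (3 / 2 : ℝ)) ^ (1 / 3 : ℝ))

/-- Solenoidal, swirl-free fields in the test class. -/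
def swirlFreeFields (γ : ℝ) : Set (E3 → E3) :=
  {u | u ∈ testFields γ ∧ (∀ x, divergence u x = 0) ∧ ∀ x, swirlPart u x = 0}

/-- Solenoidal fields in the test class with prescribed swirl part `G`. -/
def fieldsWithSwirl (γ : ℝ) (G : E3 → E3) : Set (E3 → E3) :=
  {u | u ∈ testFields γ ∧ (∀ x, divergence u x = 0) ∧ ∀ x, swirlPart u x = G x}

/-- `C_{γ,g} = min {C_{γ,0}, ∫|∇G|²|x|^(2γ) / ∫|G|²|x|^(2γ-2)}` where `G = g e_φ`. -/
def constWithSwirl (γ : ℝ) (G : E3 → E3) : ℝ :=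
  min (constSwirlFree γ) ((gradIntegral γ G).toReal / (hardyIntegral γ G).toReal)

end HardyLeray

end

open MeasureTheory Set
open scoped ENNReal ContDiff

namespace HardyLeray

/-! In the variables `t = log ρ` and `θ`, put `k = γ + 1/2`, `a = 3/2 - γ`, `F = exp(kt) u_ρ` and `H
= exp(kt) u_θ`. The weights then disappear and both integrals become translation invariant in `t`. A
swirl-free field need not be axisymmetric, but on each meridian half-plane `(F, H)` satisfies the
axisymmetric divergence equation `Ft + aF + Hθ + cot θ H = 0`, and the squares containing
`φ`-derivatives of `u_ρ`, `u_θ` may be discarded. It is therefore enough to prove the inequality on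
every half-plane separately.

On a half-plane two Poincaré inequalities with constant 2 are available: one for `H` against its
spherical divergence, which equals `-(Ft + aF)`, and one for `F`, whose flux through each
half-circle is zero. `exists_certificate` provides coefficients for which energy minus `C_{γ,0}(F² +
H²)` is, up to an exact `θ`-derivative, a `t`-derivative plus squares plus nonnegative multiples of
the two Poincaré deficits (`MeridianField.polarInt_deriv_le`). Integration in `t` gives
`MeridianField.sharp_ineq`. The flux is integrable because finite energy forces a finite
zeroth-order integral (`exists_ray_bound`); this is where `u 0 = 0` for `γ ≤ -1/2` is needed.

The constant is optimal because of degree-one fields, `u_ρ ∝ cos θ` and `u_θ ∝ sin θ`, built from a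
stream function of `|x|`. Oscillation at frequency `w` in `t` under a slowly varying envelope
produces the quotient `k² + 2 + auxFun γ (w²)` (`le_symbol`), so the variable minimised over is a
squared frequency.

An axisymmetric swirl is pointwise orthogonal to a swirl-free field, and their gradients interact
only through an exact `φ`-derivative (`hasDerivAt_interaction`). Both integrals are thus additive.
Scaling up the swirl-free part, or setting it to zero, gives the two entries of the minimum. -/

/-! ### The threshold and the scalar minimisation -/

/-- Cardano's formula for `d³ + 4d - 8`: the cube `4 + s` of the radical solves `z² - 8z - 64/27 =
0`. Since the cubic is increasing, comparisons with `gammaZero` become polynomial sign conditions.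
-/
lemma gammaZero_cubic : (gammaZero - 3 / 2) ^ 3 + 4 * (gammaZero - 3 / 2) - 8 = 0 := by
  set s : ℝ := 4 * Real.sqrt 31 / (3 : ℝ) ^ (3 / 2 : ℝ) with hs
  have hs0 : 0 < s := by positivity
  have hs2 : s ^ 2 = 16 * 31 / 27 := by
    have h3 : ((3 : ℝ) ^ (3 / 2 : ℝ)) ^ 2 = 27 := by
      rw [← Real.rpow_natCast, ← Real.rpow_mul (by norm_num)]; norm_num
    rw [hs, div_pow, mul_pow, h3, Real.sq_sqrt (by norm_num)]; norm_num
  set c : ℝ := (4 + s) ^ (1 / 3 : ℝ) with hc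
  have hc0 : 0 < c := by positivity
  have hc3 : c ^ 3 = 4 + s := by
    rw [hc, ← Real.rpow_natCast, ← Real.rpow_mul (by positivity)]; norm_num
  have hd : gammaZero - 3 / 2 = c - 4 / (3 * c) := by
    simp only [gammaZero, ← hs, ← hc]; ring
  rw [hd]
  have : (c - 4 / (3 * c)) ^ 3 + 4 * (c - 4 / (3 * c)) - 8
      = ((c ^ 3) ^ 2 - 8 * c ^ 3 - 64 / 27) / c ^ 3 := by
    field_simp; ring
  rw [this, hc3, show (4 + s) ^ 2 - 8 * (4 + s) - 64 / 27 = 0 by linear_combination hs2, zero_div]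

lemma cubic_lt_cubic {d e : ℝ} (h : d < e) : d ^ 3 + 4 * d - 8 < e ^ 3 + 4 * e - 8 := by
  nlinarith [sq_nonneg (d + e), sq_nonneg d, sq_nonneg e, sq_nonneg (d - e)]

lemma cubic_nonpos_iff {d : ℝ} : d ^ 3 + 4 * d - 8 ≤ 0 ↔ d ≤ gammaZero - 3 / 2 := by
  have h0 := gammaZero_cubic
  constructor
  · intro h
    by_contra! hlt
    have := cubic_lt_cubic hlt
    linarith
  · intro h
    rcases h.eq_or_lt with rfl | hlt
    · exact h0.le
    · have := cubic_lt_cubic hlt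
      linarith

lemma abs_gammaZero_sub_lt : |gammaZero - 2.8646556| < 0.0000001 := by
  have h1 : ¬ (gammaZero - 3 / 2 ≤ 1.3646555) := by
    intro h
    have h0 := gammaZero_cubic
    rcases h.eq_or_lt with h | h
    · rw [h] at h0; norm_num at h0
    · have := cubic_lt_cubic h
      norm_num at this; linarith
  have h2 : ¬ (1.3646557 ≤ gammaZero - 3 / 2) := by
    intro h
    have := cubic_nonpos_iff.2 h
    norm_num at this
  rw [abs_lt]
  constructor <;> norm_num at h1 h2 ⊢ <;> linarith

/-- The point at which `auxFun γ` attains its minimum over `[0, ∞)`. -/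
noncomputable def auxArgmin (γ : ℝ) : ℝ :=
  if 3 / 2 ≤ γ ∧ γ ≤ gammaZero then √(8 * (γ - 1)) - 2 - (γ - 3 / 2) ^ 2 else 0

/-- The free critical point of `auxFun γ` is where `x + 2 + (γ - 3/2)²` equals `√(8(γ - 1))`; the
quartic inequality says that it lies in `[0, ∞)`. The quartic difference factors as `d (d³ + 4d -
8)` with `d = γ - 3/2`, which explains both endpoints of the interval. -/
lemma quartic_le_iff (γ : ℝ) :
    (2 + (γ - 3 / 2) ^ 2) ^ 2 ≤ 8 * (γ - 1) ↔ 3 / 2 ≤ γ ∧ γ ≤ gammaZero := by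
  have key : (2 + (γ - 3 / 2) ^ 2) ^ 2 - 8 * (γ - 1)
      = (γ - 3 / 2) * ((γ - 3 / 2) ^ 3 + 4 * (γ - 3 / 2) - 8) := by ring
  have hg : γ ≤ gammaZero ↔ γ - 3 / 2 ≤ gammaZero - 3 / 2 := by simp
  rw [hg, ← cubic_nonpos_iff, ← sub_nonpos, key]
  constructor
  · intro h
    have h0 : 3 / 2 ≤ γ := by
      by_contra! hlt
      have : (γ - 3 / 2) ^ 3 + 4 * (γ - 3 / 2) - 8 < 0 := by
        nlinarith [sq_nonneg (γ - 3 / 2)]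
      nlinarith
    refine ⟨h0, ?_⟩
    rcases h0.eq_or_lt with h1 | h1
    · rw [← h1]; norm_num
    · by_contra! h2
      nlinarith [mul_pos (sub_pos.2 h1) h2]
  · rintro ⟨h1, h2⟩
    exact mul_nonpos_of_nonneg_of_nonpos (by linarith) h2

lemma auxArgmin_nonneg (γ : ℝ) : 0 ≤ auxArgmin γ := by
  unfold auxArgmin
  split_ifs with h
  · have := Real.le_sqrt_of_sq_le ((quartic_le_iff γ).2 h)
    linarith
  · rfl

lemma auxFun_auxArgmin_le (γ : ℝ) {x : ℝ} (hx : 0 ≤ x) : auxFun γ (auxArgmin γ) ≤ auxFun γ x := by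
  have hx' : 0 < x + 2 + (γ - 3 / 2) ^ 2 := by positivity
  unfold auxArgmin
  split_ifs with h
  · have h8 : 0 < 8 * (γ - 1) := by linarith [h.1]
    set y := √(8 * (γ - 1)) with hy
    have hy0 : 0 < y := Real.sqrt_pos.2 h8
    have hy2 : y ^ 2 = 8 * (γ - 1) := Real.sq_sqrt h8.le
    have e1 : auxFun γ (y - 2 - (γ - 3 / 2) ^ 2) = 2 * y - 2 - (γ - 3 / 2) ^ 2 := by
      unfold auxFun
      rw [← hy2, show y - 2 - (γ - 3 / 2) ^ 2 + 2 + (γ - 3 / 2) ^ 2 = y by ring]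
      field_simp; ring
    rw [e1, auxFun, ← hy2, ← sub_nonneg]
    -- AM-GM for `x + 2 + (γ - 3/2)²` and its quotient into `y²`: the excess over the minimum is a
    -- perfect square over a positive denominator.
    have : x + y ^ 2 / (x + 2 + (γ - 3 / 2) ^ 2) - (2 * y - 2 - (γ - 3 / 2) ^ 2)
      = (x + 2 + (γ - 3 / 2) ^ 2 - y) ^ 2 / (x + 2 + (γ - 3 / 2) ^ 2) := by
      field_simp; ring
    rw [this]; positivity
  · rw [← quartic_le_iff] at h
    push Not at h
    have h0 : 0 < 2 + (γ - 3 / 2) ^ 2 := by positivity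
    rw [auxFun, auxFun, ← sub_nonneg]
    have : x + 8 * (γ - 1) / (x + 2 + (γ - 3 / 2) ^ 2)
        - (0 + 8 * (γ - 1) / (0 + 2 + (γ - 3 / 2) ^ 2))
      = x * ((x + 2 + (γ - 3 / 2) ^ 2) * (2 + (γ - 3 / 2) ^ 2) - 8 * (γ - 1))
        / ((x + 2 + (γ - 3 / 2) ^ 2) * (2 + (γ - 3 / 2) ^ 2)) := by
      rw [zero_add 2]; field_simp; ring
    rw [this]
    refine div_nonneg (mul_nonneg hx ?_) (by positivity)
    nlinarith [mul_nonneg hx h0.le]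

lemma constSwirlFree_eq (γ : ℝ) :
    constSwirlFree γ = (γ + 1 / 2) ^ 2 + 2 + auxFun γ (auxArgmin γ) := by
  have : IsLeast (auxFun γ '' Ici 0) (auxFun γ (auxArgmin γ)) :=
    ⟨⟨_, auxArgmin_nonneg γ, rfl⟩, by rintro _ ⟨x, hx, rfl⟩; exact auxFun_auxArgmin_le γ hx⟩
  rw [constSwirlFree, this.csInf_eq]

lemma constSwirlFree_eq_interior {γ : ℝ} (h : 3 / 2 ≤ γ ∧ γ ≤ gammaZero) :
    constSwirlFree γ = (γ + 1 / 2) ^ 2 + 2 * √(8 * (γ - 1)) - (γ - 3 / 2) ^ 2 := by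
  have h8 : 0 < 8 * (γ - 1) := by linarith [h.1]
  rw [constSwirlFree_eq, auxArgmin, if_pos h, auxFun]
  have hy0 : 0 < √(8 * (γ - 1)) := Real.sqrt_pos.2 h8
  have hy2 : √(8 * (γ - 1)) ^ 2 = 8 * (γ - 1) := Real.sq_sqrt h8.le
  rw [show √(8 * (γ - 1)) - 2 - (γ - 3 / 2) ^ 2 + 2 + (γ - 3 / 2) ^ 2 = √(8 * (γ - 1)) by ring]
  nth_rw 2 [← hy2]
  field_simp; ring

lemma constSwirlFree_eq_boundary {γ : ℝ} (h : ¬ (3 / 2 ≤ γ ∧ γ ≤ gammaZero)) :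
    constSwirlFree γ = (γ + 1 / 2) ^ 2 + 2 * (γ + 1 / 2) ^ 2 / (2 + (γ - 3 / 2) ^ 2) := by
  have h0 : 0 < 2 + (γ - 3 / 2) ^ 2 := by positivity
  rw [constSwirlFree_eq, auxArgmin, if_neg h, auxFun]
  rw [zero_add 2]; field_simp; ring

lemma constSwirlFree_explicit_interior {γ : ℝ} (h : 3 / 2 ≤ γ ∧ γ ≤ gammaZero) :
    constSwirlFree γ = (2 * Real.sqrt (γ - 1) + Real.sqrt 2) ^ 2 := by
  have h1 : 0 ≤ γ - 1 := by linarith [h.1]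
  rw [constSwirlFree_eq_interior h]
  have : √(8 * (γ - 1)) = 2 * (√2 * √(γ - 1)) := by
    rw [← Real.sqrt_mul (by norm_num), show 8 * (γ - 1) = 2 ^ 2 * (2 * (γ - 1)) by ring,
      Real.sqrt_mul (by norm_num), Real.sqrt_sq (by norm_num)]
  rw [this]
  linear_combination -4 * Real.sq_sqrt h1 - Real.sq_sqrt (show (0 : ℝ) ≤ 2 by norm_num)

lemma constSwirlFree_explicit_boundary {γ : ℝ} (h : ¬ (3 / 2 ≤ γ ∧ γ ≤ gammaZero)) :
    constSwirlFree γ = (γ + 1 / 2) ^ 2 * ((4 + (γ - 3 / 2) ^ 2) / (2 + (γ - 3 / 2) ^ 2)) := by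
  have h0 : 0 < 2 + (γ - 3 / 2) ^ 2 := by positivity
  rw [constSwirlFree_eq_boundary h]; field_simp; ring

lemma constSwirlFree_nonneg (γ : ℝ) : 0 ≤ constSwirlFree γ := by
  by_cases h : 3 / 2 ≤ γ ∧ γ ≤ gammaZero
  · rw [constSwirlFree_explicit_interior h]; positivity
  · rw [constSwirlFree_explicit_boundary h]; positivity

/-! ### The sum-of-squares certificate -/

/-- Coefficients of the sum-of-squares decomposition behind the sharp inequality. -/
lemma exists_certificate (γ : ℝ) : ∃ α β μ ν ξ : ℝ, 0 ≤ μ ∧ 0 ≤ ν ∧ 0 ≤ ξ ∧ ν + β ^ 2 = 1 ∧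
    -2 * β + μ + ξ = 2 ∧ α ^ 2 - 2 * μ = -(constSwirlFree γ - (γ + 1 / 2) ^ 2) ∧
    2 * α * β * (3 / 2 - γ) + (3 / 2 - γ) ^ 2 * μ - 2 * ν
      = (3 / 2 - γ) ^ 2 - 4 * (3 / 2 - γ) + 2 - (constSwirlFree γ - (γ + 1 / 2) ^ 2) := by
  by_cases h : 3 / 2 ≤ γ ∧ γ ≤ gammaZero
  · have h8 : 0 < 8 * (γ - 1) := by linarith [h.1]
    have hy0 : 0 < √(8 * (γ - 1)) := Real.sqrt_pos.2 h8
    have hy2 : √(8 * (γ - 1)) ^ 2 = 8 * (γ - 1) := Real.sq_sqrt h8.le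
    -- Here `γ ≤ γ₀ < 3` suffices; the bound makes `ν = 1 - (1 - y/2)²` nonnegative.
    have hy4 : √(8 * (γ - 1)) ≤ 4 := by
      rw [Real.sqrt_le_left (by norm_num)]
      have := abs_lt.1 abs_gammaZero_sub_lt
      have h2 := h.2
      norm_num at this; linarith
    rw [constSwirlFree_eq_interior h]
    set y := √(8 * (γ - 1))
    -- The extremal oscillates in `t`, so `ξ = 0` is forced. With `α = -a` and `β = y/2 - 1` the
    -- square `(Ht + αH + βFθ)²` vanishes exactly on degree-one modes with `Ftt = (a² - 2β) F`,
    -- whose squared frequency is `auxArgmin γ`.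
    refine ⟨-(3 / 2 - γ), -(1 - y / 2), y, 1 - (1 - y / 2) ^ 2, 0, hy0.le, ?_, le_rfl,
      by ring, by ring, by ring, ?_⟩
    · nlinarith
    · linear_combination (1 / 2) * hy2
  · rw [constSwirlFree_eq_boundary h]
    have h0 : 0 < 2 + (γ - 3 / 2) ^ 2 := by positivity
    by_cases ha : γ ≤ 3 / 2
    -- Now the critical frequency is 0. Vanishing of the square on the `t`-independent degree-one
    -- field requires `β = α (γ - 3/2) / 2`; the choice `α = β = 0` is enough on this side.
    · refine ⟨0, 0, (γ + 1 / 2) ^ 2 / (2 + (γ - 3 / 2) ^ 2), 1,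
        2 - (γ + 1 / 2) ^ 2 / (2 + (γ - 3 / 2) ^ 2), by positivity, by norm_num, ?_, by norm_num,
        by ring, by ring, ?_⟩
      · rw [sub_nonneg, div_le_iff₀ h0]
        nlinarith
      · field_simp; ring
    · push Not at ha
      obtain ⟨d, rfl⟩ : ∃ d, γ = d + 3 / 2 := ⟨γ - 3 / 2, by ring⟩
      have hd : 0 < d := by linarith
      have hroot : 0 < d ^ 3 + 4 * d - 8 := by
        by_contra! hle
        exact h ⟨ha.le, by linarith [cubic_nonpos_iff.1 hle]⟩
      have hd1 : 1 < d := by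
        by_contra! hle
        nlinarith [pow_le_one₀ hd.le hle (n := 3)]
      rw [show d + 3 / 2 - 3 / 2 = d by ring] at *
      -- The same one-parameter family, `α = m` and `β = md/2`. Nonnegativity of `ν` means `(md)² ≤
      -- 4`, and `ξ`, the second expression here, is largest at `m = d`. Hence `m = d` while `d² ≤
      -- 2`, where `ξ` is a positive multiple of the cubic, and `m = 2/d` afterwards.
      obtain ⟨m, hm1, hm2⟩ : ∃ m : ℝ, (m * d) ^ 2 ≤ 4 ∧
          0 ≤ 2 + m * d - (d + 2) ^ 2 / (2 + d ^ 2) - m ^ 2 / 2 := by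
        rcases le_or_gt (d ^ 2) 2 with h2 | h2
        · refine ⟨d, by nlinarith, ?_⟩
          have : 2 + d * d - (d + 2) ^ 2 / (2 + d ^ 2) - d ^ 2 / 2
              = d * (d ^ 3 + 4 * d - 8) / (2 * (2 + d ^ 2)) := by
            field_simp; ring
          rw [this]; positivity
        · refine ⟨2 / d, by rw [div_mul_cancel₀ _ hd.ne']; norm_num, ?_⟩
          have : 2 + 2 / d * d - (d + 2) ^ 2 / (2 + d ^ 2) - (2 / d) ^ 2 / 2
              = (d ^ 2 * (3 * d ^ 2 - 4 * d + 2) - 4) / (d ^ 2 * (2 + d ^ 2)) := by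
            field_simp; ring
          rw [this]
          refine div_nonneg ?_ (by positivity)
          nlinarith [sq_nonneg (d - 3 / 2), mul_nonneg (sub_nonneg.2 h2.le) hd.le]
      refine ⟨m, m * d / 2, ((d + 2) ^ 2 / (2 + d ^ 2)) + m ^ 2 / 2, 1 - (m * d / 2) ^ 2,
        2 + m * d - (d + 2) ^ 2 / (2 + d ^ 2) - m ^ 2 / 2, by positivity, ?_, hm2, by ring,
        by ring, by ring, ?_⟩
      · nlinarith
      · field_simp; ring

/-! ### Poincaré inequalities on the polar arc -/

-- The form taken by integrations by parts in an angle: once a primitive `Φ` of the difference is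
-- given, what remains is an algebraic identity.
open Real Filter Topology intervalIntegral in
lemma integral_eq_of_sub_hasDerivAt {f g Φ : ℝ → ℝ} {a b : ℝ} (hf : Continuous f)
    (hg : Continuous g) (hΦ : ∀ x, HasDerivAt Φ (f x - g x) x) (hab : Φ a = Φ b) :
    ∫ x in a..b, f x = ∫ x in a..b, g x := by
  rw [← sub_eq_zero, ← integral_sub (hf.intervalIntegrable _ _) (hg.intervalIntegrable _ _),
    integral_eq_sub_of_hasDerivAt (fun x _ => hΦ x) ((hf.sub hg).intervalIntegrable _ _), hab,
    sub_self]

/-- `N` is `cot θ · H`, continued through the poles. The difference of `(H' + N)²` and `(H' - N)²`,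
times `sin θ`, is `4 cos θ H H'`, which is `2 H² sin θ` plus the derivative of `2 cos θ H²`.
Equality holds for multiples of `sin θ`. -/
lemma two_mul_integral_sq_le_integral_div_sq {H H' N : ℝ → ℝ}
    (hH : ∀ θ, HasDerivAt H (H' θ) θ) (cH' : Continuous H')
    (cN : Continuous N) (hN : ∀ θ, N θ * Real.sin θ = Real.cos θ * H θ) (h0 : H 0 = 0)
    (hπ : H Real.pi = 0) :
    2 * ∫ θ in 0..Real.pi, H θ ^ 2 * Real.sin θ
      ≤ ∫ θ in 0..Real.pi, (H' θ + N θ) ^ 2 * Real.sin θ := by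
  have cH : Continuous H := continuous_iff_continuousAt.2 fun x => (hH x).continuousAt
  have h1 : ∫ θ in 0..Real.pi, (H' θ + N θ) ^ 2 * Real.sin θ
      = ∫ θ in 0..Real.pi, ((H' θ - N θ) ^ 2 * Real.sin θ + 2 * (H θ ^ 2 * Real.sin θ)) := by
    refine integral_eq_of_sub_hasDerivAt (Φ := fun θ => 2 * Real.cos θ * H θ ^ 2)
      (by fun_prop) (by fun_prop) (fun θ => ?_) (by simp [h0, hπ])
    refine (((Real.hasDerivAt_cos θ).const_mul 2).mul ((hH θ).pow 2)).congr_deriv ?_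
    simp
    linear_combination (-4 * H' θ) * hN θ
  rw [h1, intervalIntegral.integral_add (Continuous.intervalIntegrable (by fun_prop) _ _)
    (Continuous.intervalIntegrable (by fun_prop) _ _), intervalIntegral.integral_const_mul]
  have : 0 ≤ ∫ θ in 0..Real.pi, (H' θ - N θ) ^ 2 * Real.sin θ :=
    intervalIntegral.integral_nonneg Real.pi_pos.le fun θ hθ =>
      mul_nonneg (sq_nonneg _) (Real.sin_nonneg_of_mem_Icc hθ)
  linarith

open Filter Topology in
/-- The Poincaré inequality for zonal functions on the sphere with zero mean. -/
lemma two_mul_integral_sq_le_of_mean_zero {F F' : ℝ → ℝ} (hF : ∀ θ, HasDerivAt F (F' θ) θ)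
    (cF' : Continuous F') (hmean : ∫ θ in 0..Real.pi, F θ * Real.sin θ = 0) :
    2 * ∫ θ in 0..Real.pi, F θ ^ 2 * Real.sin θ
      ≤ ∫ θ in 0..Real.pi, F' θ ^ 2 * Real.sin θ := by
  have cF : Continuous F := continuous_iff_continuousAt.2 fun x => (hF x).continuousAt
  have cFs : Continuous fun θ => F θ * Real.sin θ := by fun_prop
  have iFs : ∀ a b, IntervalIntegrable (fun θ => F θ * Real.sin θ) volume a b :=
    fun a b => cFs.intervalIntegrable a b
  set B : ℝ → ℝ := fun θ => -∫ s in 0..θ, F s * Real.sin s with hB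
  have dB : ∀ θ, HasDerivAt B (-(F θ * Real.sin θ)) θ := fun θ =>
    (intervalIntegral.integral_hasDerivAt_right (iFs 0 θ)
      cFs.aestronglyMeasurable.stronglyMeasurableAtFilter cFs.continuousAt).neg
  obtain ⟨C, hC⟩ : ∃ C, ∀ θ ∈ Icc 0 Real.pi, ‖F θ‖ ≤ C :=
    isCompact_Icc.exists_bound_of_continuousOn cF.continuousOn
  have hC0 : 0 ≤ C := (norm_nonneg _).trans (hC 0 ⟨le_rfl, Real.pi_pos.le⟩)
  have hb : ∀ θ ∈ Icc 0 Real.pi, ∀ a ∈ Icc 0 θ, |∫ s in a..θ, F s * Real.sin s|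
      ≤ C * (Real.cos a - Real.cos θ) := by
    intro θ hθ a ha
    rw [← integral_sin, ← intervalIntegral.integral_const_mul, ← Real.norm_eq_abs]
    refine intervalIntegral.norm_integral_le_of_norm_le ha.2 (Eventually.of_forall fun s hs => ?_)
      (Continuous.intervalIntegrable (by fun_prop) _ _)
    have hs' : s ∈ Icc 0 Real.pi := ⟨ha.1.trans hs.1.le, hs.2.trans hθ.2⟩
    rw [norm_mul, Real.norm_of_nonneg (Real.sin_nonneg_of_mem_Icc hs')]
    exact mul_le_mul_of_nonneg_right (hC s hs') (Real.sin_nonneg_of_mem_Icc hs')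
  -- `B` is of order `sin² θ` at both poles; at `π` this is the zero-mean hypothesis.
  have hBbound : ∀ θ ∈ Icc 0 Real.pi, |B θ| ≤ C * Real.sin θ ^ 2 := by
    intro θ hθ
    have h1 : |B θ| ≤ C * (1 - Real.cos θ) := by
      have := hb θ hθ 0 ⟨le_rfl, hθ.1⟩
      rwa [Real.cos_zero, ← abs_neg] at this
    have h2 : |B θ| ≤ C * (1 + Real.cos θ) := by
      have h3 := hb Real.pi ⟨Real.pi_pos.le, le_rfl⟩ θ hθ
      have h4 : B θ = ∫ s in θ..Real.pi, F s * Real.sin s := by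
        have := intervalIntegral.integral_add_adjacent_intervals (iFs 0 θ) (iFs θ Real.pi)
        rw [hmean] at this
        simp only [hB]; linarith
      rw [Real.cos_pi] at h3
      rw [h4]; linarith
    rw [Real.sin_sq]
    rcases le_total 0 (Real.cos θ) with h | h
    · refine h1.trans (mul_le_mul_of_nonneg_left ?_ hC0)
      nlinarith [Real.cos_le_one θ]
    · refine h2.trans (mul_le_mul_of_nonneg_left ?_ hC0)
      nlinarith [Real.neg_one_le_cos θ]
  set q : ℝ → ℝ := fun θ => (F' θ ^ 2 - 2 * F θ ^ 2) * Real.sin θ with hq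
  have cq : Continuous q := by fun_prop
  set Q : ℝ → ℝ := fun θ => ∫ s in 0..θ, q s with hQ
  have dQ : ∀ θ, HasDerivAt Q (q θ) θ := fun θ =>
    intervalIntegral.integral_hasDerivAt_right (cq.intervalIntegrable 0 θ)
      cq.aestronglyMeasurable.stronglyMeasurableAtFilter cq.continuousAt
  -- A boundary term that vanishes at both poles and completes the integrand to squares. Both
  -- squares in `e` below are zero for the extremal `F = cos θ`, where `B = -sin² θ / 2`.
  set Ψ : ℝ → ℝ := fun θ => 4 * F θ * B θ + 4 * Real.cos θ * B θ ^ 2 / Real.sin θ ^ 2 with hΨ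
  have dΨ : ∀ θ ∈ Ioo 0 Real.pi, HasDerivAt Ψ (4 * F' θ * B θ - 4 * F θ ^ 2 * Real.sin θ
      - 4 * B θ ^ 2 / Real.sin θ - 8 * Real.cos θ * F θ * B θ / Real.sin θ
      - 8 * Real.cos θ ^ 2 * B θ ^ 2 / Real.sin θ ^ 3) θ := by
    intro θ hθ
    have hs : Real.sin θ ≠ 0 := (Real.sin_pos_of_mem_Ioo hθ).ne'
    refine ((((hF θ).const_mul 4).mul (dB θ)).add
      ((((Real.hasDerivAt_cos θ).const_mul 4).mul ((dB θ).pow 2)).div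
        ((Real.hasDerivAt_sin θ).pow 2) (pow_ne_zero 2 hs))).congr_deriv ?_
    simp
    field_simp
    ring
  have hmono : MonotoneOn (fun θ => Q θ - Ψ θ) (Ioo 0 Real.pi) := by
    refine monotoneOn_of_deriv_nonneg (convex_Ioo _ _)
      (fun θ hθ => ((dQ θ).sub (dΨ θ hθ)).continuousAt.continuousWithinAt)
      (fun θ hθ => ?_) (fun θ hθ => ?_)
    · rw [interior_Ioo] at hθ
      exact ((dQ θ).sub (dΨ θ hθ)).differentiableAt.differentiableWithinAt
    · rw [interior_Ioo] at hθ
      have hs : 0 < Real.sin θ := Real.sin_pos_of_mem_Ioo hθ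
      rw [HasDerivAt.deriv (f := fun θ => Q θ - Ψ θ) ((dQ θ).sub (dΨ θ hθ))]
      have e : q θ - (4 * F' θ * B θ - 4 * F θ ^ 2 * Real.sin θ
        - 4 * B θ ^ 2 / Real.sin θ - 8 * Real.cos θ * F θ * B θ / Real.sin θ
        - 8 * Real.cos θ ^ 2 * B θ ^ 2 / Real.sin θ ^ 3)
        = Real.sin θ * (F' θ - 2 * B θ / Real.sin θ) ^ 2
          + 2 * (F θ * Real.sin θ + 2 * Real.cos θ / Real.sin θ * B θ) ^ 2 / Real.sin θ := by
        simp only [hq]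
        field_simp
        ring
      rw [e]; positivity
  have hΨ0 : ∀ θ ∈ Ioo 0 Real.pi, |Ψ θ| ≤ 8 * C ^ 2 * Real.sin θ ^ 2 := by
    intro θ hθ
    have hs : 0 < Real.sin θ := Real.sin_pos_of_mem_Ioo hθ
    have h1 := hBbound θ (Ioo_subset_Icc_self hθ)
    have h2 := hC θ (Ioo_subset_Icc_self hθ)
    rw [Real.norm_eq_abs] at h2
    have h3 : |4 * F θ * B θ| ≤ 4 * C ^ 2 * Real.sin θ ^ 2 := by
      rw [abs_mul, abs_mul, abs_of_pos (by norm_num : (0 : ℝ) < 4)]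
      have := mul_le_mul h2 h1 (abs_nonneg _) hC0
      nlinarith
    have h4 : |4 * Real.cos θ * B θ ^ 2 / Real.sin θ ^ 2| ≤ 4 * C ^ 2 * Real.sin θ ^ 2 := by
      rw [abs_div, abs_of_pos (pow_pos hs 2), div_le_iff₀ (pow_pos hs 2), abs_mul, abs_mul,
        abs_of_pos (by norm_num : (0 : ℝ) < 4), abs_pow]
      have h5 := pow_le_pow_left₀ (abs_nonneg _) h1 2
      have h6 := mul_le_mul (Real.abs_cos_le_one θ) h5 (by positivity) zero_le_one
      nlinarith
    calc |Ψ θ| ≤ _ := abs_add_le _ _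
      _ ≤ _ := by linarith
  have cQ : Continuous Q := continuous_iff_continuousAt.2 fun x => (dQ x).continuousAt
  -- `Ψ` divides by `sin² θ`, so its value at the poles is replaced by one-sided limits;
  -- monotonicity is then compared through the midpoint `π/2`.
  have key : ∀ θ₀, Real.sin θ₀ = 0 → ∀ s : Set ℝ, s ⊆ Ioo 0 Real.pi →
      Tendsto (fun θ => Q θ - Ψ θ) (𝓝[s] θ₀) (𝓝 (Q θ₀)) := by
    intro θ₀ h0 s hs
    have h1 : Tendsto (fun θ => 8 * C ^ 2 * Real.sin θ ^ 2) (𝓝[s] θ₀) (𝓝 0) := by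
      have : Continuous fun θ => 8 * C ^ 2 * Real.sin θ ^ 2 := by fun_prop
      simpa [h0] using (this.continuousWithinAt (s := s) (x := θ₀)).tendsto
    have h2 : Tendsto Ψ (𝓝[s] θ₀) (𝓝 0) := by
      refine squeeze_zero_norm' ?_ h1
      filter_upwards [self_mem_nhdsWithin] with θ hθ using hΨ0 θ (hs hθ)
    simpa using cQ.continuousWithinAt.tendsto.sub h2
  have hmid : Real.pi / 2 ∈ Ioo 0 Real.pi := ⟨by positivity, by linarith [Real.pi_pos]⟩
  have hlow : Q 0 ≤ Q (Real.pi / 2) - Ψ (Real.pi / 2) := by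
    have : (𝓝[Ioo 0 (Real.pi / 2)] (0 : ℝ)).NeBot := left_nhdsWithin_Ioo_neBot hmid.1
    refine le_of_tendsto (key 0 Real.sin_zero (Ioo 0 (Real.pi / 2))
      (Ioo_subset_Ioo_right hmid.2.le)) ?_
    filter_upwards [self_mem_nhdsWithin] with θ hθ
    exact hmono ⟨hθ.1, hθ.2.trans hmid.2⟩ hmid hθ.2.le
  have hup : Q (Real.pi / 2) - Ψ (Real.pi / 2) ≤ Q Real.pi := by
    have : (𝓝[Ioo (Real.pi / 2) Real.pi] Real.pi).NeBot := right_nhdsWithin_Ioo_neBot hmid.2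
    refine ge_of_tendsto (key Real.pi Real.sin_pi (Ioo (Real.pi / 2) Real.pi)
      (Ioo_subset_Ioo_left hmid.1.le)) ?_
    filter_upwards [self_mem_nhdsWithin] with θ hθ
    exact hmono hmid ⟨hmid.1.trans hθ.1, hθ.2⟩ hθ.1.le
  have hfin : 0 ≤ ∫ θ in 0..Real.pi, q θ := by
    have : Q 0 = 0 := by simp [hQ]
    rw [this] at hlow
    exact hlow.trans hup
  have e : ∫ θ in 0..Real.pi, q θ = (∫ θ in 0..Real.pi, F' θ ^ 2 * Real.sin θ)
      - 2 * ∫ θ in 0..Real.pi, F θ ^ 2 * Real.sin θ := by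
    rw [← intervalIntegral.integral_const_mul, ← intervalIntegral.integral_sub
      (Continuous.intervalIntegrable (by fun_prop) _ _)
      (Continuous.intervalIntegrable (by fun_prop) _ _)]
    congr 1; ext θ; simp only [hq]; ring
  linarith

/-! ### Integration over the polar angle -/

/-- The integral of `A t` over the polar angle, with the weight `sin θ`. -/
noncomputable def polarInt (A : ℝ → ℝ → ℝ) (t : ℝ) : ℝ := ∫ θ in 0..Real.pi, A t θ * Real.sin θ

lemma continuous_slice {A : ℝ → ℝ → ℝ} (hA : Continuous (Function.uncurry A)) (t : ℝ) :
    Continuous (A t) :=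
  hA.comp (Continuous.prodMk_right t)

lemma continuous_mul_sin {A : ℝ → ℝ → ℝ} (hA : Continuous (Function.uncurry A)) :
    Continuous (Function.uncurry fun t θ => A t θ * Real.sin θ) :=
  hA.mul (Real.continuous_sin.comp continuous_snd)

lemma continuous_polarInt {A : ℝ → ℝ → ℝ} (hA : Continuous (Function.uncurry A)) :
    Continuous (polarInt A) :=
  intervalIntegral.continuous_parametric_intervalIntegral_of_continuous' (continuous_mul_sin hA) _ _

lemma polarInt_mono {A B : ℝ → ℝ → ℝ} (hA : Continuous (Function.uncurry A))
    (hB : Continuous (Function.uncurry B)) {t : ℝ} (h : ∀ θ, A t θ ≤ B t θ) :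
    polarInt A t ≤ polarInt B t :=
  intervalIntegral.integral_mono_on Real.pi_pos.le
    ((continuous_slice (continuous_mul_sin hA) t).intervalIntegrable _ _)
    ((continuous_slice (continuous_mul_sin hB) t).intervalIntegrable _ _) fun θ hθ =>
    mul_le_mul_of_nonneg_right (h θ) (Real.sin_nonneg_of_mem_Icc hθ)

lemma polarInt_nonneg {A : ℝ → ℝ → ℝ} {t : ℝ} (h : ∀ θ, 0 ≤ A t θ) : 0 ≤ polarInt A t :=
  intervalIntegral.integral_nonneg Real.pi_pos.le fun θ hθ =>
    mul_nonneg (h θ) (Real.sin_nonneg_of_mem_Icc hθ)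

lemma polarInt_add {A B : ℝ → ℝ → ℝ} (hA : Continuous (Function.uncurry A))
    (hB : Continuous (Function.uncurry B)) (t : ℝ) :
    polarInt (fun t θ => A t θ + B t θ) t = polarInt A t + polarInt B t := by
  simp only [polarInt, add_mul]
  exact intervalIntegral.integral_add
    ((continuous_slice (continuous_mul_sin hA) t).intervalIntegrable _ _)
    ((continuous_slice (continuous_mul_sin hB) t).intervalIntegrable _ _)

lemma polarInt_const_mul (c : ℝ) (A : ℝ → ℝ → ℝ) (t : ℝ) :
    polarInt (fun t θ => c * A t θ) t = c * polarInt A t := by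
  simp only [polarInt, mul_assoc]
  exact intervalIntegral.integral_const_mul _ _

lemma abs_polarInt_le {A B : ℝ → ℝ → ℝ} (hA : Continuous (Function.uncurry A))
    (hB : Continuous (Function.uncurry B)) {t : ℝ} (h : ∀ θ, |A t θ| ≤ B t θ) :
    |polarInt A t| ≤ polarInt B t := by
  rw [abs_le]
  refine ⟨?_, polarInt_mono hA hB fun θ => (le_abs_self _).trans (h θ)⟩
  have hB' : Continuous (Function.uncurry fun t θ => -1 * B t θ) := continuous_const.mul hB
  have := polarInt_mono (t := t) hB' hA fun θ => by linarith [neg_abs_le (A t θ), h θ]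
  rw [polarInt_const_mul] at this
  linarith

open Filter Topology in
lemma hasDerivAt_polarInt {A A' : ℝ → ℝ → ℝ} (hA : Continuous (Function.uncurry A))
    (hA' : Continuous (Function.uncurry A'))
    (h : ∀ t θ, HasDerivAt (fun t => A t θ) (A' t θ) t) (t : ℝ) :
    HasDerivAt (polarInt A) (polarInt A' t) t := by
  have cA := continuous_mul_sin hA
  have cA' := continuous_mul_sin hA'
  obtain ⟨C, hC⟩ := (isCompact_Icc (a := t - 1) (b := t + 1)).prod
    (isCompact_Icc (a := (0 : ℝ)) (b := Real.pi)) |>.exists_bound_of_continuousOn cA'.continuousOn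
  refine (intervalIntegral.hasDerivAt_integral_of_dominated_loc_of_deriv_le
    (F := fun t θ => A t θ * Real.sin θ) (F' := fun t θ => A' t θ * Real.sin θ)
    (bound := fun _ => C) (Icc_mem_nhds (show t - 1 < t by linarith) (show t < t + 1 by linarith))
    (Eventually.of_forall fun s => (continuous_slice cA s).aestronglyMeasurable)
    ((continuous_slice cA t).intervalIntegrable _ _)
    (continuous_slice cA' t).aestronglyMeasurable
    (Eventually.of_forall fun θ hθ s hs => ?_) intervalIntegrable_const
    (Eventually.of_forall fun θ _ s _ => (h s θ).mul_const _)).2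
  rw [uIoc_of_le Real.pi_pos.le] at hθ
  exact hC (s, θ) ⟨hs, hθ.1.le, hθ.2⟩

lemma lintegral_polar {A : ℝ → ℝ → ℝ} (hA : Continuous (Function.uncurry A)) {t : ℝ}
    (h : ∀ θ, 0 ≤ A t θ) :
    ∫⁻ θ in Ioo 0 Real.pi, ENNReal.ofReal (A t θ * Real.sin θ) = ENNReal.ofReal (polarInt A t) := by
  rw [polarInt, intervalIntegral.integral_of_le Real.pi_pos.le, integral_Ioc_eq_integral_Ioo]
  refine (ofReal_integral_eq_lintegral_ofReal ?_ ?_).symm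
  · exact ((continuous_slice (continuous_mul_sin hA) t).integrableOn_Icc).mono_set
      Ioo_subset_Icc_self
  · filter_upwards [ae_restrict_mem measurableSet_Ioo] with θ hθ
    exact mul_nonneg (h θ) (Real.sin_nonneg_of_mem_Icc (Ioo_subset_Icc_self hθ))

/-! ### The sharp inequality on a meridian half-plane -/

/-- The components `F`, `H` (radial, polar) of a weighted swirl-free solenoidal field on a
meridian half-plane in the coordinates `t = log ρ` and `θ`, with their partial derivatives. -/
structure MeridianField (a : ℝ) (F Ft Fθ Ftθ H Ht Hθ : ℝ → ℝ → ℝ) : Prop where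
  cF : Continuous (Function.uncurry F)
  cFt : Continuous (Function.uncurry Ft)
  cFθ : Continuous (Function.uncurry Fθ)
  cFtθ : Continuous (Function.uncurry Ftθ)
  cH : Continuous (Function.uncurry H)
  cHt : Continuous (Function.uncurry Ht)
  cHθ : Continuous (Function.uncurry Hθ)
  dF_t : ∀ t θ, HasDerivAt (fun t => F t θ) (Ft t θ) t
  dF_θ : ∀ t θ, HasDerivAt (F t) (Fθ t θ) θ
  dFθ_t : ∀ t θ, HasDerivAt (fun t => Fθ t θ) (Ftθ t θ) t
  dFt_θ : ∀ t θ, HasDerivAt (Ft t) (Ftθ t θ) θ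
  dH_t : ∀ t θ, HasDerivAt (fun t => H t θ) (Ht t θ) t
  dH_θ : ∀ t θ, HasDerivAt (H t) (Hθ t θ) θ
  div_eq : ∀ t θ, Real.sin θ * (Ft t θ + a * F t θ + Hθ t θ) + Real.cos θ * H t θ = 0
  H_zero : ∀ t, H t 0 = 0
  H_pi : ∀ t, H t Real.pi = 0
  F_eq_zero : ∃ T, ∀ θ, F T θ = 0

namespace MeridianField

variable {a : ℝ} {F Ft Fθ Ftθ H Ht Hθ : ℝ → ℝ → ℝ}

/-- The flux of the field through each half-circle vanishes. -/
lemma polarInt_eq_zero (h : MeridianField a F Ft Fθ Ftθ H Ht Hθ) (t : ℝ) : polarInt F t = 0 := by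
  have hd := hasDerivAt_polarInt h.cF h.cFt h.dF_t
  have hrel : ∀ t, polarInt Ft t = -a * polarInt F t := by
    intro t
    rw [← polarInt_const_mul]
    have cF := continuous_slice h.cF t
    have cFt := continuous_slice h.cFt t
    refine integral_eq_of_sub_hasDerivAt (Φ := fun θ => -H t θ * Real.sin θ)
      (by fun_prop) (by fun_prop) (fun θ => ?_) (by simp)
    refine ((h.dH_θ t θ).neg.mul (Real.hasDerivAt_sin θ)).congr_deriv ?_
    simp only [Pi.neg_apply]
    linear_combination (-1 : ℝ) * h.div_eq t θ
  -- Integrating the divergence equation over `θ` gives `(flux)' = -a · flux`, so `exp(at)` times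
  -- the flux is constant; it is zero at the height `T` where `F` vanishes.
  have hconst : ∀ t, HasDerivAt (fun t => Real.exp (a * t) * polarInt F t) 0 t := by
    intro t
    have he : HasDerivAt (fun t => Real.exp (a * t)) (Real.exp (a * t) * (a * 1)) t :=
      ((hasDerivAt_id t).const_mul a).exp
    refine (he.mul (hd t)).congr_deriv ?_
    rw [hrel]; ring
  obtain ⟨T, hT⟩ := h.F_eq_zero
  have h1 := is_const_of_deriv_eq_zero (fun t => (hconst t).differentiableAt)
    (fun t => (hconst t).deriv) t T
  have h2 : polarInt F T = 0 := by simp [polarInt, hT]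
  simpa [h2] using h1

/-- The energy density, with `cot θ · H` expressed by the divergence equation. -/
def energy (k a : ℝ) (F Ft Fθ H Ht Hθ : ℝ → ℝ → ℝ) (t θ : ℝ) : ℝ :=
  (Ft t θ - k * F t θ) ^ 2 + (Ht t θ - k * H t θ) ^ 2 + (Fθ t θ - H t θ) ^ 2
    + (Hθ t θ + F t θ) ^ 2 + (F t θ - (Ft t θ + a * F t θ + Hθ t θ)) ^ 2

lemma continuous_energy (h : MeridianField a F Ft Fθ Ftθ H Ht Hθ) (k : ℝ) :
    Continuous (Function.uncurry (energy k a F Ft Fθ H Ht Hθ)) := by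
  have h1 := h.cF
  have h2 := h.cFt
  have h3 := h.cFθ
  have h4 := h.cH
  have h5 := h.cHt
  have h6 := h.cHθ
  simp only [Function.uncurry_def] at *
  unfold energy
  fun_prop

/-- The flux density `Z` whose `t`-derivative is bounded by the deficit of the inequality. -/
lemma polarInt_deriv_le (h : MeridianField a F Ft Fθ Ftθ H Ht Hθ) {k C α β μ ν ξ : ℝ}
    (hμ : 0 ≤ μ) (hν : 0 ≤ ν) (hξ : 0 ≤ ξ) (e1 : ν + β ^ 2 = 1) (e2 : -2 * β + μ + ξ = 2)
    (e3 : α ^ 2 - 2 * μ = k ^ 2 - C)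
    (e4 : 2 * α * β * a + a ^ 2 * μ - 2 * ν = a ^ 2 - 4 * a + 2 + k ^ 2 - C) (t : ℝ) :
    polarInt (fun t θ => 2 * (-k - 2 + a + β * a - α * β - a * μ) * F t θ * Ft t θ
        + 2 * (-k - α) * H t θ * Ht t θ
        + -2 * β * (Ftθ t θ * H t θ + Fθ t θ * Ht t θ)) t
      + C * polarInt (fun t θ => F t θ ^ 2 + H t θ ^ 2) t
      ≤ polarInt (energy k a F Ft Fθ H Ht Hθ) t := by
  have h1 := h.cF
  have h2 := h.cFt
  have h3 := h.cFθ
  have h4 := h.cH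
  have h5 := h.cHt
  have h6 := h.cHθ
  have h7 := h.cFtθ
  have s1 := continuous_slice h1 t
  have s2 := continuous_slice h2 t
  have s3 := continuous_slice h3 t
  have s4 := continuous_slice h4 t
  have s5 := continuous_slice h5 t
  have s6 := continuous_slice h6 t
  have s7 := continuous_slice h7 t
  simp only [Function.uncurry_def] at h1 h2 h3 h4 h5 h6 h7
  -- The divergence equation identifies this `N` with `cot θ · H`, and makes `Hθ + N` equal to `-(Ft
  -- + aF)`.
  have hP1 := two_mul_integral_sq_le_integral_div_sq (N := fun θ => -(Ft t θ + a * F t θ + Hθ t θ))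
    (h.dH_θ t) s6 (by fun_prop) (fun θ => by linear_combination (-1 : ℝ) * h.div_eq t θ)
    (h.H_zero t) (h.H_pi t)
  have hP2 := two_mul_integral_sq_le_of_mean_zero (h.dF_θ t) s3 (h.polarInt_eq_zero t)
  have hsq : 0 ≤ ∫ θ in 0..Real.pi, ((Ht t θ + α * H t θ + β * Fθ t θ) ^ 2 + ξ * Ft t θ ^ 2)
      * Real.sin θ := intervalIntegral.integral_nonneg Real.pi_pos.le fun θ hθ =>
        mul_nonneg (by positivity) (Real.sin_nonneg_of_mem_Icc hθ)
  rw [← polarInt_const_mul, ← polarInt_add (by simp only [Function.uncurry_def]; fun_prop)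
    (by simp only [Function.uncurry_def]; fun_prop)]
  have hM : ∫ θ in 0..Real.pi, (Hθ t θ + -(Ft t θ + a * F t θ + Hθ t θ)) ^ 2 * Real.sin θ
      = ∫ θ in 0..Real.pi, (Ft t θ + a * F t θ) ^ 2 * Real.sin θ := by
    congr 1; ext θ; ring
  rw [hM] at hP1
  -- Modulo an exact `θ`-derivative the energy is the `t`-derivative, the main term, the squares and
  -- the two Poincaré deficits. The relations `e1`, `e2`, `e3`, `e4` match the coefficients of
  -- `Fθ²`, `Ft²`, `H²` and `F²`.
  have key : polarInt (energy k a F Ft Fθ H Ht Hθ) t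
      = ∫ θ in 0..Real.pi, ((2 * (-k - 2 + a + β * a - α * β - a * μ) * F t θ * Ft t θ
        + 2 * (-k - α) * H t θ * Ht t θ
        + -2 * β * (Ftθ t θ * H t θ + Fθ t θ * Ht t θ) + C * (F t θ ^ 2 + H t θ ^ 2)) * Real.sin θ
        + ((Ht t θ + α * H t θ + β * Fθ t θ) ^ 2 + ξ * Ft t θ ^ 2) * Real.sin θ
        + μ * ((Ft t θ + a * F t θ) ^ 2 * Real.sin θ - 2 * (H t θ ^ 2 * Real.sin θ))
        + ν * (Fθ t θ ^ 2 * Real.sin θ - 2 * (F t θ ^ 2 * Real.sin θ))) := by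
    refine integral_eq_of_sub_hasDerivAt (Φ := fun θ => (-2 - 2 * α * β) * F t θ * H t θ
      * Real.sin θ - H t θ ^ 2 * Real.cos θ + 2 * β * Ft t θ * H t θ * Real.sin θ)
      (by unfold energy; fun_prop) (by fun_prop) (fun θ => ?_) (by simp [h.H_zero, h.H_pi])
    refine ((((((h.dF_θ t θ).const_mul (-2 - 2 * α * β)).mul (h.dH_θ t θ)).mul
      (Real.hasDerivAt_sin θ)).sub (((h.dH_θ t θ).pow 2).mul (Real.hasDerivAt_cos θ))).add
      ((((h.dFt_θ t θ).const_mul (2 * β)).mul (h.dH_θ t θ)).mul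
      (Real.hasDerivAt_sin θ))).congr_deriv ?_
    simp only [energy, Nat.cast_ofNat, Nat.add_one_sub_one, pow_one, Pi.mul_apply, Pi.pow_apply]
    linear_combination ((-2 - 2 * α * β) * F t θ + 2 * β * Ft t θ - 2 * Hθ t θ) * h.div_eq t θ
      + (Real.sin θ * Fθ t θ ^ 2) * e1 + (Real.sin θ * Ft t θ ^ 2) * e2
      + (Real.sin θ * H t θ ^ 2) * e3 + (Real.sin θ * F t θ ^ 2) * e4
  rw [key, polarInt]
  have i1 := fun (f : ℝ → ℝ) (hf : Continuous f) => hf.intervalIntegrable (μ := volume) 0 Real.pi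
  rw [intervalIntegral.integral_add (i1 _ (by fun_prop)) (i1 _ (by fun_prop)),
    intervalIntegral.integral_add (i1 _ (by fun_prop)) (i1 _ (by fun_prop)),
    intervalIntegral.integral_add (i1 _ (by fun_prop)) (i1 _ (by fun_prop)),
    intervalIntegral.integral_const_mul, intervalIntegral.integral_const_mul,
    intervalIntegral.integral_sub (i1 _ (by fun_prop)) (i1 _ (by fun_prop)),
    intervalIntegral.integral_sub (i1 _ (by fun_prop)) (i1 _ (by fun_prop)),
    intervalIntegral.integral_const_mul, intervalIntegral.integral_const_mul]
  have := mul_nonneg hμ (sub_nonneg.2 hP1)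
  have := mul_nonneg hν (sub_nonneg.2 hP2)
  linarith

/-- The second derivative `Ftθ` is not controlled by the energy. Integration by parts in `θ`
followed by the divergence equation trades it for first-order terms, which makes the derivative of
the flux integrable in `t`. -/
lemma polarInt_mixed (h : MeridianField a F Ft Fθ Ftθ H Ht Hθ) (c₁ c₂ c₃ t : ℝ) :
    polarInt (fun t θ => 2 * c₁ * F t θ * Ft t θ + 2 * c₂ * H t θ * Ht t θ
        + c₃ * (Ftθ t θ * H t θ + Fθ t θ * Ht t θ)) t
      = polarInt (fun t θ => 2 * c₁ * F t θ * Ft t θ + 2 * c₂ * H t θ * Ht t θ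
        + c₃ * (Ft t θ * (Ft t θ + a * F t θ) + Fθ t θ * Ht t θ)) t := by
  have s1 := continuous_slice h.cF t
  have s2 := continuous_slice h.cFt t
  have s3 := continuous_slice h.cFθ t
  have s4 := continuous_slice h.cH t
  have s5 := continuous_slice h.cHt t
  have s7 := continuous_slice h.cFtθ t
  refine integral_eq_of_sub_hasDerivAt (Φ := fun θ => c₃ * Ft t θ * H t θ * Real.sin θ)
    (by fun_prop) (by fun_prop) (fun θ => ?_) (by simp)
  refine ((((h.dFt_θ t θ).const_mul c₃).mul (h.dH_θ t θ)).mul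
      (Real.hasDerivAt_sin θ)).congr_deriv ?_
  simp only [Pi.mul_apply]
  linear_combination (c₃ * Ft t θ) * h.div_eq t θ

lemma integrable_of_lintegral_ofReal_lt_top {f : ℝ → ℝ} (hf : Continuous f) (h0 : ∀ t, 0 ≤ f t)
    (h : ∫⁻ t, ENNReal.ofReal (f t) < ⊤) : Integrable f :=
  ⟨hf.aestronglyMeasurable, by
    rwa [hasFiniteIntegral_iff_ofReal (Filter.Eventually.of_forall h0)]⟩

lemma abs_const_mul_mul_le {x y S : ℝ} (c : ℝ) (hx : x ^ 2 ≤ S) (hy : y ^ 2 ≤ S) :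
    |c * (x * y)| ≤ |c| * S := by
  rw [abs_mul]
  exact mul_le_mul_of_nonneg_left (abs_le.2 ⟨by linarith [sq_nonneg (x + y)],
    by linarith [sq_nonneg (x - y)]⟩) (abs_nonneg c)

/-- The constant is the one in `abs_flux_deriv_le`, so that one integrable majorant serves the flux
and its derivative. -/
lemma abs_flux_le (c₁ c₂ c₃ a f h f' h' g : ℝ) :
    |c₁ * f ^ 2 + c₂ * h ^ 2 + c₃ * (g * h)| ≤ (1 + 4 * (|c₁| + |c₂| + |c₃|) * (1 + |a|))
      * (f ^ 2 + h ^ 2 + f' ^ 2 + h' ^ 2 + g ^ 2) := by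
  have q1 := sq_nonneg f
  have q2 := sq_nonneg h
  have q3 := sq_nonneg f'
  have q4 := sq_nonneg h'
  have q5 := sq_nonneg g
  set S := f ^ 2 + h ^ 2 + f' ^ 2 + h' ^ 2 + g ^ 2 with hS
  have hS0 : 0 ≤ S := by positivity
  have b1 := abs_const_mul_mul_le (x := f) (y := f) (S := S) c₁ (by linarith) (by linarith)
  have b2 := abs_const_mul_mul_le (x := h) (y := h) (S := S) c₂ (by linarith) (by linarith)
  have b3 := abs_const_mul_mul_le (x := g) (y := h) (S := S) c₃ (by linarith) (by linarith)
  have b4 := abs_add_three (c₁ * f ^ 2) (c₂ * h ^ 2) (c₃ * (g * h))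
  rw [← sq] at b1 b2
  have b5 : 0 ≤ 4 * (|c₁| + |c₂| + |c₃|) * |a| * S := by positivity
  have b6 : 0 ≤ 3 * (|c₁| + |c₂| + |c₃|) * S := by positivity
  linarith

lemma abs_flux_deriv_le (c₁ c₂ c₃ a f h f' h' g : ℝ) :
    |2 * c₁ * f * f' + 2 * c₂ * h * h' + c₃ * (f' * (f' + a * f) + g * h')|
      ≤ (1 + 4 * (|c₁| + |c₂| + |c₃|) * (1 + |a|))
      * (f ^ 2 + h ^ 2 + f' ^ 2 + h' ^ 2 + g ^ 2) := by
  have q1 := sq_nonneg f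
  have q2 := sq_nonneg h
  have q3 := sq_nonneg f'
  have q4 := sq_nonneg h'
  have q5 := sq_nonneg g
  set S := f ^ 2 + h ^ 2 + f' ^ 2 + h' ^ 2 + g ^ 2 with hS
  have hS0 : 0 ≤ S := by positivity
  have b1 := abs_const_mul_mul_le (x := f) (y := f') (S := S) c₁ (by linarith) (by linarith)
  have b2 := abs_const_mul_mul_le (x := h) (y := h') (S := S) c₂ (by linarith) (by linarith)
  have b3 := abs_const_mul_mul_le (x := f') (y := f') (S := S) c₃ (by linarith) (by linarith)
  have b4 := abs_const_mul_mul_le (x := f') (y := f) (S := S) (c₃ * a) (by linarith) (by linarith)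
  have b5 := abs_const_mul_mul_le (x := g) (y := h') (S := S) c₃ (by linarith) (by linarith)
  rw [abs_mul c₃ a] at b4
  have e : 2 * c₁ * f * f' + 2 * c₂ * h * h' + c₃ * (f' * (f' + a * f) + g * h')
      = 2 * (c₁ * (f * f')) + 2 * (c₂ * (h * h'))
        + (c₃ * (f' * f') + c₃ * a * (f' * f) + c₃ * (g * h')) := by ring
  rw [e]
  have b6 := abs_add_three (2 * (c₁ * (f * f'))) (2 * (c₂ * (h * h')))
    (c₃ * (f' * f') + c₃ * a * (f' * f) + c₃ * (g * h'))
  have b7 := abs_add_three (c₃ * (f' * f')) (c₃ * a * (f' * f)) (c₃ * (g * h'))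
  rw [abs_mul 2, abs_mul 2, abs_of_pos (by norm_num : (0 : ℝ) < 2)] at b6
  have p1 : 0 ≤ 2 * (|c₁| + |c₂| + |c₃|) * S := by positivity
  have p2 : 0 ≤ (4 * |c₁| + 4 * |c₂| + 3 * |c₃|) * |a| * S := by positivity
  linarith

/-- The sharp inequality on a meridian half-plane, given a sum-of-squares certificate. -/
theorem sharp_ineq (h : MeridianField a F Ft Fθ Ftθ H Ht Hθ) {k C α β μ ν ξ : ℝ}
    (hμ : 0 ≤ μ) (hν : 0 ≤ ν) (hξ : 0 ≤ ξ) (e1 : ν + β ^ 2 = 1) (e2 : -2 * β + μ + ξ = 2)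
    (e3 : α ^ 2 - 2 * μ = k ^ 2 - C)
    (e4 : 2 * α * β * a + a ^ 2 * μ - 2 * ν = a ^ 2 - 4 * a + 2 + k ^ 2 - C)
    (hfin : ∫⁻ t, ENNReal.ofReal (polarInt (fun t θ => F t θ ^ 2 + H t θ ^ 2) t) < ⊤)
    (hC : 0 ≤ C) :
    ENNReal.ofReal C * ∫⁻ t, ENNReal.ofReal (polarInt (fun t θ => F t θ ^ 2 + H t θ ^ 2) t)
      ≤ ∫⁻ t, ENNReal.ofReal (polarInt (energy k a F Ft Fθ H Ht Hθ) t) := by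
  rcases eq_top_or_lt_top (∫⁻ t, ENNReal.ofReal (polarInt (energy k a F Ft Fθ H Ht Hθ) t))
    with htop | hlt
  · rw [htop]; exact le_top
  have cE := h.continuous_energy k
  have h1 := h.cF
  have h2 := h.cFt
  have h3 := h.cFθ
  have h4 := h.cH
  have h5 := h.cHt
  have h6 := h.cHθ
  have h7 := h.cFtθ
  simp only [Function.uncurry_def] at h1 h2 h3 h4 h5 h6 h7
  have cJ : Continuous (Function.uncurry fun t θ => F t θ ^ 2 + H t θ ^ 2) := by
    simp only [Function.uncurry_def]; fun_prop
  have nE : ∀ t θ, 0 ≤ energy k a F Ft Fθ H Ht Hθ t θ := fun t θ => by unfold energy; positivity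
  have nJ : ∀ t θ, 0 ≤ F t θ ^ 2 + H t θ ^ 2 := fun t θ => by positivity
  have iE := integrable_of_lintegral_ofReal_lt_top (continuous_polarInt cE)
    (fun t => polarInt_nonneg (nE t)) hlt
  have iJ := integrable_of_lintegral_ofReal_lt_top (continuous_polarInt cJ)
    (fun t => polarInt_nonneg (nJ t)) hfin
  set c₁ := -k - 2 + a + β * a - α * β - a * μ with hc₁
  set c₂ := -k - α with hc₂
  set c₃ := -2 * β with hc₃
  set z : ℝ → ℝ → ℝ := fun t θ => c₁ * F t θ ^ 2 + c₂ * H t θ ^ 2 + c₃ * (Fθ t θ * H t θ) with hz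
  set z' : ℝ → ℝ → ℝ := fun t θ => 2 * c₁ * F t θ * Ft t θ + 2 * c₂ * H t θ * Ht t θ
        + c₃ * (Ftθ t θ * H t θ + Fθ t θ * Ht t θ) with hz'
  set z'' : ℝ → ℝ → ℝ := fun t θ => 2 * c₁ * F t θ * Ft t θ + 2 * c₂ * H t θ * Ht t θ
        + c₃ * (Ft t θ * (Ft t θ + a * F t θ) + Fθ t θ * Ht t θ) with hz''
  have cz : Continuous (Function.uncurry z) := by
    simp only [hz, Function.uncurry_def]; fun_prop
  have cz' : Continuous (Function.uncurry z') := by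
    simp only [hz', Function.uncurry_def]; fun_prop
  have cz'' : Continuous (Function.uncurry z'') := by
    simp only [hz'', Function.uncurry_def]; fun_prop
  have dz : ∀ t, HasDerivAt (polarInt z) (polarInt z' t) t :=
    hasDerivAt_polarInt cz cz' fun t θ => by
      refine (((((h.dF_t t θ).pow 2).const_mul c₁).add (((h.dH_t t θ).pow 2).const_mul c₂)).add
        (((h.dFθ_t t θ).mul (h.dH_t t θ)).const_mul c₃)).congr_deriv ?_
      simp [hz']; ring
  have ezz : ∀ t, polarInt z' t = polarInt z'' t := h.polarInt_mixed c₁ c₂ c₃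
  -- a common majorant for `z` and `z''`
  set D : ℝ := 1 + 4 * (|c₁| + |c₂| + |c₃|) * (1 + |a|) with hD
  set Y : ℝ → ℝ → ℝ := fun t θ => D * (2 * energy k a F Ft Fθ H Ht Hθ t θ
    + (3 + 2 * k ^ 2) * (F t θ ^ 2 + H t θ ^ 2)) with hY
  have cY : Continuous (Function.uncurry Y) := by
    simp only [Function.uncurry_def] at cE
    simp only [hY, Function.uncurry_def]; fun_prop
  have iY : Integrable (polarInt Y) := by
    have : polarInt Y = fun t => D * (2 * polarInt (energy k a F Ft Fθ H Ht Hθ) t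
        + (3 + 2 * k ^ 2) * polarInt (fun t θ => F t θ ^ 2 + H t θ ^ 2) t) := by
      ext t
      rw [hY, polarInt_const_mul, polarInt_add, polarInt_const_mul, polarInt_const_mul]
      · exact continuous_const.mul cE
      · exact continuous_const.mul cJ
    rw [this]
    exact ((iE.const_mul 2).add (iJ.const_mul _)).const_mul D
  -- Each shifted square is undone by `x² ≤ 2(x - cy)² + 2c²y²`.
  have hmaj : ∀ t θ, F t θ ^ 2 + H t θ ^ 2 + Ft t θ ^ 2 + Ht t θ ^ 2 + Fθ t θ ^ 2
      ≤ 2 * energy k a F Ft Fθ H Ht Hθ t θ + (3 + 2 * k ^ 2) * (F t θ ^ 2 + H t θ ^ 2) := by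
    intro t θ
    unfold energy
    linarith [sq_nonneg (Ft t θ - 2 * k * F t θ), sq_nonneg (Ht t θ - 2 * k * H t θ),
      sq_nonneg (Fθ t θ - 2 * H t θ), sq_nonneg (Hθ t θ + F t θ), sq_nonneg (F t θ),
      sq_nonneg (F t θ - (Ft t θ + a * F t θ + Hθ t θ))]
  have bz : ∀ t θ, |z t θ| ≤ Y t θ := fun t θ =>
    (abs_flux_le c₁ c₂ c₃ a _ _ (Ft t θ) (Ht t θ) _).trans
      (mul_le_mul_of_nonneg_left (hmaj t θ) (by positivity))
  have bz'' : ∀ t θ, |z'' t θ| ≤ Y t θ := fun t θ =>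
    (abs_flux_deriv_le c₁ c₂ c₃ a _ _ _ _ _).trans
      (mul_le_mul_of_nonneg_left (hmaj t θ) (by positivity))
  have iz : Integrable (polarInt z) :=
    iY.mono' (continuous_polarInt cz).aestronglyMeasurable
      (Filter.Eventually.of_forall fun t => abs_polarInt_le cz cY (bz t))
  have iz' : Integrable (polarInt z') := by
    refine iY.mono' (continuous_polarInt cz').aestronglyMeasurable
      (Filter.Eventually.of_forall fun t => ?_)
    rw [ezz]
    exact abs_polarInt_le cz'' cY (bz'' t)
  -- Flux and derivative are both integrable, hence no boundary term survives at `t = ±∞`, that is,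
  -- at the origin or at infinity.
  have hzero := integral_eq_zero_of_hasDerivAt_of_integrable dz iz' iz
  have hmono : ∫ t, (polarInt z' t + C * polarInt (fun t θ => F t θ ^ 2 + H t θ ^ 2) t)
      ≤ ∫ t, polarInt (energy k a F Ft Fθ H Ht Hθ) t :=
    integral_mono (iz'.add (iJ.const_mul C)) iE
      (h.polarInt_deriv_le hμ hν hξ e1 e2 e3 e4)
  rw [integral_add iz' (iJ.const_mul C), hzero, zero_add, integral_const_mul] at hmono
  rw [← ofReal_integral_eq_lintegral_ofReal iE
    (Filter.Eventually.of_forall fun t => polarInt_nonneg (nE t)),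
    ← ofReal_integral_eq_lintegral_ofReal iJ
    (Filter.Eventually.of_forall fun t => polarInt_nonneg (nJ t)), ← ENNReal.ofReal_mul hC]
  exact ENNReal.ofReal_le_ofReal hmono

end MeridianField

/-! ### Spherical coordinates and the moving frame -/

/-- Spherical coordinates with `ρ = exp t`. -/
noncomputable def sph (t θ φ : ℝ) : E3 :=
  !₂[Real.exp t * Real.cos θ, Real.exp t * (Real.sin θ * Real.cos φ),
    Real.exp t * (Real.sin θ * Real.sin φ)]

lemma measurePreserving_triple :
    MeasurePreserving (fun p : ℝ × ℝ × ℝ => (!₂[p.1, p.2.1, p.2.2] : E3))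
      (volume.prod (volume.prod volume)) volume := by
  have h1 := (volume_preserving_piFinSuccAbove (fun _ : Fin 3 => ℝ) 0).symm
  have h2 := (MeasurePreserving.id (volume : Measure ℝ)).prod (volume_preserving_finTwoArrow ℝ).symm
  have h3 := (PiLp.volume_preserving_toLp (Fin 3)).comp (h1.comp h2)
  have e : (fun p : ℝ × ℝ × ℝ => (!₂[p.1, p.2.1, p.2.2] : E3)) = WithLp.toLp 2 ∘
      (MeasurableEquiv.piFinSuccAbove (fun _ : Fin 3 => ℝ) 0).symm ∘
        Prod.map id MeasurableEquiv.finTwoArrow.symm :=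
    funext fun p => PiLp.ext fun i => by fin_cases i <;> rfl
  rw [e]
  exact h3

lemma lintegral_exp (f : ℝ → ℝ≥0∞) :
    ∫⁻ r in Ioi 0, f r = ∫⁻ t, ENNReal.ofReal (Real.exp t) * f (Real.exp t) := by
  have := lintegral_image_eq_lintegral_abs_deriv_mul (s := univ) MeasurableSet.univ
    (fun t _ => (Real.hasDerivAt_exp t).hasDerivWithinAt) Real.exp_injective.injOn f
  rw [image_univ, Real.range_exp] at this
  simpa [abs_of_pos, Real.exp_pos] using this

lemma lintegral_polar_coord {f : ℝ × ℝ → ℝ≥0∞} (hf : Measurable f) :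
    ∫⁻ p, f p = ∫⁻ r in Ioi 0, ∫⁻ φ in Ioo (-Real.pi) Real.pi,
      ENNReal.ofReal r * f (r * Real.cos φ, r * Real.sin φ) := by
  rw [← lintegral_comp_polarCoord_symm, polarCoord_target, Measure.volume_eq_prod,
    setLIntegral_prod]
  · rfl
  · simp only [smul_eq_mul, polarCoord_symm_apply]
    fun_prop

/-- Polar coordinates on a half-plane. -/
lemma lintegral_half_plane {g : ℝ → ℝ → ℝ≥0∞} (hg : Measurable (Function.uncurry g)) :
    ∫⁻ z, ∫⁻ r in Ioi 0, g z r = ∫⁻ t, ∫⁻ θ in Ioo 0 Real.pi,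
      ENNReal.ofReal (Real.exp (2 * t)) * g (Real.exp t * Real.cos θ) (Real.exp t * Real.sin θ) := by
  set f : ℝ × ℝ → ℝ≥0∞ := (Prod.snd ⁻¹' Ioi (0 : ℝ)).indicator (Function.uncurry g) with hf
  have mf : Measurable f := hg.indicator (measurable_snd measurableSet_Ioi)
  have h1 : ∫⁻ z, ∫⁻ r in Ioi 0, g z r = ∫⁻ p, f p := by
    rw [Measure.volume_eq_prod, lintegral_prod _ mf.aemeasurable]
    congr 1; ext z
    rw [← lintegral_indicator measurableSet_Ioi]
    rfl
  rw [h1, lintegral_polar_coord mf, lintegral_exp]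
  congr 1; ext t
  rw [← lintegral_const_mul' _ _ ENNReal.ofReal_ne_top, ← lintegral_indicator measurableSet_Ioo,
    ← lintegral_indicator measurableSet_Ioo]
  congr 1; ext θ
  have he := Real.exp_pos t
  by_cases h : θ ∈ Ioo 0 Real.pi
  · have h' : θ ∈ Ioo (-Real.pi) Real.pi := ⟨by linarith [h.1, h.2], h.2⟩
    have hs : (Real.exp t * Real.cos θ, Real.exp t * Real.sin θ) ∈ Prod.snd ⁻¹' Ioi (0 : ℝ) :=
      mul_pos he (Real.sin_pos_of_mem_Ioo h)
    rw [indicator_of_mem h, indicator_of_mem h', hf, indicator_of_mem hs, ← mul_assoc,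
      ← ENNReal.ofReal_mul he.le, ← Real.exp_add, two_mul]
    rfl
  · rw [indicator_of_notMem h]
    by_cases h' : θ ∈ Ioo (-Real.pi) Real.pi
    · have hs : (Real.exp t * Real.cos θ, Real.exp t * Real.sin θ) ∉ Prod.snd ⁻¹' Ioi (0 : ℝ) := by
        have h0 : θ ≤ 0 := by
          by_contra! h0
          exact h ⟨h0, h'.2⟩
        have := Real.sin_nonpos_of_nonpos_of_neg_pi_le h0 h'.1.le
        simp only [mem_preimage, mem_Ioi, not_lt]
        exact mul_nonpos_of_nonneg_of_nonpos he.le this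
      rw [indicator_of_mem h', hf, indicator_of_notMem hs]; simp
    · rw [indicator_of_notMem h']

/-- Plane polar coordinates are used twice: first in the last two variables, with radius `r`, then
in the half-plane of the first variable and `r`. The factors `r = exp t sin θ` and `exp (2t)`
multiply to the spherical density. -/
lemma lintegral_spherical {f : E3 → ℝ≥0∞} (hf : Measurable f) :
    ∫⁻ x, f x = ∫⁻ t, ∫⁻ θ in Ioo 0 Real.pi, ∫⁻ φ in Ioo (-Real.pi) Real.pi,
      ENNReal.ofReal (Real.exp (3 * t) * Real.sin θ) * f (sph t θ φ) := by
  have mT := measurePreserving_triple.measurable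
  have mf : Measurable fun p : ℝ × ℝ × ℝ => f !₂[p.1, p.2.1, p.2.2] := hf.comp mT
  rw [← measurePreserving_triple.lintegral_comp hf, lintegral_prod _ mf.aemeasurable]
  have h1 : ∀ z, ∫⁻ q : ℝ × ℝ, f !₂[z, q.1, q.2] ∂(volume.prod volume)
      = ∫⁻ r in Ioi 0, ∫⁻ φ in Ioo (-Real.pi) Real.pi,
        ENNReal.ofReal r * f !₂[z, r * Real.cos φ, r * Real.sin φ] := fun z =>
    lintegral_polar_coord (f := fun q => f !₂[z, q.1, q.2]) (mf.comp measurable_prodMk_left)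
  simp only [h1]
  rw [lintegral_half_plane (g := fun z r => ∫⁻ φ in Ioo (-Real.pi) Real.pi,
        ENNReal.ofReal r * f !₂[z, r * Real.cos φ, r * Real.sin φ])]
  · congr 1; ext t
    refine setLIntegral_congr_fun measurableSet_Ioo fun θ hθ => ?_
    rw [← lintegral_const_mul' _ _ ENNReal.ofReal_ne_top]
    congr 1; ext φ
    rw [← mul_assoc, ← ENNReal.ofReal_mul (Real.exp_pos _).le, ← mul_assoc, ← Real.exp_add, sph]
    congr 2
    · ring_nf
    · ring_nf
  · refine Measurable.lintegral_prod_right' (f := fun p : (ℝ × ℝ) × ℝ =>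
      ENNReal.ofReal p.1.2 * f !₂[p.1.1, p.1.2 * Real.cos p.2, p.1.2 * Real.sin p.2]) ?_
    refine (by fun_prop : Measurable fun p : (ℝ × ℝ) × ℝ => ENNReal.ofReal p.1.2).mul ?_
    exact mf.comp (g := fun q : ℝ × ℝ × ℝ => f !₂[q.1, q.2.1, q.2.2])
      (f := fun p : (ℝ × ℝ) × ℝ => (p.1.1, p.1.2 * Real.cos p.2, p.1.2 * Real.sin p.2))
      (by fun_prop)

lemma norm_sph (t θ φ : ℝ) : ‖sph t θ φ‖ = Real.exp t := by
  rw [EuclideanSpace.norm_eq, Real.sqrt_eq_iff_mul_self_eq (by positivity) (Real.exp_pos t).le]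
  simp only [sph, Fin.sum_univ_three, Real.norm_eq_abs, sq_abs]
  simp
  linear_combination (Real.exp t ^ 2 * Real.sin θ ^ 2) * Real.sin_sq_add_cos_sq φ
    + Real.exp t ^ 2 * Real.sin_sq_add_cos_sq θ

lemma hasDerivAt_comp_triple {u : E3 → E3} (hu : Differentiable ℝ u) {a b c : ℝ → ℝ}
    {a' b' c' s : ℝ} (ha : HasDerivAt a a' s) (hb : HasDerivAt b b' s) (hc : HasDerivAt c c' s)
    (i : Fin 3) :
    HasDerivAt (fun s => u !₂[a s, b s, c s] i)
      (a' * pderiv 0 u !₂[a s, b s, c s] i + b' * pderiv 1 u !₂[a s, b s, c s] i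
        + c' * pderiv 2 u !₂[a s, b s, c s] i) s := by
  have hcurve : HasDerivAt (fun s => (!₂[a s, b s, c s] : E3)) !₂[a', b', c'] s := by
    rw [← hasDerivWithinAt_univ, hasDerivWithinAt_iff_hasFDerivWithinAt,
      hasFDerivWithinAt_euclidean]
    intro j
    fin_cases j
    · exact ha.hasFDerivAt.hasFDerivWithinAt.congr_fderiv (by ext; simp)
    · exact hb.hasFDerivAt.hasFDerivWithinAt.congr_fderiv (by ext; simp)
    · exact hc.hasFDerivAt.hasFDerivWithinAt.congr_fderiv (by ext; simp)
  have h1 := (hu !₂[a s, b s, c s]).hasFDerivAt.comp_hasDerivAt s hcurve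
  have h2 := (PiLp.hasFDerivAt_apply (𝕜 := ℝ) 2 (u !₂[a s, b s, c s]) i).comp_hasDerivAt s h1
  refine h2.congr_deriv ?_
  have e : (!₂[a', b', c'] : E3) = a' • EuclideanSpace.single 0 1 + b' • EuclideanSpace.single 1 1
      + c' • EuclideanSpace.single 2 1 := by
    ext j; fin_cases j <;> simp
  rw [e]
  simp [pderiv, map_add, map_smul]

lemma hasDerivAt_fst {g : ℝ × ℝ → ℝ} (hg : Differentiable ℝ g) (x y : ℝ) :
    HasDerivAt (fun x => g (x, y)) (fderiv ℝ g (x, y) (1, 0)) x :=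
  HasFDerivAt.comp_hasDerivAt (f := fun x => (x, y)) x (hg (x, y)).hasFDerivAt
    ((hasDerivAt_id x).prodMk (hasDerivAt_const x y))

lemma hasDerivAt_snd {g : ℝ × ℝ → ℝ} (hg : Differentiable ℝ g) (x y : ℝ) :
    HasDerivAt (fun y => g (x, y)) (fderiv ℝ g (x, y) (0, 1)) y :=
  HasFDerivAt.comp_hasDerivAt (f := fun y => (x, y)) y (hg (x, y)).hasFDerivAt
    ((hasDerivAt_const y x).prodMk (hasDerivAt_id y))

/-- Second-order partial derivatives of a smooth function of two variables. -/
lemma exists_partials {f : ℝ → ℝ → ℝ} (hf : ContDiff ℝ ∞ (Function.uncurry f)) :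
    ∃ fx fy fxy : ℝ → ℝ → ℝ, Continuous (Function.uncurry fx) ∧ Continuous (Function.uncurry fy) ∧
      Continuous (Function.uncurry fxy) ∧ (∀ x y, HasDerivAt (fun x => f x y) (fx x y) x) ∧
      (∀ x y, HasDerivAt (f x) (fy x y) y) ∧ (∀ x y, HasDerivAt (fun x => fy x y) (fxy x y) x) ∧
      (∀ x y, HasDerivAt (fx x) (fxy x y) y) := by
  set g := Function.uncurry f
  have h1 : ContDiff ℝ ∞ (fderiv ℝ g) := hf.fderiv_right (by simp)
  have hx : ContDiff ℝ ∞ (fun p => fderiv ℝ g p (1, 0)) := h1.clm_apply contDiff_const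
  have hy : ContDiff ℝ ∞ (fun p => fderiv ℝ g p (0, 1)) := h1.clm_apply contDiff_const
  have d1 : Differentiable ℝ (fderiv ℝ g) := h1.differentiable (by simp)
  have hxy : ∀ p, fderiv ℝ (fun p => fderiv ℝ g p (0, 1)) p (1, 0)
      = fderiv ℝ (fun p => fderiv ℝ g p (1, 0)) p (0, 1) := by
    intro p
    have hs : IsSymmSndFDerivAt ℝ g p := hf.contDiffAt.isSymmSndFDerivAt
      (by simpa using (WithTop.coe_le_coe.2 le_top : ((2 : ℕ∞) : WithTop ℕ∞) ≤ ((⊤ : ℕ∞) : WithTop ℕ∞)))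
    rw [fderiv_clm_apply (d1 p) (differentiableAt_const _),
      fderiv_clm_apply (d1 p) (differentiableAt_const _)]
    simpa using hs (1, 0) (0, 1)
  refine ⟨fun x y => fderiv ℝ g (x, y) (1, 0), fun x y => fderiv ℝ g (x, y) (0, 1),
    fun x y => fderiv ℝ (fun p => fderiv ℝ g p (0, 1)) (x, y) (1, 0), hx.continuous, hy.continuous,
    (ContDiff.clm_apply (hy.fderiv_right (m := ∞) (by simp)) contDiff_const).continuous,
    hasDerivAt_fst (hf.differentiable (by simp)), hasDerivAt_snd (hf.differentiable (by simp)),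
    hasDerivAt_fst (hy.differentiable (by simp)), fun x y => ?_⟩
  simp only [hxy]
  exact hasDerivAt_snd (hx.differentiable (by simp)) x y

/-- Spherical components of a vector field at `sph t θ φ`. -/
noncomputable def radial (u : E3 → E3) (t θ φ : ℝ) : ℝ :=
  u (sph t θ φ) 0 * Real.cos θ + u (sph t θ φ) 1 * (Real.sin θ * Real.cos φ)
    + u (sph t θ φ) 2 * (Real.sin θ * Real.sin φ)

noncomputable def polar (u : E3 → E3) (t θ φ : ℝ) : ℝ :=
  -(u (sph t θ φ) 0 * Real.sin θ) + u (sph t θ φ) 1 * (Real.cos θ * Real.cos φ)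
    + u (sph t θ φ) 2 * (Real.cos θ * Real.sin φ)

noncomputable def azimuthal (u : E3 → E3) (t θ φ : ℝ) : ℝ :=
  -(u (sph t θ φ) 1 * Real.sin φ) + u (sph t θ φ) 2 * Real.cos φ

/-- The derivatives of the Cartesian components of a field along the coordinate lines. -/
lemma hasDerivAt_sph_t {u : E3 → E3} (hu : Differentiable ℝ u) (t θ φ : ℝ) (i : Fin 3) :
    HasDerivAt (fun t => u (sph t θ φ) i) (Real.exp t * (Real.cos θ * pderiv 0 u (sph t θ φ) i
      + Real.sin θ * Real.cos φ * pderiv 1 u (sph t θ φ) i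
      + Real.sin θ * Real.sin φ * pderiv 2 u (sph t θ φ) i)) t := by
  refine (hasDerivAt_comp_triple hu ((Real.hasDerivAt_exp t).mul_const (Real.cos θ))
    ((Real.hasDerivAt_exp t).mul_const (Real.sin θ * Real.cos φ))
    ((Real.hasDerivAt_exp t).mul_const (Real.sin θ * Real.sin φ)) i).congr_deriv ?_
  rw [sph]; ring

lemma hasDerivAt_sph_θ {u : E3 → E3} (hu : Differentiable ℝ u) (t θ φ : ℝ) (i : Fin 3) :
    HasDerivAt (fun θ => u (sph t θ φ) i) (Real.exp t * (-Real.sin θ * pderiv 0 u (sph t θ φ) i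
      + Real.cos θ * Real.cos φ * pderiv 1 u (sph t θ φ) i
      + Real.cos θ * Real.sin φ * pderiv 2 u (sph t θ φ) i)) θ := by
  refine (hasDerivAt_comp_triple hu ((Real.hasDerivAt_cos θ).const_mul (Real.exp t))
    (((Real.hasDerivAt_sin θ).mul_const (Real.cos φ)).const_mul (Real.exp t))
    (((Real.hasDerivAt_sin θ).mul_const (Real.sin φ)).const_mul (Real.exp t)) i).congr_deriv ?_
  rw [sph]; ring

lemma hasDerivAt_sph_φ {u : E3 → E3} (hu : Differentiable ℝ u) (t θ φ : ℝ) (i : Fin 3) :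
    HasDerivAt (fun φ => u (sph t θ φ) i) (Real.exp t * (Real.sin θ
      * (-Real.sin φ * pderiv 1 u (sph t θ φ) i + Real.cos φ * pderiv 2 u (sph t θ φ) i))) φ := by
  refine (hasDerivAt_comp_triple hu (hasDerivAt_const φ (Real.exp t * Real.cos θ))
    (((Real.hasDerivAt_cos φ).const_mul (Real.sin θ)).const_mul (Real.exp t))
    (((Real.hasDerivAt_sin φ).const_mul (Real.sin θ)).const_mul (Real.exp t)) i).congr_deriv ?_
  rw [sph]; ring

/-- Squared norm in the spherical frame. -/
lemma norm_sq_eq_frame (u : E3 → E3) (t θ φ : ℝ) :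
    ‖u (sph t θ φ)‖ ^ 2 = radial u t θ φ ^ 2 + polar u t θ φ ^ 2 + azimuthal u t θ φ ^ 2 := by
  rw [EuclideanSpace.norm_sq_eq, Fin.sum_univ_three]
  simp only [Real.norm_eq_abs, sq_abs, radial, polar, azimuthal]
  set x := u (sph t θ φ) 0
  set y := u (sph t θ φ) 1
  set z := u (sph t θ φ) 2
  have hθ := Real.sin_sq_add_cos_sq θ
  have hφ := Real.sin_sq_add_cos_sq φ
  linear_combination (-x ^ 2 - (y * Real.cos φ + z * Real.sin φ) ^ 2) * hθ
    - (y ^ 2 + z ^ 2) * hφ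

lemma frame_sq (x y z θ φ : ℝ) :
    (x * Real.cos θ + y * (Real.sin θ * Real.cos φ) + z * (Real.sin θ * Real.sin φ)) ^ 2
      + (-(x * Real.sin θ) + y * (Real.cos θ * Real.cos φ) + z * (Real.cos θ * Real.sin φ)) ^ 2
      + (-(y * Real.sin φ) + z * Real.cos φ) ^ 2 = x ^ 2 + y ^ 2 + z ^ 2 := by
  linear_combination (x ^ 2 + (y * Real.cos φ + z * Real.sin φ) ^ 2) * Real.sin_sq_add_cos_sq θ
    + (y ^ 2 + z ^ 2) * Real.sin_sq_add_cos_sq φ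

/-- The derivative of the `i`-th component in the direction of the unit vector `e_ρ`. -/
noncomputable def dRad (u : E3 → E3) (t θ φ : ℝ) (i : Fin 3) : ℝ :=
  Real.cos θ * pderiv 0 u (sph t θ φ) i + Real.sin θ * Real.cos φ * pderiv 1 u (sph t θ φ) i
      + Real.sin θ * Real.sin φ * pderiv 2 u (sph t θ φ) i

/-- The derivative of the `i`-th component in the direction of the unit vector `e_θ`. -/
noncomputable def dPol (u : E3 → E3) (t θ φ : ℝ) (i : Fin 3) : ℝ :=
  -Real.sin θ * pderiv 0 u (sph t θ φ) i + Real.cos θ * Real.cos φ * pderiv 1 u (sph t θ φ) i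
      + Real.cos θ * Real.sin φ * pderiv 2 u (sph t θ φ) i

/-- The derivative of the `i`-th component in the direction of the unit vector `e_φ`. -/
noncomputable def dAzi (u : E3 → E3) (t θ φ : ℝ) (i : Fin 3) : ℝ :=
  -Real.sin φ * pderiv 1 u (sph t θ φ) i + Real.cos φ * pderiv 2 u (sph t θ φ) i

/-- The components of a vector in the spherical frame. -/
noncomputable def frameR (θ φ : ℝ) (v : Fin 3 → ℝ) : ℝ :=
  v 0 * Real.cos θ + v 1 * (Real.sin θ * Real.cos φ) + v 2 * (Real.sin θ * Real.sin φ)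

noncomputable def frameP (θ φ : ℝ) (v : Fin 3 → ℝ) : ℝ :=
  -(v 0 * Real.sin θ) + v 1 * (Real.cos θ * Real.cos φ) + v 2 * (Real.cos θ * Real.sin φ)

noncomputable def frameA (φ : ℝ) (v : Fin 3 → ℝ) : ℝ := -(v 1 * Real.sin φ) + v 2 * Real.cos φ

lemma sum_sq_eq_frame (θ φ : ℝ) (v : Fin 3 → ℝ) :
    v 0 ^ 2 + v 1 ^ 2 + v 2 ^ 2 = frameR θ φ v ^ 2 + frameP θ φ v ^ 2 + frameA φ v ^ 2 :=
  (frame_sq _ _ _ _ _).symm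

lemma gradSq_eq_directional (u : E3 → E3) (t θ φ : ℝ) :
    gradSq u (sph t θ φ) = (dRad u t θ φ 0 ^ 2 + dRad u t θ φ 1 ^ 2 + dRad u t θ φ 2 ^ 2)
      + (dPol u t θ φ 0 ^ 2 + dPol u t θ φ 1 ^ 2 + dPol u t θ φ 2 ^ 2)
      + (dAzi u t θ φ 0 ^ 2 + dAzi u t θ φ 1 ^ 2 + dAzi u t θ φ 2 ^ 2) := by
  simp only [gradSq, Fin.sum_univ_three, dRad, dPol, dAzi]
  have h := fun i => frame_sq (pderiv 0 u (sph t θ φ) i) (pderiv 1 u (sph t θ φ) i)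
    (pderiv 2 u (sph t θ φ) i) θ φ
  linear_combination -h 0 - h 1 - h 2

/-- The Frobenius norm does not change when the direction of differentiation and the component are
both expressed in an orthonormal frame. The trace is invariant in the same way, which gives
`divergence_eq_frame`. -/
lemma gradSq_eq_frame (u : E3 → E3) (t θ φ : ℝ) :
    gradSq u (sph t θ φ)
      = frameR θ φ (dRad u t θ φ) ^ 2 + frameP θ φ (dRad u t θ φ) ^ 2 + frameA φ (dRad u t θ φ) ^ 2
      + (frameR θ φ (dPol u t θ φ) ^ 2 + frameP θ φ (dPol u t θ φ) ^ 2
        + frameA φ (dPol u t θ φ) ^ 2)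
      + (frameR θ φ (dAzi u t θ φ) ^ 2 + frameP θ φ (dAzi u t θ φ) ^ 2
        + frameA φ (dAzi u t θ φ) ^ 2) := by
  rw [gradSq_eq_directional, sum_sq_eq_frame θ φ, sum_sq_eq_frame θ φ, sum_sq_eq_frame θ φ]

lemma divergence_eq_frame (u : E3 → E3) (t θ φ : ℝ) :
    divergence u (sph t θ φ) = frameR θ φ (dRad u t θ φ) + frameP θ φ (dPol u t θ φ)
      + frameA φ (dAzi u t θ φ) := by
  simp only [divergence, Fin.sum_univ_three, frameR, frameP, frameA, dRad, dPol, dAzi]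
  set D := fun j i => pderiv j u (sph t θ φ) i with hD
  have e : ∀ j i, pderiv j u (sph t θ φ) i = D j i := fun _ _ => rfl
  simp only [e]
  have hθ := Real.sin_sq_add_cos_sq θ
  have hφ := Real.sin_sq_add_cos_sq φ
  linear_combination (-D 0 0 - D 1 1 * Real.cos φ ^ 2 - D 2 2 * Real.sin φ ^ 2
    - (D 1 2 + D 2 1) * Real.cos φ * Real.sin φ) * hθ - (D 1 1 + D 2 2) * hφ

lemma contDiff_sph : ContDiff ℝ ∞ fun p : ℝ × ℝ × ℝ => sph p.1 p.2.1 p.2.2 := by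
  rw [contDiff_euclidean]
  intro i
  fin_cases i <;> simp [sph] <;> fun_prop

lemma contDiff_comp_sph {u : E3 → E3} (hu : ContDiff ℝ ∞ u) (i : Fin 3) :
    ContDiff ℝ ∞ fun p : ℝ × ℝ × ℝ => u (sph p.1 p.2.1 p.2.2) i :=
  contDiff_euclidean.1 (hu.comp contDiff_sph) i

lemma contDiff_radial {u : E3 → E3} (hu : ContDiff ℝ ∞ u) (φ : ℝ) :
    ContDiff ℝ ∞ fun p : ℝ × ℝ => radial u p.1 p.2 φ := by
  have h := fun i => (contDiff_comp_sph hu i).comp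
    (contDiff_fst.prodMk (contDiff_snd.prodMk contDiff_const) :
      ContDiff ℝ ∞ fun p : ℝ × ℝ => (p.1, p.2, φ))
  have h0 := h 0
  have h1 := h 1
  have h2 := h 2
  simp only [Function.comp_def] at h0 h1 h2
  unfold radial
  fun_prop

lemma contDiff_polar {u : E3 → E3} (hu : ContDiff ℝ ∞ u) (φ : ℝ) :
    ContDiff ℝ ∞ fun p : ℝ × ℝ => polar u p.1 p.2 φ := by
  have h := fun i => (contDiff_comp_sph hu i).comp
    (contDiff_fst.prodMk (contDiff_snd.prodMk contDiff_const) :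
      ContDiff ℝ ∞ fun p : ℝ × ℝ => (p.1, p.2, φ))
  have h0 := h 0
  have h1 := h 1
  have h2 := h 2
  simp only [Function.comp_def] at h0 h1 h2
  unfold polar
  fun_prop

lemma hasDerivAt_radial_t {u : E3 → E3} (hu : Differentiable ℝ u) (t θ φ : ℝ) :
    HasDerivAt (fun t => radial u t θ φ) (Real.exp t * frameR θ φ (dRad u t θ φ)) t := by
  refine ((((hasDerivAt_sph_t hu t θ φ 0).mul_const _).add
    ((hasDerivAt_sph_t hu t θ φ 1).mul_const _)).add
    ((hasDerivAt_sph_t hu t θ φ 2).mul_const _)).congr_deriv ?_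
  simp only [frameR, dRad]; ring

lemma hasDerivAt_polar_t {u : E3 → E3} (hu : Differentiable ℝ u) (t θ φ : ℝ) :
    HasDerivAt (fun t => polar u t θ φ) (Real.exp t * frameP θ φ (dRad u t θ φ)) t := by
  refine ((((hasDerivAt_sph_t hu t θ φ 0).mul_const _).neg.add
    ((hasDerivAt_sph_t hu t θ φ 1).mul_const _)).add
    ((hasDerivAt_sph_t hu t θ φ 2).mul_const _)).congr_deriv ?_
  simp only [frameP, dRad]; ring

lemma hasDerivAt_radial_θ {u : E3 → E3} (hu : Differentiable ℝ u) (t θ φ : ℝ) :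
    HasDerivAt (fun θ => radial u t θ φ)
      (Real.exp t * frameR θ φ (dPol u t θ φ) + polar u t θ φ) θ := by
  refine ((((hasDerivAt_sph_θ hu t θ φ 0).mul (Real.hasDerivAt_cos θ)).add
    ((hasDerivAt_sph_θ hu t θ φ 1).mul ((Real.hasDerivAt_sin θ).mul_const (Real.cos φ)))).add
    ((hasDerivAt_sph_θ hu t θ φ 2).mul
      ((Real.hasDerivAt_sin θ).mul_const (Real.sin φ)))).congr_deriv ?_
  simp only [frameR, dPol, polar]; ring

lemma hasDerivAt_polar_θ {u : E3 → E3} (hu : Differentiable ℝ u) (t θ φ : ℝ) :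
    HasDerivAt (fun θ => polar u t θ φ)
      (Real.exp t * frameP θ φ (dPol u t θ φ) - radial u t θ φ) θ := by
  refine ((((hasDerivAt_sph_θ hu t θ φ 0).mul (Real.hasDerivAt_sin θ)).neg.add
    ((hasDerivAt_sph_θ hu t θ φ 1).mul ((Real.hasDerivAt_cos θ).mul_const (Real.cos φ)))).add
    ((hasDerivAt_sph_θ hu t θ φ 2).mul
      ((Real.hasDerivAt_cos θ).mul_const (Real.sin φ)))).congr_deriv ?_
  simp only [frameP, dPol, radial]; ring

/-- The correction comes from `∂_φ e_φ = -(sin θ e_ρ + cos θ e_θ)`. For a field without azimuthal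
component the derivative is zero, so the `φφ` entry of the gradient is determined by `u_ρ` and
`u_θ`. -/
lemma hasDerivAt_azimuthal_φ {u : E3 → E3} (hu : Differentiable ℝ u) (t θ φ : ℝ) :
    HasDerivAt (fun φ => azimuthal u t θ φ) (Real.exp t * Real.sin θ * frameA φ (dAzi u t θ φ)
      - (Real.sin θ * radial u t θ φ + Real.cos θ * polar u t θ φ)) φ := by
  refine (((hasDerivAt_sph_φ hu t θ φ 1).mul (Real.hasDerivAt_sin φ)).neg.add
    ((hasDerivAt_sph_φ hu t θ φ 2).mul (Real.hasDerivAt_cos φ))).congr_deriv ?_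
  simp only [frameA, dAzi, radial, polar]
  linear_combination (u (sph t θ φ) 1 * Real.cos φ + u (sph t θ φ) 2 * Real.sin φ)
    * Real.sin_sq_add_cos_sq θ

/-! ### Swirl-free fields on meridian half-planes -/

lemma dense_sin_ne_zero : Dense {θ : ℝ | Real.sin θ ≠ 0} := by
  have : {θ : ℝ | Real.sin θ ≠ 0} = (range fun n : ℤ => (n : ℝ) * Real.pi)ᶜ := by
    ext θ
    simp [Real.sin_eq_zero_iff]
  rw [this]
  exact (countable_range _).dense_compl ℝ

lemma inner_ePhi_sph (v : E3) (t θ φ : ℝ) :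
    inner ℝ v (ePhi (sph t θ φ)) = (Real.sqrt ((sph t θ φ) 1 ^ 2 + (sph t θ φ) 2 ^ 2))⁻¹
      * (Real.exp t * Real.sin θ * frameA φ v) := by
  rw [ePhi, inner_smul_right, PiLp.inner_apply, Fin.sum_univ_three]
  congr 1
  simp [sph, frameA]
  ring

lemma sph_sq (t θ φ : ℝ) :
    (sph t θ φ) 1 ^ 2 + (sph t θ φ) 2 ^ 2 = (Real.exp t * Real.sin θ) ^ 2 := by
  simp [sph]
  linear_combination (Real.exp t * Real.sin θ) ^ 2 * Real.sin_sq_add_cos_sq φ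

/-- A swirl-free field has no azimuthal component, including on the axis. -/
lemma azimuthal_eq_zero {u : E3 → E3} (hu : Continuous u) (h : ∀ x, swirlPart u x = 0)
    (t θ φ : ℝ) : azimuthal u t θ φ = 0 := by
  have cs : Continuous fun θ => sph t θ φ :=
    contDiff_sph.continuous.comp (by fun_prop : Continuous fun θ : ℝ => (t, θ, φ))
  have cu : ∀ i, Continuous fun θ => u (sph t θ φ) i := fun i =>
    (PiLp.continuous_apply 2 _ i).comp (hu.comp cs)
  have c1 := cu 1
  have c2 := cu 2
  have hc : Continuous fun θ => azimuthal u t θ φ := by unfold azimuthal; fun_prop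
  -- The hypothesis is empty on the axis, where `ePhi` is 0; the zeros of `sin` are recovered by
  -- density and continuity.
  have key : EqOn (fun θ => azimuthal u t θ φ) (fun _ => 0) {θ : ℝ | Real.sin θ ≠ 0} := by
    intro θ hθ
    have h1 : swirlComponent u (sph t θ φ) = 0 := by
      rcases smul_eq_zero.1 (h (sph t θ φ)) with h2 | h2
      · exact h2
      · rw [swirlComponent, h2, inner_zero_right]
    rw [swirlComponent, inner_ePhi_sph, sph_sq] at h1
    have hne : Real.exp t * Real.sin θ ≠ 0 := mul_ne_zero (Real.exp_ne_zero t) hθ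
    have hs : (Real.sqrt ((Real.exp t * Real.sin θ) ^ 2))⁻¹ ≠ 0 := by
      rw [Real.sqrt_sq_eq_abs]; exact inv_ne_zero (abs_ne_zero.2 hne)
    exact (mul_eq_zero.1 ((mul_eq_zero.1 h1).resolve_left hs)).resolve_left hne
  exact congrFun (hc.ext_on dense_sin_ne_zero continuous_const key) θ

lemma sph_eq_of_sin_eq_zero {θ : ℝ} (h : Real.sin θ = 0) (t φ φ' : ℝ) :
    sph t θ φ = sph t θ φ' := by
  simp [sph, h]

/-- A point of the axis has every azimuth, so the vanishing of the azimuthal component at `φ = 0`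
and `φ = π/2` kills both transverse components of `u` there. -/
lemma polar_eq_zero {u : E3 → E3} (h : ∀ t θ φ, azimuthal u t θ φ = 0) {θ : ℝ}
    (hθ : Real.sin θ = 0) (t φ : ℝ) : polar u t θ φ = 0 := by
  have h1 := h t θ 0
  have h2 := h t θ (Real.pi / 2)
  rw [azimuthal, sph_eq_of_sin_eq_zero hθ t _ φ] at h1 h2
  simp at h1 h2
  simp [polar, hθ, h1, h2]

lemma exists_forall_norm_ge_eq_zero {u : E3 → E3} (h : HasCompactSupport u) :
    ∃ R : ℝ, ∀ x, R ≤ ‖x‖ → u x = 0 := by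
  obtain ⟨R, hR⟩ := h.isCompact.isBounded.exists_norm_le
  refine ⟨R + 1, fun x hx => ?_⟩
  by_contra hne
  linarith [hR x (subset_tsupport u hne)]

lemma sph_eq_zero_of_le {u : E3 → E3} {R : ℝ} (h : ∀ x, R ≤ ‖x‖ → u x = 0) {t : ℝ} (ht : R ≤ t)
    (θ φ : ℝ) : u (sph t θ φ) = 0 :=
  h _ (by rw [norm_sph]; linarith [Real.add_one_le_exp t])

/-- The restriction of a swirl-free solenoidal field to a meridian half-plane. -/
lemma exists_meridianField {γ : ℝ} {u : E3 → E3} (hu : u ∈ swirlFreeFields γ) (φ : ℝ) :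
    ∃ Ft Fθ Ftθ Ht Hθ : ℝ → ℝ → ℝ,
      MeridianField (3 / 2 - γ) (fun t θ => Real.exp ((γ + 1 / 2) * t) * radial u t θ φ) Ft Fθ Ftθ
        (fun t θ => Real.exp ((γ + 1 / 2) * t) * polar u t θ φ) Ht Hθ ∧
      ∀ t θ, MeridianField.energy (γ + 1 / 2) (3 / 2 - γ)
        (fun t θ => Real.exp ((γ + 1 / 2) * t) * radial u t θ φ) Ft Fθ
        (fun t θ => Real.exp ((γ + 1 / 2) * t) * polar u t θ φ) Ht Hθ t θ
        ≤ Real.exp ((2 * γ + 3) * t) * gradSq u (sph t θ φ) := by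
  obtain ⟨⟨hsm, hcs, -⟩, hdiv, hsw⟩ := hu
  have hd : Differentiable ℝ u := hsm.differentiable (by simp)
  have haz := azimuthal_eq_zero hsm.continuous hsw
  set k := γ + 1 / 2 with hk
  set F : ℝ → ℝ → ℝ := fun t θ => Real.exp (k * t) * radial u t θ φ with hF
  set H : ℝ → ℝ → ℝ := fun t θ => Real.exp (k * t) * polar u t θ φ with hH
  have sF : ContDiff ℝ ∞ (Function.uncurry F) := by
    have := contDiff_radial hsm φ
    simp only [hF, Function.uncurry_def]; fun_prop
  have sH : ContDiff ℝ ∞ (Function.uncurry H) := by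
    have := contDiff_polar hsm φ
    simp only [hH, Function.uncurry_def]; fun_prop
  obtain ⟨Ft, Fθ, Ftθ, cFt, cFθ, cFtθ, dFt, dFθ, dFθt, dFtθ⟩ := exists_partials sF
  obtain ⟨Ht, Hθ, -, cHt, cHθ, -, dHt, dHθ, -, -⟩ := exists_partials sH
  have hexp : ∀ t, HasDerivAt (fun t => Real.exp (k * t)) (Real.exp (k * t) * (k * 1)) t :=
    fun t => ((hasDerivAt_id t).const_mul k).exp
  have eFt : ∀ t θ, Ft t θ - k * F t θ
      = Real.exp (k * t) * Real.exp t * frameR θ φ (dRad u t θ φ) := fun t θ => by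
    rw [(dFt t θ).unique ((hexp t).mul (hasDerivAt_radial_t hd t θ φ))]; simp only [hF]; ring
  have eHt : ∀ t θ, Ht t θ - k * H t θ
      = Real.exp (k * t) * Real.exp t * frameP θ φ (dRad u t θ φ) := fun t θ => by
    rw [(dHt t θ).unique ((hexp t).mul (hasDerivAt_polar_t hd t θ φ))]; simp only [hH]; ring
  have eFθ : ∀ t θ, Fθ t θ - H t θ
      = Real.exp (k * t) * Real.exp t * frameR θ φ (dPol u t θ φ) := fun t θ => by
    rw [(dFθ t θ).unique ((hasDerivAt_radial_θ hd t θ φ).const_mul _)]; simp only [hH]; ring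
  have eHθ : ∀ t θ, Hθ t θ + F t θ
      = Real.exp (k * t) * Real.exp t * frameP θ φ (dPol u t θ φ) := fun t θ => by
    rw [(dHθ t θ).unique ((hasDerivAt_polar_θ hd t θ φ).const_mul _)]; simp only [hF]; ring
  -- The divergence constraint rewrites the `φφ` entry of the gradient in the form used by `energy`.
  have eN : ∀ t θ, F t θ - (Ft t θ + (3 / 2 - γ) * F t θ + Hθ t θ)
      = Real.exp (k * t) * Real.exp t * frameA φ (dAzi u t θ φ) := fun t θ => by
    have h1 := hdiv (sph t θ φ)
    rw [divergence_eq_frame] at h1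
    linear_combination (-Real.exp (k * t) * Real.exp t) * h1 - eFt t θ - eHθ t θ + F t θ * hk
  have eA : ∀ t θ, Real.exp t * Real.sin θ * frameA φ (dAzi u t θ φ)
      = Real.sin θ * radial u t θ φ + Real.cos θ * polar u t θ φ := fun t θ => by
    have h1 : HasDerivAt (fun φ => azimuthal u t θ φ) 0 φ := by
      simp only [haz]; exact hasDerivAt_const _ _
    linarith [h1.unique (hasDerivAt_azimuthal_φ hd t θ φ)]
  obtain ⟨R, hR⟩ := exists_forall_norm_ge_eq_zero hcs
  refine ⟨Ft, Fθ, Ftθ, Ht, Hθ, ⟨sF.continuous, cFt, cFθ, cFtθ, sH.continuous, cHt, cHθ, dFt, dFθ,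
    dFθt, dFtθ, dHt, dHθ, fun t θ => ?_, fun t => ?_, fun t => ?_, R, fun θ => ?_⟩, fun t θ => ?_⟩
  · simp only [hH] at *
    linear_combination (-Real.sin θ) * eN t θ - Real.exp (k * t) * eA t θ
  · simp [hH, polar_eq_zero haz Real.sin_zero]
  · simp [hH, polar_eq_zero haz Real.sin_pi]
  · simp [hF, radial, sph_eq_zero_of_le hR le_rfl]
  · have e2 : Real.exp ((2 * γ + 3) * t) = (Real.exp (k * t) * Real.exp t) ^ 2 := by
      rw [← Real.exp_add, ← Real.exp_nat_mul, hk]; congr 1; push_cast; ring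
    rw [MeridianField.energy, eFt, eHt, eFθ, eHθ, eN, gradSq_eq_frame, e2]
    set E := Real.exp (k * t) * Real.exp t
    -- The four frame entries absent from `energy` are discarded as squares. Two of them carry the
    -- `φ`-derivatives of `u_ρ` and `u_θ`, so axisymmetry is not required.
    have q : 0 ≤ E ^ 2 * (frameA φ (dRad u t θ φ) ^ 2 + frameA φ (dPol u t θ φ) ^ 2
      + frameR θ φ (dAzi u t θ φ) ^ 2 + frameP θ φ (dAzi u t θ φ) ^ 2) := by positivity
    linarith

/-! ### Hardy's inequality along rays -/

open Filter Topology in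
/-- One-dimensional weighted Hardy inequality in logarithmic variables, for `q = |V|²`,
`r ≥ |V'|²`. -/
lemma lintegral_hardy_ray {q q' r : ℝ → ℝ} {p T M : ℝ} (hp : 1 ≤ p)
    (hq : ∀ t, HasDerivAt q (q' t) t) (cq' : Continuous q') (cr : Continuous r)
    (hq0 : ∀ t, 0 ≤ q t) (hr0 : ∀ t, 0 ≤ r t) (hqr : ∀ t, q' t ^ 2 ≤ 4 * (q t * r t))
    (hM : ∀ t, q t ≤ M * Real.exp (2 * t)) (hT : ∀ t, T ≤ t → q t = 0) :
    ∫⁻ t, ENNReal.ofReal (Real.exp (-p * t) * q t)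
      ≤ ENNReal.ofReal (4 / p ^ 2) * ∫⁻ t, ENNReal.ofReal (Real.exp (-p * t) * r t) := by
  have hp0 : 0 < p := by linarith
  rcases eq_top_or_lt_top (∫⁻ t, ENNReal.ofReal (Real.exp (-p * t) * r t)) with htop | hlt
  · rw [htop, ENNReal.mul_top (by simp; positivity)]; exact le_top
  have cq : Continuous q := continuous_iff_continuousAt.2 fun t => (hq t).continuousAt
  have cer : Continuous fun t => Real.exp (-p * t) * r t := by fun_prop
  have ceq : Continuous fun t => Real.exp (-p * t) * q t := by fun_prop
  have hM0 : 0 ≤ M := by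
    have := (hq0 0).trans (hM 0)
    simpa using this
  have ir : Integrable fun t => Real.exp (-p * t) * r t :=
    MeridianField.integrable_of_lintegral_ofReal_lt_top cer
      (fun t => mul_nonneg (Real.exp_pos _).le (hr0 t)) hlt
  set Y := ∫ t, Real.exp (-p * t) * r t with hY
  have hYle : ∀ a b : ℝ, a ≤ b → ∫ t in a..b, Real.exp (-p * t) * r t ≤ Y := fun a b hab => by
    rw [intervalIntegral.integral_of_le hab]
    exact setIntegral_le_integral ir
      (Eventually.of_forall fun t => mul_nonneg (Real.exp_pos _).le (hr0 t))
  -- the regularised weight is `exp (-p * l t)`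
  have step1 : ∀ δ > 0, ∀ n : ℝ, -n ≤ T →
      ∫ t in (-n)..T, Real.exp (-p * Real.log (Real.exp t + δ))
        * (Real.exp t / (Real.exp t + δ)) * q t
      ≤ 2 / p * (Real.exp (-p * Real.log δ) * (M * Real.exp (2 * -n))) + 4 / p ^ 2 * Y := by
    intro δ hδ n hn
    have hpos : ∀ t, 0 < Real.exp t + δ := fun t => by positivity
    set w : ℝ → ℝ := fun t => Real.exp (-p * Real.log (Real.exp t + δ)) with hw
    set σ : ℝ → ℝ := fun t => Real.exp t / (Real.exp t + δ) with hσ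
    have hw0 : ∀ t, 0 < w t := fun t => Real.exp_pos _
    have hσ0 : ∀ t, 0 < σ t := fun t => by simp only [hσ]; positivity
    have cσ : Continuous σ :=
      Real.continuous_exp.div (by fun_prop) fun t => (hpos t).ne'
    have dl : ∀ t, HasDerivAt (fun t => Real.log (Real.exp t + δ)) (σ t) t := fun t =>
      ((Real.hasDerivAt_exp t).add_const δ).log (hpos t).ne'
    have dw : ∀ t, HasDerivAt w (w t * (-p * σ t)) t := fun t => ((dl t).const_mul (-p)).exp
    have cw : Continuous w := continuous_iff_continuousAt.2 fun t => (dw t).continuousAt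
    have dwq : ∀ t, HasDerivAt (fun t => w t * q t) (-p * (w t * σ t * q t) + w t * q' t) t :=
      fun t => ((dw t).mul (hq t)).congr_deriv (by ring)
    -- The quotient is `(exp t + δ)^(1-p) exp(-t)`; this is where `1 ≤ p` enters.
    have hwσ : ∀ t, w t / σ t ≤ Real.exp (-p * t) := by
      intro t
      have h1 : t ≤ Real.log (Real.exp t + δ) := by
        rw [Real.le_log_iff_exp_le (hpos t)]; linarith
      have h2 : w t / σ t = Real.exp (-(p - 1) * Real.log (Real.exp t + δ) - t) := by
        have : -(p - 1) * Real.log (Real.exp t + δ) - t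
          = -p * Real.log (Real.exp t + δ) + Real.log (Real.exp t + δ) - t := by ring
        rw [this, Real.exp_sub, Real.exp_add, Real.exp_log (hpos t)]
        simp only [hw, hσ]
        field_simp
      rw [h2, Real.exp_le_exp]
      nlinarith
    have hpt : ∀ t, w t * σ t * q t ≤ 2 / p * (p * (w t * σ t * q t) - w t * q' t)
        + 4 / p ^ 2 * (Real.exp (-p * t) * r t) := by
      intro t
      have hs := hσ0 t
      -- AM-GM for `q' ≤ 2√(qr)`, weighted so that half of the left side is absorbed after
      -- integration by parts; this yields the constant `4/p²`.
      have h1 : q' t ≤ p / 2 * (σ t * q t) + 2 / p * (r t / σ t) := by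
        refine le_of_sq_le_sq ?_ ?_
        · have : (p / 2 * (σ t * q t) + 2 / p * (r t / σ t)) ^ 2
            = (p / 2 * (σ t * q t) - 2 / p * (r t / σ t)) ^ 2 + 4 * (q t * r t) := by
            field_simp; ring
          rw [this]
          linarith [hqr t, sq_nonneg (p / 2 * (σ t * q t) - 2 / p * (r t / σ t))]
        · have := hq0 t
          have := hr0 t
          positivity
      have h2 : w t * q' t ≤ p / 2 * (w t * σ t * q t) + 2 / p * (w t / σ t * r t) := by
        refine (mul_le_mul_of_nonneg_left h1 (hw0 t).le).trans_eq ?_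
        field_simp
      have h3 : w t / σ t * r t ≤ Real.exp (-p * t) * r t :=
        mul_le_mul_of_nonneg_right (hwσ t) (hr0 t)
      have h4 : 2 / p * (w t * q' t)
          ≤ 2 / p * (p / 2 * (w t * σ t * q t) + 2 / p * (Real.exp (-p * t) * r t)) := by
        refine mul_le_mul_of_nonneg_left (h2.trans ?_) (by positivity)
        have : 2 / p * (w t / σ t * r t) ≤ 2 / p * (Real.exp (-p * t) * r t) :=
          mul_le_mul_of_nonneg_left h3 (by positivity)
        linarith
      have h5 : 2 / p * (p / 2 * (w t * σ t * q t) + 2 / p * (Real.exp (-p * t) * r t))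
        = w t * σ t * q t + 4 / p ^ 2 * (Real.exp (-p * t) * r t) := by
        field_simp; ring
      have h6 : 2 / p * (p * (w t * σ t * q t) - w t * q' t)
        = 2 * (w t * σ t * q t) - 2 / p * (w t * q' t) := by field_simp
      rw [h6]; linarith
    have hint : ∫ t in (-n)..T, (-p * (w t * σ t * q t) + w t * q' t)
        = w T * q T - w (-n) * q (-n) :=
      intervalIntegral.integral_eq_sub_of_hasDerivAt (fun t _ => dwq t)
        (Continuous.intervalIntegrable (by fun_prop) _ _)
    have h1 : ∫ t in (-n)..T, w t * σ t * q t
        ≤ ∫ t in (-n)..T, (2 / p * -(-p * (w t * σ t * q t) + w t * q' t)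
        + 4 / p ^ 2 * (Real.exp (-p * t) * r t)) :=
      intervalIntegral.integral_mono_on hn (Continuous.intervalIntegrable (by fun_prop) _ _)
        (Continuous.intervalIntegrable (by fun_prop) _ _) fun t _ =>
        (hpt t).trans_eq (by ring)
    rw [intervalIntegral.integral_add (Continuous.intervalIntegrable (by fun_prop) _ _)
      (Continuous.intervalIntegrable (by fun_prop) _ _), intervalIntegral.integral_const_mul,
      intervalIntegral.integral_const_mul, intervalIntegral.integral_neg, hint, hT T le_rfl] at h1
    refine h1.trans (add_le_add (mul_le_mul_of_nonneg_left ?_ (by positivity))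
      (mul_le_mul_of_nonneg_left (hYle _ _ hn) (by positivity)))
    have h2 : w (-n) ≤ Real.exp (-p * Real.log δ) := by
      simp only [hw]
      rw [Real.exp_le_exp]
      have : Real.log δ ≤ Real.log (Real.exp (-n) + δ) :=
        Real.log_le_log hδ (by linarith [Real.exp_pos (-n)])
      nlinarith
    have := mul_le_mul h2 (hM (-n)) (hq0 _) (Real.exp_pos _).le
    linarith
  -- For fixed `δ` the regularised weight is bounded near `-∞`, so `q ≤ M exp(2t)` removes the
  -- boundary term whatever `p` is.
  have step2 : ∀ δ > 0, ∀ N : ℝ, -N ≤ T →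
      ∫ t in (-N)..T, Real.exp (-p * Real.log (Real.exp t + δ))
        * (Real.exp t / (Real.exp t + δ)) * q t ≤ 4 / p ^ 2 * Y := by
    intro δ hδ N hN
    have hlim : Tendsto (fun n : ℝ => 2 / p * (Real.exp (-p * Real.log δ)
        * (M * Real.exp (2 * -n))) + 4 / p ^ 2 * Y) atTop
        (𝓝 (2 / p * (Real.exp (-p * Real.log δ) * (M * 0)) + 4 / p ^ 2 * Y)) := by
      refine ((((Real.tendsto_exp_atBot.comp ?_).const_mul M).const_mul _).const_mul _).add_const _
      exact tendsto_neg_atTop_atBot.const_mul_atBot (by norm_num)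
    rw [mul_zero, mul_zero, mul_zero, zero_add] at hlim
    refine ge_of_tendsto hlim ?_
    filter_upwards [eventually_ge_atTop N] with n hn
    refine le_trans ?_ (step1 δ hδ n (by linarith))
    have hc : Continuous fun t => Real.exp (-p * Real.log (Real.exp t + δ))
        * (Real.exp t / (Real.exp t + δ)) * q t := by
      have hpos : ∀ t, Real.exp t + δ ≠ 0 := fun t => by positivity
      have h1 : Continuous fun t => Real.log (Real.exp t + δ) :=
        Continuous.log (by fun_prop) hpos
      have h2 : Continuous fun t => Real.exp t / (Real.exp t + δ) :=
        Real.continuous_exp.div (by fun_prop) hpos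
      fun_prop
    refine intervalIntegral.integral_mono_interval (by linarith) hN le_rfl
      (Eventually.of_forall fun t => ?_) (hc.intervalIntegrable _ _)
    have := hq0 t
    simp only [Pi.zero_apply]
    positivity
  have step3 : ∀ N : ℝ, -N ≤ T → ∫ t in (-N)..T, Real.exp (-p * t) * q t ≤ 4 / p ^ 2 * Y := by
    intro N hN
    -- For `t ≥ -N` one has `exp t + δ ≤ exp t (1 + δ exp N)`, hence the original weight is the
    -- regularised one up to a factor that tends to 1 with `δ → 0`.
    have hb : ∀ δ > 0, ∫ t in (-N)..T, Real.exp (-p * t) * q t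
        ≤ Real.exp ((p + 1) * Real.log (1 + δ * Real.exp N)) * (4 / p ^ 2 * Y) := by
      intro δ hδ
      have hpos : ∀ t, 0 < Real.exp t + δ := fun t => by positivity
      have h1 : Continuous fun t => Real.log (Real.exp t + δ) :=
        Continuous.log (by fun_prop) fun t => (hpos t).ne'
      have h2 : Continuous fun t => Real.exp t / (Real.exp t + δ) :=
        Real.continuous_exp.div (by fun_prop) fun t => (hpos t).ne'
      refine le_trans ?_ (mul_le_mul_of_nonneg_left (step2 δ hδ N hN) (Real.exp_pos _).le)
      rw [← intervalIntegral.integral_const_mul]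
      refine intervalIntegral.integral_mono_on hN (ceq.intervalIntegrable _ _)
        (Continuous.intervalIntegrable (by fun_prop) _ _) fun t ht => ?_
      rw [← mul_assoc]
      refine mul_le_mul_of_nonneg_right ?_ (hq0 t)
      have e1 : Real.exp t / (Real.exp t + δ) = Real.exp (t - Real.log (Real.exp t + δ)) := by
        rw [Real.exp_sub, Real.exp_log (hpos t)]
      rw [e1, ← Real.exp_add, ← Real.exp_add, Real.exp_le_exp]
      have h3 : Real.log (Real.exp t + δ) ≤ t + Real.log (1 + δ * Real.exp N) := by
        have h4 : t + Real.log (1 + δ * Real.exp N)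
            = Real.log (Real.exp t * (1 + δ * Real.exp N)) := by
          rw [Real.log_mul (Real.exp_ne_zero _) (by positivity), Real.log_exp]
        rw [h4]
        refine Real.log_le_log (hpos t) ?_
        have h5 : 1 ≤ Real.exp t * Real.exp N := by
          rw [← Real.exp_add]; exact Real.one_le_exp (by linarith [ht.1])
        nlinarith
      nlinarith
    have hlim : Tendsto (fun δ : ℝ => Real.exp ((p + 1) * Real.log (1 + δ * Real.exp N))
        * (4 / p ^ 2 * Y)) (𝓝[>] 0) (𝓝 (4 / p ^ 2 * Y)) := by
      have : ContinuousAt (fun δ : ℝ => Real.exp ((p + 1) * Real.log (1 + δ * Real.exp N))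
        * (4 / p ^ 2 * Y)) 0 := by
        have h1 : ContinuousAt (fun δ : ℝ => Real.log (1 + δ * Real.exp N)) 0 :=
          ContinuousAt.log (by fun_prop) (by simp)
        fun_prop
      have h2 := this.tendsto.mono_left (nhdsWithin_le_nhds (s := Ioi (0 : ℝ)))
      simpa using h2
    refine ge_of_tendsto hlim ?_
    filter_upwards [self_mem_nhdsWithin] with δ hδ using hb δ hδ
  have step4 : ∀ n : ℕ, ∫⁻ t in Ioi (-(n : ℝ)), ENNReal.ofReal (Real.exp (-p * t) * q t)
      ≤ ENNReal.ofReal (4 / p ^ 2 * Y) := by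
    intro n
    have hle : -(max (n : ℝ) (-T)) ≤ T := by linarith [le_max_right (n : ℝ) (-T)]
    have h1 : ∫⁻ t in Ioc (-(max (n : ℝ) (-T))) T, ENNReal.ofReal (Real.exp (-p * t) * q t)
        ≤ ENNReal.ofReal (4 / p ^ 2 * Y) := by
      rw [← ofReal_integral_eq_lintegral_ofReal
        (ceq.integrableOn_Icc.mono_set Ioc_subset_Icc_self)
        (Eventually.of_forall fun t => mul_nonneg (Real.exp_pos _).le (hq0 t)),
        ← intervalIntegral.integral_of_le hle]
      exact ENNReal.ofReal_le_ofReal (step3 _ hle)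
    refine le_trans ?_ h1
    rw [← lintegral_indicator measurableSet_Ioi, ← lintegral_indicator measurableSet_Ioc]
    refine lintegral_mono fun t => ?_
    by_cases ht : t ∈ Ioi (-(n : ℝ))
    · rw [indicator_of_mem ht]
      rcases le_or_gt t T with h | h
      · rw [indicator_of_mem]
        exact ⟨by have := le_max_left (n : ℝ) (-T); have : -(n : ℝ) < t := ht; linarith, h⟩
      · rw [hT t h.le]; simp
    · rw [indicator_of_notMem ht]; exact zero_le
  rw [← ofReal_integral_eq_lintegral_ofReal ir
    (Eventually.of_forall fun t => mul_nonneg (Real.exp_pos _).le (hr0 t)),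
    ← ENNReal.ofReal_mul (by positivity)]
  have hU : (⋃ n : ℕ, Ioi (-(n : ℝ))) = univ := by
    refine eq_univ_of_forall fun t => mem_iUnion.2 ?_
    obtain ⟨n, hn⟩ := exists_nat_gt (-t)
    exact ⟨n, by simp only [mem_Ioi]; linarith⟩
  rw [← setLIntegral_univ, ← hU, setLIntegral_iUnion_of_directed]
  · exact iSup_le step4
  · refine (Monotone.directed_le fun m n hmn => Ioi_subset_Ioi ?_)
    have : (m : ℝ) ≤ n := by exact_mod_cast hmn
    linarith

lemma sum_dRad_sq_le_gradSq (u : E3 → E3) (t θ φ : ℝ) :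
    dRad u t θ φ 0 ^ 2 + dRad u t θ φ 1 ^ 2 + dRad u t θ φ 2 ^ 2 ≤ gradSq u (sph t θ φ) := by
  rw [gradSq_eq_directional]
  have : 0 ≤ (dPol u t θ φ 0 ^ 2 + dPol u t θ φ 1 ^ 2 + dPol u t θ φ 2 ^ 2)
      + (dAzi u t θ φ 0 ^ 2 + dAzi u t θ φ 1 ^ 2 + dAzi u t θ φ 2 ^ 2) := by positivity
  linarith

lemma norm_sq_eq_sum (v : E3) : ‖v‖ ^ 2 = v 0 ^ 2 + v 1 ^ 2 + v 2 ^ 2 := by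
  rw [EuclideanSpace.norm_sq_eq, Fin.sum_univ_three]
  simp

lemma continuous_pderiv {u : E3 → E3} (hu : ContDiff ℝ ∞ u) (j i : Fin 3) :
    Continuous fun x => pderiv j u x i :=
  (PiLp.continuous_apply 2 _ i).comp ((hu.continuous_fderiv (by simp)).clm_apply continuous_const)

lemma continuous_gradSq {u : E3 → E3} (hu : ContDiff ℝ ∞ u) : Continuous (gradSq u) := by
  unfold gradSq
  exact continuous_finsetSum _ fun i _ => continuous_finsetSum _ fun j _ =>
    (continuous_pderiv hu j i).pow 2

lemma continuous_sph : Continuous fun p : ℝ × ℝ × ℝ => sph p.1 p.2.1 p.2.2 :=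
  contDiff_sph.continuous

/-- Along each ray the zeroth-order energy is controlled by the first-order energy. -/
lemma exists_ray_bound {γ : ℝ} {u : E3 → E3} (hu : u ∈ testFields γ) :
    ∃ c c' : ℝ≥0∞, c ≠ ⊤ ∧ c' ≠ ⊤ ∧ ∀ θ φ : ℝ,
      ∫⁻ t, ENNReal.ofReal (Real.exp ((2 * γ + 1) * t) * ‖u (sph t θ φ)‖ ^ 2)
        ≤ c + c' * ∫⁻ t, ENNReal.ofReal (Real.exp ((2 * γ + 3) * t) * gradSq u (sph t θ φ)) := by
  obtain ⟨hsm, hcs, h0⟩ := hu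
  obtain ⟨R, hR⟩ := exists_forall_norm_ge_eq_zero hcs
  obtain ⟨K, hK⟩ := hsm.lipschitzWith_of_hasCompactSupport hcs (by simp)
  have hlip : γ ≤ -(1 / 2) → ∀ t θ φ, ‖u (sph t θ φ)‖ ^ 2 ≤ (K : ℝ) ^ 2 * Real.exp (2 * t) := by
    intro hγ t θ φ
    have := hK.dist_le_mul (sph t θ φ) 0
    rw [h0 hγ, dist_zero_right, dist_zero_right, norm_sph] at this
    calc ‖u (sph t θ φ)‖ ^ 2 ≤ (K * Real.exp t) ^ 2 :=
          pow_le_pow_left₀ (norm_nonneg _) this 2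
      _ = _ := by rw [mul_pow, ← Real.exp_nat_mul]; norm_num
  -- the case of an integrable weight
  have direct : ∀ c M : ℝ, 0 < c → (∀ t θ φ, Real.exp ((2 * γ + 1) * t) * ‖u (sph t θ φ)‖ ^ 2
      ≤ M * Real.exp (c * t)) → ∃ c c' : ℝ≥0∞, c ≠ ⊤ ∧ c' ≠ ⊤ ∧ ∀ θ φ : ℝ,
      ∫⁻ t, ENNReal.ofReal (Real.exp ((2 * γ + 1) * t) * ‖u (sph t θ φ)‖ ^ 2)
        ≤ c + c' * ∫⁻ t, ENNReal.ofReal (Real.exp ((2 * γ + 3) * t) * gradSq u (sph t θ φ)) := by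
    intro c M hc hM
    have hi : IntegrableOn (fun t => M * Real.exp (c * t)) (Iic R) :=
      (integrableOn_exp_mul_Iic hc R).const_mul M
    refine ⟨∫⁻ t in Iic R, ENNReal.ofReal (M * Real.exp (c * t)), 0, ?_, by simp, fun θ φ => ?_⟩
    · exact hi.lintegral_lt_top.ne
    · rw [zero_mul, add_zero, ← lintegral_indicator measurableSet_Iic]
      refine lintegral_mono fun t => ?_
      by_cases ht : t ∈ Iic R
      · rw [indicator_of_mem ht]; exact ENNReal.ofReal_le_ofReal (hM t θ φ)
      · rw [sph_eq_zero_of_le hR (not_le.1 ht).le]; simp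
  -- Three regimes: boundedness of `u` suffices for `γ > -1/2`; the Lipschitz bound from `u 0 = 0`
  -- gains `exp(2t)` and suffices for `-3/2 < γ ≤ -1/2`; below that the ray inequality is applied
  -- with `p = -(2γ + 1) ≥ 2`.
  rcases lt_or_ge (-(1 / 2)) γ with h1 | h1
  · obtain ⟨M, hM⟩ := hsm.continuous.bounded_above_of_compact_support hcs
    refine direct (2 * γ + 1) (M ^ 2) (by linarith) fun t θ φ => ?_
    rw [mul_comm]
    exact mul_le_mul_of_nonneg_right (pow_le_pow_left₀ (norm_nonneg _) (hM _) 2) (Real.exp_pos _).le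
  rcases lt_or_ge (-(3 / 2)) γ with h2 | h2
  · refine direct (2 * γ + 3) (K ^ 2) (by linarith) fun t θ φ => ?_
    refine (mul_le_mul_of_nonneg_left (hlip h1 t θ φ) (Real.exp_pos _).le).trans_eq ?_
    rw [mul_left_comm, ← Real.exp_add]; ring_nf
  · refine ⟨0, ENNReal.ofReal (4 / (-(2 * γ + 1)) ^ 2), by simp, by simp, fun θ φ => ?_⟩
    rw [zero_add]
    have hd : Differentiable ℝ u := hsm.differentiable (by simp)
    have cs : Continuous fun t => sph t θ φ :=
      continuous_sph.comp (by fun_prop : Continuous fun t : ℝ => (t, θ, φ))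
    have cu : ∀ i, Continuous fun t => u (sph t θ φ) i := fun i =>
      (PiLp.continuous_apply 2 _ i).comp (hsm.continuous.comp cs)
    have cp : ∀ j i, Continuous fun t => pderiv j u (sph t θ φ) i := fun j i =>
      (continuous_pderiv hsm j i).comp cs
    have cd : ∀ i, Continuous fun t => dRad u t θ φ i := fun i =>
      ((continuous_const.mul (cp 0 i)).add (continuous_const.mul (cp 1 i))).add
        (continuous_const.mul (cp 2 i))
    have cg : Continuous fun t => gradSq u (sph t θ φ) := (continuous_gradSq hsm).comp cs
    have := lintegral_hardy_ray (p := -(2 * γ + 1)) (T := R) (M := K ^ 2)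
      (q := fun t => ‖u (sph t θ φ)‖ ^ 2)
      (q' := fun t => 2 * Real.exp t * (u (sph t θ φ) 0 * dRad u t θ φ 0
        + u (sph t θ φ) 1 * dRad u t θ φ 1 + u (sph t θ φ) 2 * dRad u t θ φ 2))
      (r := fun t => Real.exp (2 * t) * gradSq u (sph t θ φ)) (by linarith) (fun t => ?_) ?_ ?_
      (fun t => by positivity) (fun t => ?_) (fun t => ?_) (fun t => hlip h1 t θ φ) (fun t ht => ?_)
    · simp only [neg_neg, ← mul_assoc, ← Real.exp_add] at this ⊢
      convert this using 6
      ring_nf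
    · simp only [norm_sq_eq_sum]
      have h := fun i => (hasDerivAt_sph_t hd t θ φ i).pow 2
      refine (((h 0).add (h 1)).add (h 2)).congr_deriv ?_
      simp only [dRad]; push_cast; ring
    · exact (continuous_const.mul Real.continuous_exp).mul
        ((((cu 0).mul (cd 0)).add ((cu 1).mul (cd 1))).add ((cu 2).mul (cd 2)))
    · exact (Real.continuous_exp.comp (continuous_const.mul continuous_id)).mul cg
    · have : 0 ≤ gradSq u (sph t θ φ) :=
        le_trans (by positivity) (sum_dRad_sq_le_gradSq u t θ φ)
      positivity
    · simp only
      have hb := sum_dRad_sq_le_gradSq u t θ φ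
      rw [norm_sq_eq_sum, two_mul t, Real.exp_add]
      set x := u (sph t θ φ) 0
      set y := u (sph t θ φ) 1
      set z := u (sph t θ φ) 2
      set x' := dRad u t θ φ 0
      set y' := dRad u t θ φ 1
      set z' := dRad u t θ φ 2
      have h1 : (x * x' + y * y' + z * z') ^ 2
          ≤ (x ^ 2 + y ^ 2 + z ^ 2) * (x' ^ 2 + y' ^ 2 + z' ^ 2) := by
        linarith [sq_nonneg (x * y' - y * x'), sq_nonneg (x * z' - z * x'),
          sq_nonneg (y * z' - z * y')]
      have h2 : (x * x' + y * y' + z * z') ^ 2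
          ≤ (x ^ 2 + y ^ 2 + z ^ 2) * gradSq u (sph t θ φ) :=
        h1.trans (mul_le_mul_of_nonneg_left hb (by positivity))
      have h3 := mul_le_mul_of_nonneg_left h2 (sq_nonneg (2 * Real.exp t))
      linarith
    · simp [sph_eq_zero_of_le hR ht]

/-! ### Slicing the integrals; the inequality for swirl-free fields -/

/-- Spherical coordinates for the two integrals. -/
lemma gradIntegral_eq {u : E3 → E3} (hu : ContDiff ℝ ∞ u) (γ : ℝ) :
    gradIntegral γ u = ∫⁻ t, ∫⁻ θ in Ioo 0 Real.pi, ∫⁻ φ in Ioo (-Real.pi) Real.pi,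
      ENNReal.ofReal (Real.exp ((2 * γ + 3) * t) * gradSq u (sph t θ φ) * Real.sin θ) := by
  have hm : Measurable fun x => ENNReal.ofReal (gradSq u x * ‖x‖ ^ (2 * γ)) := by
    have := (continuous_gradSq hu).measurable
    fun_prop
  rw [gradIntegral, lintegral_spherical hm]
  congr 1; ext t
  refine setLIntegral_congr_fun measurableSet_Ioo fun θ hθ => ?_
  congr 1; ext φ
  rw [← ENNReal.ofReal_mul (mul_nonneg (Real.exp_pos _).le
    (Real.sin_pos_of_mem_Ioo hθ).le), norm_sph, ← Real.exp_mul]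
  congr 1
  rw [show (2 * γ + 3) * t = 3 * t + t * (2 * γ) by ring, Real.exp_add]; ring

lemma hardyIntegral_eq {u : E3 → E3} (hu : Continuous u) (γ : ℝ) :
    hardyIntegral γ u = ∫⁻ t, ∫⁻ θ in Ioo 0 Real.pi, ∫⁻ φ in Ioo (-Real.pi) Real.pi,
      ENNReal.ofReal (Real.exp ((2 * γ + 1) * t) * ‖u (sph t θ φ)‖ ^ 2 * Real.sin θ) := by
  have hm : Measurable fun x => ENNReal.ofReal (‖u x‖ ^ 2 * ‖x‖ ^ (2 * γ - 2)) := by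
    have := hu.measurable
    fun_prop
  rw [hardyIntegral, lintegral_spherical hm]
  congr 1; ext t
  refine setLIntegral_congr_fun measurableSet_Ioo fun θ hθ => ?_
  congr 1; ext φ
  rw [← ENNReal.ofReal_mul (mul_nonneg (Real.exp_pos _).le
    (Real.sin_pos_of_mem_Ioo hθ).le), norm_sph, ← Real.exp_mul]
  congr 1
  rw [show (2 * γ + 1) * t = 3 * t + t * (2 * γ - 2) by ring, Real.exp_add]; ring

lemma lintegral_swap_outer {f : ℝ × ℝ × ℝ → ℝ≥0∞} (hf : Measurable f) (s s' : Set ℝ) :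
    ∫⁻ t, ∫⁻ θ in s, ∫⁻ φ in s', f (t, θ, φ) = ∫⁻ φ in s', ∫⁻ t, ∫⁻ θ in s, f (t, θ, φ) := by
  have h1 : ∀ t, ∫⁻ θ in s, ∫⁻ φ in s', f (t, θ, φ) = ∫⁻ φ in s', ∫⁻ θ in s, f (t, θ, φ) :=
    fun t => lintegral_lintegral_swap
      (hf.comp (by fun_prop : Measurable fun p : ℝ × ℝ => (t, p.1, p.2))).aemeasurable
  simp only [h1]
  refine lintegral_lintegral_swap (f := fun t φ => ∫⁻ θ in s, f (t, θ, φ)) ?_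
  exact (Measurable.lintegral_prod_right' (f := fun p : (ℝ × ℝ) × ℝ => f (p.1.1, p.2, p.1.2))
    (by fun_prop)).aemeasurable

/-- The first-order energy on the meridian half-plane with azimuth `φ`. -/
noncomputable def gradSlice (γ : ℝ) (u : E3 → E3) (φ : ℝ) : ℝ≥0∞ :=
  ∫⁻ t, ∫⁻ θ in Ioo 0 Real.pi,
    ENNReal.ofReal (Real.exp ((2 * γ + 3) * t) * gradSq u (sph t θ φ) * Real.sin θ)

/-- The zeroth-order energy on the meridian half-plane with azimuth `φ`. -/
noncomputable def hardySlice (γ : ℝ) (u : E3 → E3) (φ : ℝ) : ℝ≥0∞ :=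
  ∫⁻ t, ∫⁻ θ in Ioo 0 Real.pi,
    ENNReal.ofReal (Real.exp ((2 * γ + 1) * t) * ‖u (sph t θ φ)‖ ^ 2 * Real.sin θ)

lemma continuous_grad_density {u : E3 → E3} (hu : ContDiff ℝ ∞ u) (γ : ℝ) :
    Continuous fun p : ℝ × ℝ × ℝ => Real.exp ((2 * γ + 3) * p.1)
      * gradSq u (sph p.1 p.2.1 p.2.2) * Real.sin p.2.1 := by
  have := (continuous_gradSq hu).comp continuous_sph
  simp only [Function.comp_def] at this
  fun_prop

lemma continuous_hardy_density {u : E3 → E3} (hu : Continuous u) (γ : ℝ) :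
    Continuous fun p : ℝ × ℝ × ℝ => Real.exp ((2 * γ + 1) * p.1)
      * ‖u (sph p.1 p.2.1 p.2.2)‖ ^ 2 * Real.sin p.2.1 := by
  have h1 : Continuous fun p : ℝ × ℝ × ℝ => ‖u (sph p.1 p.2.1 p.2.2)‖ ^ 2 :=
    (hu.comp continuous_sph).norm.pow 2
  fun_prop

lemma gradIntegral_eq_slices {u : E3 → E3} (hu : ContDiff ℝ ∞ u) (γ : ℝ) :
    gradIntegral γ u = ∫⁻ φ in Ioo (-Real.pi) Real.pi, gradSlice γ u φ := by
  rw [gradIntegral_eq hu]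
  exact lintegral_swap_outer (f := fun p => ENNReal.ofReal (Real.exp ((2 * γ + 3) * p.1)
    * gradSq u (sph p.1 p.2.1 p.2.2) * Real.sin p.2.1))
    (continuous_grad_density hu γ).measurable.ennreal_ofReal _ _

lemma hardyIntegral_eq_slices {u : E3 → E3} (hu : Continuous u) (γ : ℝ) :
    hardyIntegral γ u = ∫⁻ φ in Ioo (-Real.pi) Real.pi, hardySlice γ u φ := by
  rw [hardyIntegral_eq hu]
  exact lintegral_swap_outer (f := fun p => ENNReal.ofReal (Real.exp ((2 * γ + 1) * p.1)
    * ‖u (sph p.1 p.2.1 p.2.2)‖ ^ 2 * Real.sin p.2.1))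
    (continuous_hardy_density hu γ).measurable.ennreal_ofReal _ _

lemma gradSq_nonneg (u : E3 → E3) (x : E3) : 0 ≤ gradSq u x := by
  unfold gradSq; positivity

/-- The constants of `exists_ray_bound` do not depend on the ray, so that bound can be integrated
over `θ`. It supplies the finiteness that `MeridianField.sharp_ineq` asks for. -/
lemma exists_slice_bound {γ : ℝ} {u : E3 → E3} (hu : u ∈ testFields γ) :
    ∃ c c' : ℝ≥0∞, c ≠ ⊤ ∧ c' ≠ ⊤ ∧ ∀ φ : ℝ, hardySlice γ u φ ≤ c + c' * gradSlice γ u φ := by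
  obtain ⟨c, c', hc, hc', h⟩ := exists_ray_bound hu
  have hmap : ∀ φ : ℝ, Continuous fun p : ℝ × ℝ => (p.1, p.2, φ) := fun φ => by fun_prop
  refine ⟨c * ENNReal.ofReal Real.pi, c', ENNReal.mul_ne_top hc ENNReal.ofReal_ne_top, hc',
    fun φ => ?_⟩
  have h1 : hardySlice γ u φ = ∫⁻ θ in Ioo 0 Real.pi, ∫⁻ t,
      ENNReal.ofReal (Real.exp ((2 * γ + 1) * t) * ‖u (sph t θ φ)‖ ^ 2 * Real.sin θ) :=
    lintegral_lintegral_swap ((continuous_hardy_density hu.1.continuous γ).comp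
      (hmap φ)).measurable.ennreal_ofReal.aemeasurable
  have h2 : gradSlice γ u φ = ∫⁻ θ in Ioo 0 Real.pi, ∫⁻ t,
      ENNReal.ofReal (Real.exp ((2 * γ + 3) * t) * gradSq u (sph t θ φ) * Real.sin θ) :=
    lintegral_lintegral_swap ((continuous_grad_density hu.1 γ).comp
      (hmap φ)).measurable.ennreal_ofReal.aemeasurable
  rw [h1, h2]
  calc ∫⁻ θ in Ioo 0 Real.pi, ∫⁻ t,
          ENNReal.ofReal (Real.exp ((2 * γ + 1) * t) * ‖u (sph t θ φ)‖ ^ 2 * Real.sin θ)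
        ≤ ∫⁻ θ in Ioo 0 Real.pi, (c + c' * ∫⁻ t,
          ENNReal.ofReal (Real.exp ((2 * γ + 3) * t) * gradSq u (sph t θ φ) * Real.sin θ)) := by
          refine setLIntegral_mono' measurableSet_Ioo fun θ hθ => ?_
          have hs := Real.sin_pos_of_mem_Ioo hθ
          have e1 : ∀ t, ENNReal.ofReal (Real.exp ((2 * γ + 1) * t) * ‖u (sph t θ φ)‖ ^ 2
            * Real.sin θ) = ENNReal.ofReal (Real.sin θ) * ENNReal.ofReal
            (Real.exp ((2 * γ + 1) * t) * ‖u (sph t θ φ)‖ ^ 2) := fun t => by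
              rw [mul_comm, ENNReal.ofReal_mul hs.le]
          have e2 : ∀ t, ENNReal.ofReal (Real.exp ((2 * γ + 3) * t) * gradSq u (sph t θ φ)
            * Real.sin θ) = ENNReal.ofReal (Real.sin θ) * ENNReal.ofReal
            (Real.exp ((2 * γ + 3) * t) * gradSq u (sph t θ φ)) := fun t => by
              rw [mul_comm, ENNReal.ofReal_mul hs.le]
          simp only [e1, e2]
          rw [lintegral_const_mul' _ _ ENNReal.ofReal_ne_top,
            lintegral_const_mul' _ _ ENNReal.ofReal_ne_top]
          refine (mul_le_mul_right (h θ φ) _).trans ?_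
          rw [mul_add, mul_left_comm]
          refine add_le_add (mul_le_of_le_one_left (zero_le) ?_) le_rfl
          rw [← ENNReal.ofReal_one]
          exact ENNReal.ofReal_le_ofReal (Real.sin_le_one θ)
      _ = _ := by
          rw [lintegral_add_left measurable_const, lintegral_const_mul' _ _ hc']
          simp

lemma hardyIntegral_lt_top {γ : ℝ} {u : E3 → E3} (hu : u ∈ testFields γ)
    (h : gradIntegral γ u < ⊤) : hardyIntegral γ u < ⊤ := by
  obtain ⟨c, c', hc, hc', hb⟩ := exists_slice_bound hu
  rw [gradIntegral_eq_slices hu.1] at h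
  rw [hardyIntegral_eq_slices hu.1.continuous]
  refine (lintegral_mono hb).trans_lt ?_
  rw [lintegral_add_left measurable_const, lintegral_const_mul' _ _ hc']
  refine ENNReal.add_lt_top.2 ⟨?_, ENNReal.mul_lt_top hc'.lt_top h⟩
  rw [setLIntegral_const]
  exact ENNReal.mul_lt_top hc.lt_top measure_Ioo_lt_top

/-- The sharp inequality on a meridian half-plane. -/
lemma slice_ineq {γ : ℝ} {u : E3 → E3} (hu : u ∈ swirlFreeFields γ) (φ : ℝ) :
    ENNReal.ofReal (constSwirlFree γ) * hardySlice γ u φ ≤ gradSlice γ u φ := by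
  rcases eq_top_or_lt_top (gradSlice γ u φ) with htop | hlt
  · rw [htop]; exact le_top
  obtain ⟨c, c', hc, hc', hb⟩ := exists_slice_bound hu.1
  have hfin : hardySlice γ u φ < ⊤ :=
    (hb φ).trans_lt (ENNReal.add_lt_top.2 ⟨hc.lt_top, ENNReal.mul_lt_top hc'.lt_top hlt⟩)
  obtain ⟨Ft, Fθ, Ftθ, Ht, Hθ, hM, hE⟩ := exists_meridianField hu φ
  obtain ⟨α, β, μ, ν, ξ, hμ, hν, hξ, e1, e2, e3, e4⟩ := exists_certificate γ
  have haz := azimuthal_eq_zero hu.1.1.continuous hu.2.2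
  set F : ℝ → ℝ → ℝ := fun t θ => Real.exp ((γ + 1 / 2) * t) * radial u t θ φ with hF
  set H : ℝ → ℝ → ℝ := fun t θ => Real.exp ((γ + 1 / 2) * t) * polar u t θ φ with hH
  have eh : hardySlice γ u φ
      = ∫⁻ t, ENNReal.ofReal (polarInt (fun t θ => F t θ ^ 2 + H t θ ^ 2) t) := by
    rw [hardySlice]
    congr 1; ext t
    have cF := hM.cF
    have cH := hM.cH
    simp only [Function.uncurry_def] at cF cH
    rw [← lintegral_polar (by simp only [Function.uncurry_def]; fun_prop)
      (fun θ => by positivity)]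
    congr 1; ext θ
    rw [norm_sq_eq_frame, haz, show (2 * γ + 1) * t = (γ + 1 / 2) * t + (γ + 1 / 2) * t by ring,
      Real.exp_add]
    congr 1
    simp only [hF, hH]; ring
  have cE := hM.continuous_energy (γ + 1 / 2)
  have eg : ∫⁻ t, ENNReal.ofReal (polarInt (MeridianField.energy (γ + 1 / 2) (3 / 2 - γ)
      F Ft Fθ H Ht Hθ) t) ≤ gradSlice γ u φ := by
    rw [gradSlice]
    refine lintegral_mono fun t => ?_
    rw [← lintegral_polar cE (fun θ => by unfold MeridianField.energy; positivity)]
    refine setLIntegral_mono' measurableSet_Ioo fun θ hθ => ENNReal.ofReal_le_ofReal ?_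
    exact mul_le_mul_of_nonneg_right (hE t θ) (Real.sin_pos_of_mem_Ioo hθ).le
  refine le_trans ?_ eg
  rw [eh] at hfin ⊢
  exact hM.sharp_ineq (α := α) (β := β) hμ hν hξ e1 e2 (by linarith) (by linarith) hfin (constSwirlFree_nonneg γ)

theorem hardyLerayIneq_of_swirlFree {γ : ℝ} {u : E3 → E3} (hu : u ∈ swirlFreeFields γ) :
    HardyLerayIneq γ (constSwirlFree γ) u := by
  rw [HardyLerayIneq, gradIntegral_eq_slices hu.1.1, hardyIntegral_eq_slices hu.1.1.continuous,
    ← lintegral_const_mul' _ _ ENNReal.ofReal_ne_top]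
  exact lintegral_mono fun φ => slice_ineq hu φ

/-! ### Adding an axisymmetric swirl -/

lemma hasDerivAt_azimuthal_t {u : E3 → E3} (hu : Differentiable ℝ u) (t θ φ : ℝ) :
    HasDerivAt (fun t => azimuthal u t θ φ) (Real.exp t * frameA φ (dRad u t θ φ)) t := by
  refine (((hasDerivAt_sph_t hu t θ φ 1).mul_const _).neg.add
    ((hasDerivAt_sph_t hu t θ φ 2).mul_const _)).congr_deriv ?_
  simp only [frameA, dRad]; ring

lemma hasDerivAt_azimuthal_θ {u : E3 → E3} (hu : Differentiable ℝ u) (t θ φ : ℝ) :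
    HasDerivAt (fun θ => azimuthal u t θ φ) (Real.exp t * frameA φ (dPol u t θ φ)) θ := by
  refine (((hasDerivAt_sph_θ hu t θ φ 1).mul_const _).neg.add
    ((hasDerivAt_sph_θ hu t θ φ 2).mul_const _)).congr_deriv ?_
  simp only [frameA, dPol]; ring

lemma hasDerivAt_radial_φ {u : E3 → E3} (hu : Differentiable ℝ u) (t θ φ : ℝ) :
    HasDerivAt (fun φ => radial u t θ φ) (Real.exp t * Real.sin θ * frameR θ φ (dAzi u t θ φ)
      + Real.sin θ * azimuthal u t θ φ) φ := by
  refine ((((hasDerivAt_sph_φ hu t θ φ 0).mul_const (Real.cos θ)).add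
    ((hasDerivAt_sph_φ hu t θ φ 1).mul ((Real.hasDerivAt_cos φ).const_mul (Real.sin θ)))).add
    ((hasDerivAt_sph_φ hu t θ φ 2).mul
      ((Real.hasDerivAt_sin φ).const_mul (Real.sin θ)))).congr_deriv ?_
  simp only [frameR, dAzi, azimuthal]; ring

lemma hasDerivAt_polar_φ {u : E3 → E3} (hu : Differentiable ℝ u) (t θ φ : ℝ) :
    HasDerivAt (fun φ => polar u t θ φ) (Real.exp t * Real.sin θ * frameP θ φ (dAzi u t θ φ)
      + Real.cos θ * azimuthal u t θ φ) φ := by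
  refine ((((hasDerivAt_sph_φ hu t θ φ 0).mul_const (Real.sin θ)).neg.add
    ((hasDerivAt_sph_φ hu t θ φ 1).mul ((Real.hasDerivAt_cos φ).const_mul (Real.cos θ)))).add
    ((hasDerivAt_sph_φ hu t θ φ 2).mul
      ((Real.hasDerivAt_sin φ).const_mul (Real.cos θ)))).congr_deriv ?_
  simp only [frameP, dAzi, azimuthal]; ring

lemma ePhi_sph (t θ φ : ℝ) :
    ePhi (sph t θ φ) = ((Real.sqrt ((Real.exp t * Real.sin θ) ^ 2))⁻¹ * (Real.exp t * Real.sin θ))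
      • !₂[0, -Real.sin φ, Real.cos φ] := by
  rw [ePhi, sph_sq, mul_smul]
  congr 1
  ext i; fin_cases i <;> simp [sph] <;> ring

/-- `ePhi` is a unit vector off the axis and 0 on it; this form covers both cases. -/
lemma inner_ePhi_self_smul (x : E3) : (inner ℝ (ePhi x) (ePhi x) : ℝ) • ePhi x = ePhi x := by
  by_cases h : x 1 ^ 2 + x 2 ^ 2 = 0
  · simp [ePhi, h]
  · have h0 : 0 < x 1 ^ 2 + x 2 ^ 2 := lt_of_le_of_ne (by positivity) (Ne.symm h)
    have : inner ℝ (ePhi x) (ePhi x) = (1 : ℝ) := by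
      rw [ePhi, inner_smul_left, inner_smul_right, PiLp.inner_apply, Fin.sum_univ_three]
      simp
      rw [← mul_assoc, ← mul_inv, Real.mul_self_sqrt h0.le]
      field_simp; ring
    rw [this, one_smul]

section Swirl

variable {g : E3 → ℝ}

lemma swirlPart_swirl (g : E3 → ℝ) (x : E3) :
    swirlPart (fun x => g x • ePhi x) x = g x • ePhi x := by
  rw [swirlPart, swirlComponent, inner_smul_left, mul_smul, inner_ePhi_self_smul]
  simp

lemma radial_swirl (g : E3 → ℝ) (t θ φ : ℝ) : radial (fun x => g x • ePhi x) t θ φ = 0 := by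
  simp [radial, ePhi_sph]; ring

lemma polar_swirl (g : E3 → ℝ) (t θ φ : ℝ) : polar (fun x => g x • ePhi x) t θ φ = 0 := by
  simp [polar, ePhi_sph]; ring

lemma azimuthal_swirl (hg : IndepOfPhi g) (t θ φ : ℝ) :
    azimuthal (fun x => g x • ePhi x) t θ φ = azimuthal (fun x => g x • ePhi x) t θ 0 := by
  have h : g (sph t θ φ) = g (sph t θ 0) := hg _ _ (by simp [sph]) (by rw [sph_sq, sph_sq])
  simp [azimuthal, ePhi_sph, h]
  linear_combination (g (sph t θ 0) * ((√((Real.exp t * Real.sin θ) ^ 2))⁻¹ * (Real.exp t * Real.sin θ)))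
    * Real.sin_sq_add_cos_sq φ

lemma hasDerivAt_const_unique {f : ℝ → ℝ} {c f' x : ℝ} (h : HasDerivAt f f' x) (hf : ∀ x, f x = c) :
    f' = 0 := by
  have : f = fun _ => c := funext hf
  rw [this] at h
  exact h.unique (hasDerivAt_const x c)

/-- Off the axis each diagonal frame entry of the gradient vanishes. The integral of `|div|` is
therefore zero, and continuity takes care of the axis. -/
lemma divergence_swirl (hg : IndepOfPhi g) (hsm : ContDiff ℝ ∞ fun x => g x • ePhi x) (x : E3) :
    divergence (fun x => g x • ePhi x) x = 0 := by
  set G : E3 → E3 := fun x => g x • ePhi x with hG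
  have hd : Differentiable ℝ G := hsm.differentiable (by simp)
  have hc : Continuous (divergence G) := by
    unfold divergence
    exact continuous_finsetSum _ fun i _ => continuous_pderiv hsm i i
  have key : ∀ t φ, ∀ θ ∈ Ioo 0 Real.pi, divergence G (sph t θ φ) = 0 := by
    intro t φ θ hθ
    have hs := (Real.sin_pos_of_mem_Ioo hθ).ne'
    have he := Real.exp_ne_zero t
    have h1 := hasDerivAt_const_unique (hasDerivAt_radial_t hd t θ φ) fun t => radial_swirl g t θ φ
    have h2 := hasDerivAt_const_unique (hasDerivAt_polar_θ hd t θ φ) fun θ => polar_swirl g t θ φ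
    have h3 := hasDerivAt_const_unique (hasDerivAt_azimuthal_φ hd t θ φ)
      fun φ => azimuthal_swirl hg t θ φ
    rw [radial_swirl] at h2 h3
    rw [polar_swirl] at h3
    simp [hs, he] at h1 h2 h3
    rw [divergence_eq_frame, h1, h2, h3]; simp
  have hz : ∫⁻ x, ENNReal.ofReal |divergence G x| = 0 := by
    rw [lintegral_spherical (by have := hc.measurable; fun_prop)]
    refine (lintegral_congr fun t => ?_).trans lintegral_zero
    refine (setLIntegral_congr_fun measurableSet_Ioo fun θ hθ => ?_).trans lintegral_zero
    simp [key t _ θ hθ]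
  rw [lintegral_eq_zero_iff (by have := hc.measurable; fun_prop)] at hz
  have hae : divergence G =ᵐ[volume] fun _ => 0 := by
    filter_upwards [hz] with x hx
    simpa using hx
  exact congrFun (hc.ae_eq_iff_eq volume continuous_const |>.1 hae) x

lemma swirlComponent_eq_zero {u : E3 → E3} {x : E3} (h : swirlPart u x = 0) :
    swirlComponent u x = 0 := by
  rcases smul_eq_zero.1 h with h | h
  · exact h
  · rw [swirlComponent, h, inner_zero_right]

lemma hardyIntegral_add_swirl {u : E3 → E3} (hu : Continuous u) (hsw : ∀ x, swirlPart u x = 0)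
    (γ : ℝ) :
    hardyIntegral γ (fun x => u x + g x • ePhi x)
      = hardyIntegral γ u + hardyIntegral γ (fun x => g x • ePhi x) := by
  rw [hardyIntegral, hardyIntegral, hardyIntegral, ← lintegral_add_left]
  · congr 1; ext x
    rw [← ENNReal.ofReal_add (by positivity) (by positivity), ← add_mul]
    congr 2
    have h := swirlComponent_eq_zero (hsw x)
    rw [swirlComponent] at h
    rw [norm_add_sq_real, inner_smul_right, h]; ring
  · have := hu.measurable
    fun_prop

lemma pderiv_add {u v : E3 → E3} (hu : Differentiable ℝ u) (hv : Differentiable ℝ v) (j : Fin 3)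
    (x : E3) : pderiv j (fun x => u x + v x) x = pderiv j u x + pderiv j v x := by
  rw [pderiv, fderiv_fun_add (hu x) (hv x)]; rfl

/-- The interaction between the swirl-free part and an axisymmetric swirl is an exact
`φ`-derivative. -/
lemma hasDerivAt_interaction (hg : IndepOfPhi g) (hsm : ContDiff ℝ ∞ fun x => g x • ePhi x)
    {u : E3 → E3} (hu : ContDiff ℝ ∞ u) (hsw : ∀ x, swirlPart u x = 0) (t θ φ : ℝ) :
    HasDerivAt (fun φ => -2 * azimuthal (fun x => g x • ePhi x) t θ 0
        * (Real.sin θ * radial u t θ φ + Real.cos θ * polar u t θ φ))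
      ((Real.exp t * Real.sin θ) ^ 2 * (gradSq (fun x => u x + g x • ePhi x) (sph t θ φ)
        - gradSq u (sph t θ φ) - gradSq (fun x => g x • ePhi x) (sph t θ φ))) φ := by
  set G : E3 → E3 := fun x => g x • ePhi x with hG
  have hd : Differentiable ℝ G := hsm.differentiable (by simp)
  have hd' : Differentiable ℝ u := hu.differentiable (by simp)
  have he := Real.exp_ne_zero t
  have haz := azimuthal_eq_zero hu.continuous hsw
  have h1 := hasDerivAt_const_unique (hasDerivAt_radial_t hd t θ φ) fun t => radial_swirl g t θ φ
  have h2 := hasDerivAt_const_unique (hasDerivAt_polar_t hd t θ φ) fun t => polar_swirl g t θ φ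
  have h3 := hasDerivAt_const_unique (hasDerivAt_radial_θ hd t θ φ) fun θ => radial_swirl g t θ φ
  have h4 := hasDerivAt_const_unique (hasDerivAt_polar_θ hd t θ φ) fun θ => polar_swirl g t θ φ
  have h5 := hasDerivAt_const_unique (hasDerivAt_radial_φ hd t θ φ) fun φ => radial_swirl g t θ φ
  have h6 := hasDerivAt_const_unique (hasDerivAt_polar_φ hd t θ φ) fun φ => polar_swirl g t θ φ
  have h7 := hasDerivAt_const_unique (hasDerivAt_azimuthal_φ hd t θ φ)
      fun φ => azimuthal_swirl hg t θ φ
  have h8 := hasDerivAt_const_unique (hasDerivAt_azimuthal_t hd' t θ φ) fun t => haz t θ φ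
  have h9 := hasDerivAt_const_unique (hasDerivAt_azimuthal_θ hd' t θ φ) fun θ => haz t θ φ
  rw [polar_swirl] at h3 h7
  rw [radial_swirl] at h4 h7
  rw [azimuthal_swirl hg] at h5 h6
  simp only [mul_zero, add_zero, sub_zero, mul_eq_zero, he, false_or] at h1 h2 h3 h4 h7 h8 h9
  have eR : dRad (fun x => u x + G x) t θ φ = dRad u t θ φ + dRad G t θ φ := by
    ext i; simp only [dRad, pderiv_add hd' hd, PiLp.add_apply, Pi.add_apply]; ring
  have eP : dPol (fun x => u x + G x) t θ φ = dPol u t θ φ + dPol G t θ φ := by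
    ext i; simp only [dPol, pderiv_add hd' hd, PiLp.add_apply, Pi.add_apply]; ring
  have eA : dAzi (fun x => u x + G x) t θ φ = dAzi u t θ φ + dAzi G t θ φ := by
    ext i; simp only [dAzi, pderiv_add hd' hd, PiLp.add_apply, Pi.add_apply]; ring
  have fR : ∀ v w, frameR θ φ (v + w) = frameR θ φ v + frameR θ φ w := fun v w => by
    simp only [frameR, Pi.add_apply]; ring
  have fP : ∀ v w, frameP θ φ (v + w) = frameP θ φ v + frameP θ φ w := fun v w => by
    simp only [frameP, Pi.add_apply]; ring
  have fA : ∀ v w, frameA φ (v + w) = frameA φ v + frameA φ w := fun v w => by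
    simp only [frameA, Pi.add_apply]; ring
  refine ((((hasDerivAt_radial_φ hd' t θ φ).const_mul (Real.sin θ)).add
    ((hasDerivAt_polar_φ hd' t θ φ).const_mul (Real.cos θ))).const_mul
    (-2 * azimuthal G t θ 0)).congr_deriv ?_
  rw [gradSq_eq_frame, gradSq_eq_frame, gradSq_eq_frame, eR, eP, eA]
  simp only [fR, fP, fA, h1, h2, h3, h4, h8, h9, haz]
  have h7' : Real.exp t * Real.sin θ * frameA φ (dAzi G t θ φ) = 0 := by
    rcases h7 with h | h <;> simp [h]
  -- The cross term comes only from differentiation along `e_φ`: there the rotating frame gives the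
  -- azimuthal field radial and polar derivatives, by `h5` and `h6` proportional to its
  -- `φ`-independent amplitude.
  linear_combination (-2 * (Real.exp t * Real.sin θ) * frameR θ φ (dAzi u t θ φ)) * h5
    + (-2 * (Real.exp t * Real.sin θ) * frameP θ φ (dAzi u t θ φ)) * h6
    + (-2 * (Real.exp t * Real.sin θ) * frameA φ (dAzi u t θ φ)) * h7'

/-- The interaction integrates to zero over each circle about the axis by periodicity. The identity
is established circle by circle before the outer integrations, so it holds without any finiteness.
-/
lemma gradIntegral_add_swirl (hg : IndepOfPhi g) (hsm : ContDiff ℝ ∞ fun x => g x • ePhi x)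
    {u : E3 → E3} (hu : ContDiff ℝ ∞ u) (hsw : ∀ x, swirlPart u x = 0) (γ : ℝ) :
    gradIntegral γ (fun x => u x + g x • ePhi x)
      = gradIntegral γ u + gradIntegral γ (fun x => g x • ePhi x) := by
  set G : E3 → E3 := fun x => g x • ePhi x with hG
  have hs : ContDiff ℝ ∞ fun x => u x + G x := hu.add hsm
  have cφ : ∀ {v : E3 → E3}, ContDiff ℝ ∞ v → ∀ t θ, Continuous fun φ => Real.exp ((2 * γ + 3) * t)
      * gradSq v (sph t θ φ) * Real.sin θ := fun hv t θ =>
    (continuous_grad_density hv γ).comp (by fun_prop : Continuous fun φ : ℝ => (t, θ, φ))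
  have hle : -Real.pi ≤ Real.pi := by linarith [Real.pi_pos]
  have eφ : ∀ {v : E3 → E3}, ContDiff ℝ ∞ v → ∀ t, ∀ θ ∈ Ioo 0 Real.pi,
      ∫⁻ φ in Ioo (-Real.pi) Real.pi,
        ENNReal.ofReal (Real.exp ((2 * γ + 3) * t) * gradSq v (sph t θ φ) * Real.sin θ)
      = ENNReal.ofReal (∫ φ in (-Real.pi)..Real.pi,
        Real.exp ((2 * γ + 3) * t) * gradSq v (sph t θ φ) * Real.sin θ) := by
    intro v hv t θ hθ
    rw [intervalIntegral.integral_of_le hle, integral_Ioc_eq_integral_Ioo]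
    refine (ofReal_integral_eq_lintegral_ofReal
      ((cφ hv t θ).integrableOn_Icc.mono_set Ioo_subset_Icc_self)
      (Filter.Eventually.of_forall fun φ => ?_)).symm
    exact mul_nonneg (mul_nonneg (Real.exp_pos _).le (gradSq_nonneg _ _))
      (Real.sin_pos_of_mem_Ioo hθ).le
  have nφ : ∀ (v : E3 → E3) t, ∀ θ ∈ Ioo 0 Real.pi, 0 ≤ ∫ φ in (-Real.pi)..Real.pi,
      Real.exp ((2 * γ + 3) * t) * gradSq v (sph t θ φ) * Real.sin θ := fun v t θ hθ =>
    intervalIntegral.integral_nonneg hle fun φ _ => mul_nonneg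
      (mul_nonneg (Real.exp_pos _).le (gradSq_nonneg _ _)) (Real.sin_pos_of_mem_Ioo hθ).le
  have key : ∀ t, ∀ θ ∈ Ioo 0 Real.pi, ∫⁻ φ in Ioo (-Real.pi) Real.pi,
        ENNReal.ofReal (Real.exp ((2 * γ + 3) * t) * gradSq (fun x => u x + G x) (sph t θ φ)
          * Real.sin θ)
      = (∫⁻ φ in Ioo (-Real.pi) Real.pi,
          ENNReal.ofReal (Real.exp ((2 * γ + 3) * t) * gradSq u (sph t θ φ) * Real.sin θ))
        + ∫⁻ φ in Ioo (-Real.pi) Real.pi,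
          ENNReal.ofReal (Real.exp ((2 * γ + 3) * t) * gradSq G (sph t θ φ) * Real.sin θ) := by
    intro t θ hθ
    have hsin := Real.sin_pos_of_mem_Ioo hθ
    have hne : Real.exp t * Real.sin θ ≠ 0 := by positivity
    rw [eφ hs t θ hθ, eφ hu t θ hθ, eφ hsm t θ hθ, ← ENNReal.ofReal_add (nφ _ t θ hθ)
      (nφ _ t θ hθ), ← intervalIntegral.integral_add ((cφ hu t θ).intervalIntegrable _ _)
      ((cφ hsm t θ).intervalIntegrable _ _)]
    congr 1
    refine integral_eq_of_sub_hasDerivAt (Φ := fun φ => Real.exp ((2 * γ + 3) * t) * Real.sin θ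
      / (Real.exp t * Real.sin θ) ^ 2 * (-2 * azimuthal G t θ 0
        * (Real.sin θ * radial u t θ φ + Real.cos θ * polar u t θ φ)))
      (cφ hs t θ) ((cφ hu t θ).add (cφ hsm t θ)) (fun φ => ?_) ?_
    · refine ((hasDerivAt_interaction hg hsm hu hsw t θ φ).const_mul _).congr_deriv ?_
      rw [← mul_assoc, div_mul_cancel₀ _ (pow_ne_zero 2 hne)]
      ring
    · simp [radial, polar, sph]
  rw [gradIntegral_eq hs, gradIntegral_eq hu, gradIntegral_eq hsm, ← lintegral_add_left]
  · congr 1; ext t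
    rw [← lintegral_add_left]
    · exact setLIntegral_congr_fun measurableSet_Ioo fun θ hθ => key t θ hθ
    · refine Measurable.lintegral_prod_right' (f := fun p : ℝ × ℝ => ENNReal.ofReal
        (Real.exp ((2 * γ + 3) * t) * gradSq u (sph t p.1 p.2) * Real.sin p.1)) ?_
      exact ((continuous_grad_density hu γ).comp
        (by fun_prop : Continuous fun p : ℝ × ℝ => (t, p.1, p.2))).measurable.ennreal_ofReal
  · have h1 : Measurable fun q : (ℝ × ℝ) × ℝ => ENNReal.ofReal
        (Real.exp ((2 * γ + 3) * q.1.1) * gradSq u (sph q.1.1 q.1.2 q.2) * Real.sin q.1.2) :=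
      ((continuous_grad_density hu γ).comp (by fun_prop : Continuous fun q : (ℝ × ℝ) × ℝ =>
        (q.1.1, q.1.2, q.2))).measurable.ennreal_ofReal
    exact Measurable.lintegral_prod_right'
      (f := fun p : ℝ × ℝ => ∫⁻ φ in Ioo (-Real.pi) Real.pi, ENNReal.ofReal
        (Real.exp ((2 * γ + 3) * p.1) * gradSq u (sph p.1 p.2 φ) * Real.sin p.2))
      h1.lintegral_prod_right'

/-- With `sub_swirl_mem` this makes `fieldsWithSwirl` the translate of `swirlFreeFields` by the
given swirl. -/
lemma add_swirl_mem {γ : ℝ} (hg : IndepOfPhi g) (hG : (fun x => g x • ePhi x) ∈ testFields γ)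
    {u : E3 → E3} (hu : u ∈ swirlFreeFields γ) :
    (fun x => u x + g x • ePhi x) ∈ fieldsWithSwirl γ (fun x => g x • ePhi x) := by
  obtain ⟨⟨h1, h2, h3⟩, h4, h5⟩ := hu
  refine ⟨⟨h1.add hG.1, h2.add hG.2.1, fun h => ?_⟩, fun x => ?_, fun x => ?_⟩
  · simp only [h3 h, hG.2.2 h, add_zero]
  · have := divergence_swirl hg hG.1 x
    have h6 := h4 x
    simp only [divergence, pderiv_add (h1.differentiable (by simp)) (hG.1.differentiable (by simp)),
      PiLp.add_apply, Finset.sum_add_distrib] at *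
    rw [h6, this, add_zero]
  · have h6 := swirlPart_swirl g x
    have h7 := swirlComponent_eq_zero (h5 x)
    simp only [swirlPart, swirlComponent] at *
    rw [inner_add_left, h7, zero_add, h6]

lemma sub_swirl_mem {γ : ℝ} (hg : IndepOfPhi g) (hG : (fun x => g x • ePhi x) ∈ testFields γ)
    {u : E3 → E3} (hu : u ∈ fieldsWithSwirl γ (fun x => g x • ePhi x)) :
    (fun x => u x - g x • ePhi x) ∈ swirlFreeFields γ := by
  obtain ⟨⟨h1, h2, h3⟩, h4, h5⟩ := hu
  have hs : ContDiff ℝ ∞ fun x => u x - g x • ePhi x := h1.sub hG.1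
  refine ⟨⟨hs, h2.sub hG.2.1, fun h => ?_⟩, fun x => ?_, fun x => ?_⟩
  · simp only [h3 h, hG.2.2 h, sub_zero]
  · have := divergence_swirl hg hG.1 x
    have h6 := h4 x
    have e : u = fun x => (u x - g x • ePhi x) + g x • ePhi x := by ext1 x; simp
    rw [e] at h6
    simp only [divergence, pderiv_add (hs.differentiable (by simp))
      (hG.1.differentiable (by simp)), PiLp.add_apply, Finset.sum_add_distrib] at *
    rwa [this, add_zero] at h6
  · have h6 := swirlPart_swirl g x
    have h7 := h5 x
    simp only [swirlPart, swirlComponent] at *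
    rw [inner_sub_left, sub_smul, h7, h6, sub_self]

/-- The weight is positive away from the origin, so a zero integral would make `u` vanish almost
everywhere, hence everywhere by continuity. -/
lemma hardyIntegral_pos {γ : ℝ} {u : E3 → E3} (hu : Continuous u) (h : ∃ x, u x ≠ 0) :
    0 < hardyIntegral γ u := by
  rw [pos_iff_ne_zero]
  intro h0
  have hm : Measurable fun x => ENNReal.ofReal (‖u x‖ ^ 2 * ‖x‖ ^ (2 * γ - 2)) := by
    have := hu.measurable
    fun_prop
  rw [hardyIntegral, lintegral_eq_zero_iff hm] at h0
  have hae : u =ᵐ[volume] fun _ => 0 := by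
    have hne : ∀ᵐ x : E3, x ≠ 0 := by simp [ae_iff, measure_singleton]
    filter_upwards [h0, hne] with x hx hx0
    have h1 : ‖u x‖ ^ 2 * ‖x‖ ^ (2 * γ - 2) ≤ 0 := ENNReal.ofReal_eq_zero.1 hx
    have h2 : 0 < ‖x‖ ^ (2 * γ - 2) := Real.rpow_pos_of_pos (norm_pos_iff.2 hx0) _
    have h3 : ‖u x‖ ^ 2 ≤ 0 := nonpos_of_mul_nonpos_left h1 h2
    simpa using le_antisymm h3 (sq_nonneg _)
  obtain ⟨x, hx⟩ := h
  exact hx (congrFun ((hu.ae_eq_iff_eq volume continuous_const).1 hae) x)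

end Swirl

/-! ### Test fields from radial stream functions -/

/-- The function `s ↦ Ψ (log s / 2)`, extended by zero to `s ≤ 0`. -/
noncomputable def logPullback (Ψ : ℝ → ℝ) (s : ℝ) : ℝ := if s ≤ 0 then 0 else Ψ (Real.log s / 2)

lemma logPullback_exp (Ψ : ℝ → ℝ) (t : ℝ) : logPullback Ψ (Real.exp (2 * t)) = Ψ t := by
  rw [logPullback, if_neg (not_le.2 (Real.exp_pos _)), Real.log_exp]
  congr 1; ring

lemma logPullback_eq_zero {Ψ : ℝ → ℝ} {M s : ℝ} (hM : ∀ t, M ≤ |t| → Ψ t = 0)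
    (hs : s ≤ Real.exp (-(2 * M))) : logPullback Ψ s = 0 := by
  rw [logPullback]
  split_ifs with h
  · rfl
  · push Not at h
    have := Real.log_le_log h hs
    rw [Real.log_exp] at this
    refine hM _ ?_
    rw [le_abs]; right; linarith

lemma logPullback_eq_zero' {Ψ : ℝ → ℝ} {M s : ℝ} (hM : ∀ t, M ≤ |t| → Ψ t = 0)
    (hs : Real.exp (2 * M) ≤ s) : logPullback Ψ s = 0 := by
  have h0 : 0 < s := (Real.exp_pos _).trans_le hs
  rw [logPullback, if_neg (not_le.2 h0)]
  have := Real.log_le_log (Real.exp_pos _) hs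
  rw [Real.log_exp] at this
  refine hM _ ?_
  rw [le_abs]; left; linarith

-- Compact support on the logarithmic scale makes the function vanish for `s ≤ exp(-2M)`, so the
-- singularity of `log` is never met.
open Filter Topology in
lemma contDiff_logPullback {Ψ : ℝ → ℝ} (hΨ : ContDiff ℝ ∞ Ψ) {M : ℝ}
    (hM : ∀ t, M ≤ |t| → Ψ t = 0) : ContDiff ℝ ∞ (logPullback Ψ) := by
  rw [contDiff_iff_contDiffAt]
  intro s
  rcases le_or_gt s 0 with h | h
  · have : logPullback Ψ =ᶠ[𝓝 s] fun _ => 0 := by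
      filter_upwards [Iio_mem_nhds (h.trans_lt (Real.exp_pos (-(2 * M))))] with r hr
      exact logPullback_eq_zero hM (le_of_lt hr)
    exact contDiffAt_const.congr_of_eventuallyEq this
  · have : logPullback Ψ =ᶠ[𝓝 s] fun r => Ψ (Real.log r / 2) := by
      filter_upwards [Ioi_mem_nhds h] with r hr
      rw [logPullback, if_neg (not_le.2 hr)]
    refine ContDiffAt.congr_of_eventuallyEq ?_ this
    exact hΨ.contDiffAt.comp s ((Real.contDiffAt_log.2 h.ne').div_const 2)

/-- The axisymmetric swirl-free solenoidal field with stream function `q (|x|²)`. -/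
noncomputable def streamField (q : ℝ → ℝ) (x : E3) : E3 :=
  (2 * deriv q (‖x‖ ^ 2) * x 0) • x
    - (2 * ‖x‖ ^ 2 * deriv q (‖x‖ ^ 2) + 2 * q (‖x‖ ^ 2)) • EuclideanSpace.single 0 1

lemma streamField_apply (q : ℝ → ℝ) (x : E3) (i : Fin 3) :
    streamField q x i = 2 * deriv q (‖x‖ ^ 2) * x 0 * x i
      - (2 * ‖x‖ ^ 2 * deriv q (‖x‖ ^ 2) + 2 * q (‖x‖ ^ 2)) * (if i = 0 then 1 else 0) := by
  simp [streamField]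

lemma contDiff_streamField {q : ℝ → ℝ} (hq : ContDiff ℝ ∞ q) : ContDiff ℝ ∞ (streamField q) := by
  have h1 : ContDiff ℝ ∞ (deriv q) := (contDiff_infty_iff_deriv.1 hq).2
  have hn : ContDiff ℝ ∞ fun x : E3 => ‖x‖ ^ 2 := contDiff_norm_sq ℝ
  have h0 : ContDiff ℝ ∞ fun x : E3 => x 0 := contDiff_euclidean.1 contDiff_id 0
  have h2 := h1.comp hn
  have h3 := hq.comp hn
  exact (((contDiff_const.mul h2).mul h0).smul contDiff_id).sub
    ((((contDiff_const.mul hn).mul h2).add (contDiff_const.mul h3)).smul contDiff_const)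

set_option maxHeartbeats 1000000 in
lemma pderiv_streamField {q : ℝ → ℝ} (hq : ContDiff ℝ ∞ q) (x : E3) (i j : Fin 3) :
    pderiv j (streamField q) x i = 4 * deriv (deriv q) (‖x‖ ^ 2) * x j * x 0 * x i
      + 2 * deriv q (‖x‖ ^ 2) * ((if j = 0 then 1 else 0) * x i + x 0 * (if j = i then 1 else 0))
      - (if i = 0 then 1 else 0) * (2 * x j)
        * (4 * deriv q (‖x‖ ^ 2) + 2 * ‖x‖ ^ 2 * deriv (deriv q) (‖x‖ ^ 2)) := by
  have h1 : ContDiff ℝ ∞ (deriv q) := (contDiff_infty_iff_deriv.1 hq).2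
  have d0 : ∀ s, HasDerivAt q (deriv q s) s := fun s => (hq.differentiable (by simp) s).hasDerivAt
  have d1 : ∀ s, HasDerivAt (deriv q) (deriv (deriv q) s) s := fun s =>
    (h1.differentiable (by simp) s).hasDerivAt
  have dn : HasFDerivAt (fun x : E3 => ‖x‖ ^ 2) (2 • innerSL ℝ x) x :=
    (hasStrictFDerivAt_norm_sq x).hasFDerivAt
  have dx : ∀ i, HasFDerivAt (fun x : E3 => x i) (PiLp.proj 2 (fun _ : Fin 3 => ℝ) i) x :=
    fun i => PiLp.hasFDerivAt_apply (𝕜 := ℝ) 2 x i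
  have a0 := (d0 (‖x‖ ^ 2)).comp_hasFDerivAt x dn
  have a1 := (d1 (‖x‖ ^ 2)).comp_hasFDerivAt x dn
  have hmain := (((a1.const_mul 2).mul (dx 0)).mul (dx i)).sub
    ((((dn.const_mul 2).mul a1).add (a0.const_mul 2)).mul_const
      (if i = 0 then (1 : ℝ) else 0))
  have hcomp : HasFDerivAt (fun x => streamField q x i)
      (PiLp.proj 2 (fun _ : Fin 3 => ℝ) i ∘L fderiv ℝ (streamField q) x) x :=
    (PiLp.hasFDerivAt_apply (𝕜 := ℝ) 2 (streamField q x) i).comp x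
      ((contDiff_streamField hq).differentiable (by simp) x).hasFDerivAt
  have e : (fun x => streamField q x i) = _ := funext fun x => streamField_apply q x i
  rw [e] at hcomp
  have := congrArg (fun L : E3 →L[ℝ] ℝ => L (EuclideanSpace.single j 1)) (hcomp.unique hmain)
  have e2 : pderiv j (streamField q) x i = (PiLp.proj 2 (fun _ : Fin 3 => ℝ) i
    ∘L fderiv ℝ (streamField q) x) (EuclideanSpace.single j 1) := rfl
  rw [e2]
  refine this.trans ?_
  generalize (if i = 0 then (1 : ℝ) else 0) = δ
  simp [EuclideanSpace.inner_single_right, eq_comm]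
  split_ifs <;> ring

lemma divergence_streamField {q : ℝ → ℝ} (hq : ContDiff ℝ ∞ q) (x : E3) :
    divergence (streamField q) x = 0 := by
  have hn := norm_sq_eq_sum x
  simp only [divergence, Fin.sum_univ_three, pderiv_streamField hq]
  simp
  linear_combination (-4 * deriv (deriv q) (‖x‖ ^ 2) * x 0) * hn

lemma swirlPart_streamField (q : ℝ → ℝ) (x : E3) : swirlPart (streamField q) x = 0 := by
  have : swirlComponent (streamField q) x = 0 := by
    rw [swirlComponent, ePhi, inner_smul_right, PiLp.inner_apply, Fin.sum_univ_three]
    simp [streamField_apply]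
    right; ring
  rw [swirlPart, this, zero_smul]

/-- At fixed radius both densities, here and in `gradSq_streamField`, are affine in `x₀² = ρ² cos²
θ`; the angular integral is then `integral_quadratic_cos_mul_sin`. -/
lemma norm_sq_streamField (q : ℝ → ℝ) (x : E3) :
    ‖streamField q x‖ ^ 2 = (2 * ‖x‖ ^ 2 * deriv q (‖x‖ ^ 2) + 2 * q (‖x‖ ^ 2)) ^ 2
      + x 0 ^ 2 * (-4 * ‖x‖ ^ 2 * deriv q (‖x‖ ^ 2) ^ 2
        - 8 * deriv q (‖x‖ ^ 2) * q (‖x‖ ^ 2)) := by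
  have hn := norm_sq_eq_sum x
  rw [norm_sq_eq_sum (streamField q x)]
  simp only [streamField_apply]
  simp
  linear_combination (-4 * deriv q (‖x‖ ^ 2) ^ 2 * x 0 ^ 2) * hn

lemma gradSq_streamField {q : ℝ → ℝ} (hq : ContDiff ℝ ∞ q) (x : E3) :
    gradSq (streamField q) x
      = x 0 ^ 2 * (-(4 * (deriv q (‖x‖ ^ 2) + ‖x‖ ^ 2 * deriv (deriv q) (‖x‖ ^ 2))) ^ 2
        - 32 * deriv q (‖x‖ ^ 2) * (deriv q (‖x‖ ^ 2) + ‖x‖ ^ 2 * deriv (deriv q) (‖x‖ ^ 2))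
        + 4 * deriv q (‖x‖ ^ 2) ^ 2)
      + ‖x‖ ^ 2 * ((4 * (deriv q (‖x‖ ^ 2) + ‖x‖ ^ 2 * deriv (deriv q) (‖x‖ ^ 2))) ^ 2
        + 32 * deriv q (‖x‖ ^ 2) * (deriv q (‖x‖ ^ 2) + ‖x‖ ^ 2 * deriv (deriv q) (‖x‖ ^ 2))
        + 20 * deriv q (‖x‖ ^ 2) ^ 2) := by
  have hn := norm_sq_eq_sum x
  simp only [gradSq, Fin.sum_univ_three, pderiv_streamField hq]
  simp
  generalize deriv (deriv q) (‖x‖ ^ 2) = q2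
  generalize deriv q (‖x‖ ^ 2) = q1
  rw [hn]
  ring

lemma integral_quadratic_cos_mul_sin (A B : ℝ) :
    ∫ θ in 0..Real.pi, (A + B * Real.cos θ ^ 2) * Real.sin θ = 2 * A + 2 / 3 * B := by
  have h : ∀ θ ∈ uIcc 0 Real.pi, HasDerivAt
      (fun θ => -(A * Real.cos θ) - B / 3 * Real.cos θ ^ 3)
      ((A + B * Real.cos θ ^ 2) * Real.sin θ) θ := fun θ _ => by
    have hc := Real.hasDerivAt_cos θ
    refine (((hc.const_mul A).neg).sub ((hc.pow 3).const_mul (B / 3))).congr_deriv ?_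
    ring
  rw [intervalIntegral.integral_eq_sub_of_hasDerivAt h
    (Continuous.intervalIntegrable (by fun_prop) _ _)]
  simp
  ring

lemma lintegral_quadratic_cos {A B : ℝ → ℝ} (hA : Continuous A) (hB : Continuous B)
    (h : ∀ t θ, 0 ≤ A t + B t * Real.cos θ ^ 2)
    (hi : Integrable fun t => 2 * A t + 2 / 3 * B t) :
    ∫⁻ t, ∫⁻ θ in Ioo 0 Real.pi, ∫⁻ _ in Ioo (-Real.pi) Real.pi,
      ENNReal.ofReal ((A t + B t * Real.cos θ ^ 2) * Real.sin θ)
    = ENNReal.ofReal (∫ t, (2 * A t + 2 / 3 * B t)) * ENNReal.ofReal (2 * Real.pi) := by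
  have hp : ∀ t, polarInt (fun t θ => A t + B t * Real.cos θ ^ 2) t = 2 * A t + 2 / 3 * B t :=
    fun t => integral_quadratic_cos_mul_sin _ _
  have hc : Continuous (Function.uncurry fun t θ => A t + B t * Real.cos θ ^ 2) := by
    simp only [Function.uncurry_def]; fun_prop
  have h1 : ∀ t, ∫⁻ θ in Ioo 0 Real.pi, ∫⁻ _ in Ioo (-Real.pi) Real.pi,
      ENNReal.ofReal ((A t + B t * Real.cos θ ^ 2) * Real.sin θ)
      = ENNReal.ofReal (2 * A t + 2 / 3 * B t) * ENNReal.ofReal (2 * Real.pi) := fun t => by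
    simp only [setLIntegral_const, Real.volume_Ioo]
    rw [lintegral_mul_const' _ _ ENNReal.ofReal_ne_top, lintegral_polar hc (h t), hp,
      sub_neg_eq_add, two_mul Real.pi]
  simp only [h1]
  rw [lintegral_mul_const' _ _ ENNReal.ofReal_ne_top,
    ofReal_integral_eq_lintegral_ofReal hi (Filter.Eventually.of_forall fun t => ?_)]
  exact (polarInt_nonneg (h t)).trans_eq (hp t)

lemma exists_forall_le_abs_eq_zero {φ : ℝ → ℝ} (h : HasCompactSupport φ) :
    ∃ M, ∀ t, M ≤ |t| → φ t = 0 ∧ deriv φ t = 0 ∧ deriv (deriv φ) t = 0 := by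
  obtain ⟨M, hM⟩ := h.isBounded.subset_closedBall 0
  refine ⟨M + 1, fun t ht => ?_⟩
  have hn : t ∉ tsupport φ := fun hm => by
    have := hM hm
    rw [mem_closedBall_zero_iff, Real.norm_eq_abs] at this
    linarith
  have h1 : tsupport (deriv φ) ⊆ tsupport φ :=
    closure_minimal (support_deriv_subset (f := φ)) (isClosed_tsupport φ)
  exact ⟨image_eq_zero_of_notMem_tsupport hn,
    image_eq_zero_of_notMem_tsupport fun hm => hn (h1 hm),
    Function.notMem_support.1 fun hm => hn (h1 (support_deriv_subset hm))⟩

lemma integrable_of_forall_le_abs_eq_zero {f : ℝ → ℝ} (hf : Continuous f) {M : ℝ}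
    (h : ∀ t, M ≤ |t| → f t = 0) : Integrable f := by
  refine hf.integrable_of_hasCompactSupport
    (HasCompactSupport.intro (isCompact_closedBall 0 M) fun t ht => h t ?_)
  rw [mem_closedBall_zero_iff, Real.norm_eq_abs] at ht
  exact (not_le.1 ht).le

lemma hasDerivAt_exp_two_mul (t : ℝ) :
    HasDerivAt (fun t => Real.exp (2 * t)) (2 * Real.exp (2 * t)) t := by
  refine (((hasDerivAt_id t).const_mul 2).exp).congr_deriv ?_
  simp [mul_comm]

/-- With `s = exp(2t)` one has `d/dt = 2s d/ds`; the resulting `2s q'` and `4s(q' + s q'')` are the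
combinations that occur in the norm and gradient of `streamField`. -/
lemma deriv_logPullback {Ψ Ψ₁ Ψ₂ : ℝ → ℝ} (hq : ContDiff ℝ ∞ (logPullback Ψ))
    (h1 : ∀ t, HasDerivAt Ψ (Ψ₁ t) t) (h2 : ∀ t, HasDerivAt Ψ₁ (Ψ₂ t) t) (t : ℝ) :
    Ψ₁ t = 2 * Real.exp (2 * t) * deriv (logPullback Ψ) (Real.exp (2 * t)) ∧
    Ψ₂ t = 4 * Real.exp (2 * t) * (deriv (logPullback Ψ) (Real.exp (2 * t))
      + Real.exp (2 * t) * deriv (deriv (logPullback Ψ)) (Real.exp (2 * t))) := by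
  have c1 : ContDiff ℝ ∞ (deriv (logPullback Ψ)) := (contDiff_infty_iff_deriv.1 hq).2
  have e1 : ∀ t, Ψ₁ t = 2 * Real.exp (2 * t) * deriv (logPullback Ψ) (Real.exp (2 * t)) :=
    fun t => by
    have hd := ((hq.differentiable (by simp)) (Real.exp (2 * t))).hasDerivAt.comp t
      (hasDerivAt_exp_two_mul t)
    have he : logPullback Ψ ∘ (fun t => Real.exp (2 * t)) = Ψ := funext (logPullback_exp Ψ)
    rw [he] at hd
    rw [(h1 t).unique hd]; ring
  refine ⟨e1 t, ?_⟩
  have hd := ((hasDerivAt_exp_two_mul t).const_mul 1).mul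
    ((((c1.differentiable (by simp)) (Real.exp (2 * t))).hasDerivAt.comp t
      (hasDerivAt_exp_two_mul t)).const_mul 2)
  have he : Ψ₁ = _ := funext e1
  have hd' : HasDerivAt Ψ₁ _ t := hd.congr_of_eventuallyEq (Filter.Eventually.of_forall fun t => by
    simp [e1]; ring)
  rw [(h2 t).unique hd']
  simp; ring

lemma streamField_mem_swirlFreeFields {Ψ : ℝ → ℝ} (hΨ : ContDiff ℝ ∞ Ψ) {M : ℝ}
    (hM : ∀ t, M ≤ |t| → Ψ t = 0) (γ : ℝ) :
    streamField (logPullback Ψ) ∈ swirlFreeFields γ := by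
  have hq := contDiff_logPullback hΨ hM
  refine ⟨⟨contDiff_streamField hq, ?_, fun _ => ?_⟩, divergence_streamField hq,
    swirlPart_streamField _⟩
  · refine HasCompactSupport.intro (isCompact_closedBall 0 (Real.exp M)) fun x hx => ?_
    rw [mem_closedBall_zero_iff, not_le] at hx
    have hs : Real.exp (2 * M) < ‖x‖ ^ 2 := by
      rw [two_mul, Real.exp_add, ← sq]
      exact pow_lt_pow_left₀ hx (Real.exp_pos _).le two_ne_zero
    have h0 : logPullback Ψ =ᶠ[nhds (‖x‖ ^ 2)] fun _ => 0 := by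
      filter_upwards [Ioi_mem_nhds hs] with r hr
      exact logPullback_eq_zero' hM (le_of_lt hr)
    simp [streamField, h0.deriv_eq, h0.eq_of_nhds]
  · simp [streamField, logPullback]

/-! ### Optimality for swirl-free fields -/

/-- Testing the inequality with stream functions that depend on `|x|` only. -/
lemma stream_ineq {γ C : ℝ} (hC : 0 ≤ C) (h : ∀ u ∈ swirlFreeFields γ, HardyLerayIneq γ C u)
    {k : ℝ} (hk : k = γ + 1 / 2) {φ φ₁ φ₂ : ℝ → ℝ} (hφ : ContDiff ℝ ∞ φ)
    (d1 : ∀ t, HasDerivAt φ (φ₁ t) t) (d2 : ∀ t, HasDerivAt φ₁ (φ₂ t) t)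
    (c2 : Continuous φ₂) {M : ℝ} (hM : ∀ t, M ≤ |t| → φ t = 0 ∧ φ₁ t = 0 ∧ φ₂ t = 0) :
    C * ∫ t, ((φ₁ t - k * φ t) ^ 2 + 4 * (φ₁ t - k * φ t) * φ t + 6 * φ t ^ 2)
      ≤ ∫ t, ((φ₂ t - 2 * k * φ₁ t + k ^ 2 * φ t) ^ 2
        + 4 * (φ₁ t - k * φ t) * (φ₂ t - 2 * k * φ₁ t + k ^ 2 * φ t)
        + 8 * (φ₁ t - k * φ t) ^ 2) := by
  have c0 : Continuous φ := hφ.continuous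
  have c1 : Continuous φ₁ := continuous_iff_continuousAt.2 fun t => (d2 t).continuousAt
  -- The factor `exp(-kt)` cancels both power weights, leaving integrals with constant coefficients
  -- in `t`.
  set Ψ : ℝ → ℝ := fun t => Real.exp (-k * t) * φ t with hΨdef
  have hΨ : ContDiff ℝ ∞ Ψ := by fun_prop
  have hΨ0 : ∀ t, M ≤ |t| → Ψ t = 0 := fun t ht => by simp [hΨdef, (hM t ht).1]
  have dE : ∀ t, HasDerivAt (fun t => Real.exp (-k * t)) (-k * Real.exp (-k * t)) t := fun t => by
    refine (((hasDerivAt_id t).const_mul (-k)).exp).congr_deriv ?_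
    simp [mul_comm]
  have dΨ : ∀ t, HasDerivAt Ψ (Real.exp (-k * t) * (φ₁ t - k * φ t)) t := fun t => by
    refine ((dE t).mul (d1 t)).congr_deriv ?_
    ring
  have dΨ1 : ∀ t, HasDerivAt (fun t => Real.exp (-k * t) * (φ₁ t - k * φ t))
      (Real.exp (-k * t) * (φ₂ t - 2 * k * φ₁ t + k ^ 2 * φ t)) t := fun t => by
    refine ((dE t).mul ((d2 t).sub ((d1 t).const_mul k))).congr_deriv ?_
    simp only [Pi.sub_apply]
    ring
  have hq := contDiff_logPullback hΨ hΨ0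
  have hD := deriv_logPullback hq dΨ dΨ1
  set q := logPullback Ψ with hqdef
  have hmem : streamField q ∈ swirlFreeFields γ := streamField_mem_swirlFreeFields hΨ hΨ0 γ
  have hsm := hmem.1.1
  have hs : ∀ t θ φ, ‖sph t θ φ‖ ^ 2 = Real.exp (2 * t) := fun t θ φ => by
    rw [norm_sph, two_mul, Real.exp_add, sq]
  have hx0 : ∀ t θ φ, sph t θ φ 0 ^ 2 = Real.exp (2 * t) * Real.cos θ ^ 2 := fun t θ φ => by
    rw [two_mul, Real.exp_add]; simp [sph]; ring
  have hw : ∀ t, Real.exp (2 * k * t) * Real.exp (-k * t) * Real.exp (-k * t) = 1 := fun t => by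
    rw [← Real.exp_add, ← Real.exp_add]; ring_nf; exact Real.exp_zero
  have hH : ∀ t θ φ', Real.exp ((2 * γ + 1) * t) * ‖streamField q (sph t θ φ')‖ ^ 2
      = (φ₁ t - k * φ t + 2 * φ t) ^ 2
        + (-(φ₁ t - k * φ t) ^ 2 - 4 * (φ₁ t - k * φ t) * φ t) * Real.cos θ ^ 2 := fun t θ φ' => by
    have e : (2 * γ + 1) * t = 2 * k * t := by rw [hk]; ring
    have e0 : q (Real.exp (2 * t)) = Real.exp (-k * t) * φ t := logPullback_exp Ψ t
    obtain ⟨e1, -⟩ := hD t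
    rw [norm_sq_streamField, hs, hx0, e0, e]
    have : ∀ s q₁ c : ℝ, (2 * s * q₁ + 2 * (Real.exp (-k * t) * φ t)) ^ 2 + s * c *
        (-4 * s * q₁ ^ 2 - 8 * q₁ * (Real.exp (-k * t) * φ t))
        = (2 * s * q₁ + 2 * (Real.exp (-k * t) * φ t)) ^ 2 +
          c * (-(2 * s * q₁) ^ 2 - 4 * (2 * s * q₁) * (Real.exp (-k * t) * φ t)) := by
      intros; ring
    rw [this, ← e1]
    linear_combination ((φ₁ t - k * φ t + 2 * φ t) ^ 2
        + (-(φ₁ t - k * φ t) ^ 2 - 4 * (φ₁ t - k * φ t) * φ t) * Real.cos θ ^ 2) * hw t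
  have hG : ∀ t θ φ', Real.exp ((2 * γ + 3) * t) * gradSq (streamField q) (sph t θ φ')
      = ((φ₂ t - 2 * k * φ₁ t + k ^ 2 * φ t) ^ 2
        + 4 * (φ₁ t - k * φ t) * (φ₂ t - 2 * k * φ₁ t + k ^ 2 * φ t)
        + 5 * (φ₁ t - k * φ t) ^ 2)
        + (-(φ₂ t - 2 * k * φ₁ t + k ^ 2 * φ t) ^ 2
        - 4 * (φ₁ t - k * φ t) * (φ₂ t - 2 * k * φ₁ t + k ^ 2 * φ t)
        + (φ₁ t - k * φ t) ^ 2) * Real.cos θ ^ 2 := fun t θ φ' => by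
    have e : (2 * γ + 3) * t = 2 * k * t + 2 * t := by rw [hk]; ring
    obtain ⟨e1, e2⟩ := hD t
    rw [gradSq_streamField hq, hs, hx0, e, Real.exp_add]
    have : ∀ w s q₁ q₂ c : ℝ, w * s * (s * c * (-(4 * (q₁ + s * q₂)) ^ 2
          - 32 * q₁ * (q₁ + s * q₂) + 4 * q₁ ^ 2)
        + s * ((4 * (q₁ + s * q₂)) ^ 2 + 32 * q₁ * (q₁ + s * q₂) + 20 * q₁ ^ 2))
        = w * ((4 * s * (q₁ + s * q₂)) ^ 2 + 4 * (2 * s * q₁) * (4 * s * (q₁ + s * q₂))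
          + 5 * (2 * s * q₁) ^ 2 + (-(4 * s * (q₁ + s * q₂)) ^ 2
          - 4 * (2 * s * q₁) * (4 * s * (q₁ + s * q₂)) + (2 * s * q₁) ^ 2) * c) := by
      intros; ring
    rw [this, ← e1, ← e2]
    linear_combination (((φ₂ t - 2 * k * φ₁ t + k ^ 2 * φ t) ^ 2
        + 4 * (φ₁ t - k * φ t) * (φ₂ t - 2 * k * φ₁ t + k ^ 2 * φ t)
        + 5 * (φ₁ t - k * φ t) ^ 2)
        + (-(φ₂ t - 2 * k * φ₁ t + k ^ 2 * φ t) ^ 2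
        - 4 * (φ₁ t - k * φ t) * (φ₂ t - 2 * k * φ₁ t + k ^ 2 * φ t)
        + (φ₁ t - k * φ t) ^ 2) * Real.cos θ ^ 2) * hw t
  have hineq := h _ hmem
  rw [HardyLerayIneq, hardyIntegral_eq hsm.continuous, gradIntegral_eq hsm] at hineq
  simp only [hH, hG] at hineq
  rw [lintegral_quadratic_cos (by fun_prop) (by fun_prop)
      (fun t θ => by rw [← hH t θ 0]; positivity)
      (integrable_of_forall_le_abs_eq_zero (M := M) (by fun_prop)
        fun t ht => by simp [hM t ht]),
    lintegral_quadratic_cos (by fun_prop) (by fun_prop)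
      (fun t θ => by rw [← hG t θ 0]; exact mul_nonneg (Real.exp_pos _).le (gradSq_nonneg _ _))
      (integrable_of_forall_le_abs_eq_zero (M := M) (by fun_prop)
        fun t ht => by simp [hM t ht]), ← mul_assoc, ← ENNReal.ofReal_mul hC,
    ENNReal.mul_le_mul_iff_left (by simp [Real.pi_pos]) ENNReal.ofReal_ne_top] at hineq
  have eH : ∀ t, 2 * (φ₁ t - k * φ t + 2 * φ t) ^ 2
      + 2 / 3 * (-(φ₁ t - k * φ t) ^ 2 - 4 * (φ₁ t - k * φ t) * φ t)
      = 4 / 3 * ((φ₁ t - k * φ t) ^ 2 + 4 * (φ₁ t - k * φ t) * φ t + 6 * φ t ^ 2) := by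
    intro t; ring
  have eG : ∀ t, 2 * ((φ₂ t - 2 * k * φ₁ t + k ^ 2 * φ t) ^ 2
        + 4 * (φ₁ t - k * φ t) * (φ₂ t - 2 * k * φ₁ t + k ^ 2 * φ t)
        + 5 * (φ₁ t - k * φ t) ^ 2)
        + 2 / 3 * (-(φ₂ t - 2 * k * φ₁ t + k ^ 2 * φ t) ^ 2
        - 4 * (φ₁ t - k * φ t) * (φ₂ t - 2 * k * φ₁ t + k ^ 2 * φ t)
        + (φ₁ t - k * φ t) ^ 2)
      = 4 / 3 * ((φ₂ t - 2 * k * φ₁ t + k ^ 2 * φ t) ^ 2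
        + 4 * (φ₁ t - k * φ t) * (φ₂ t - 2 * k * φ₁ t + k ^ 2 * φ t)
        + 8 * (φ₁ t - k * φ t) ^ 2) := by
    intro t; ring
  simp only [eH, eG, integral_const_mul] at hineq
  rw [ENNReal.ofReal_le_ofReal_iff] at hineq
  · linarith
  · refine mul_nonneg (by norm_num) (integral_nonneg fun t => ?_)
    change 0 ≤ (_ : ℝ)
    nlinarith [sq_nonneg ((φ₂ t - 2 * k * φ₁ t + k ^ 2 * φ t) + 2 * (φ₁ t - k * φ t)),
      sq_nonneg (φ₁ t - k * φ t)]

/-- The two-parameter average of `stream_ineq` over the phases of an oscillation with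
frequency `w` and slowly varying amplitude `E`. -/
lemma modulated_ineq {γ C : ℝ} (hC : 0 ≤ C) (h : ∀ u ∈ swirlFreeFields γ, HardyLerayIneq γ C u)
    {k : ℝ} (hk : k = γ + 1 / 2) (w : ℝ) {E E₁ E₂ : ℝ → ℝ} (hE : ContDiff ℝ ∞ E)
    (d1 : ∀ t, HasDerivAt E (E₁ t) t) (d2 : ∀ t, HasDerivAt E₁ (E₂ t) t)
    (c2 : Continuous E₂) {M : ℝ} (hM : ∀ t, M ≤ |t| → E t = 0 ∧ E₁ t = 0 ∧ E₂ t = 0) :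
    C * ∫ t, ((E₁ t - k * E t) ^ 2 + w ^ 2 * E t ^ 2 + 4 * (E₁ t - k * E t) * E t + 6 * E t ^ 2)
      ≤ ∫ t, ((E₂ t - 2 * k * E₁ t + (k ^ 2 - w ^ 2) * E t) ^ 2
        + (2 * w * E₁ t - 2 * k * w * E t) ^ 2
        + 4 * ((E₁ t - k * E t) * (E₂ t - 2 * k * E₁ t + (k ^ 2 - w ^ 2) * E t)
          + w * E t * (2 * w * E₁ t - 2 * k * w * E t))
        + 8 * ((E₁ t - k * E t) ^ 2 + w ^ 2 * E t ^ 2)) := by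
  have c0 : Continuous E := hE.continuous
  have c1 : Continuous E₁ := continuous_iff_continuousAt.2 fun t => (d2 t).continuousAt
  have dl : ∀ t, HasDerivAt (fun t => w * t) w t := fun t => by
    simpa using (hasDerivAt_id t).const_mul w
  have dc : ∀ t, HasDerivAt (fun t => Real.cos (w * t)) (-w * Real.sin (w * t)) t := fun t =>
    (dl t).cos.congr_deriv (by ring)
  have ds : ∀ t, HasDerivAt (fun t => Real.sin (w * t)) (w * Real.cos (w * t)) t := fun t =>
    (dl t).sin.congr_deriv (by ring)
  have hcos := stream_ineq hC h hk (φ := fun t => Real.cos (w * t) * E t)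
    (φ₁ := fun t => -w * (Real.sin (w * t) * E t) + Real.cos (w * t) * E₁ t)
    (φ₂ := fun t => -w ^ 2 * (Real.cos (w * t) * E t) - 2 * w * (Real.sin (w * t) * E₁ t)
      + Real.cos (w * t) * E₂ t) (M := M) (by fun_prop)
    (fun t => ((dc t).mul (d1 t)).congr_deriv (by ring))
    (fun t => ((((ds t).mul (d1 t)).const_mul (-w)).add ((dc t).mul (d2 t))).congr_deriv (by ring))
    (by fun_prop) (fun t ht => by simp [hM t ht])
  have hsin := stream_ineq hC h hk (φ := fun t => Real.sin (w * t) * E t)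
    (φ₁ := fun t => w * (Real.cos (w * t) * E t) + Real.sin (w * t) * E₁ t)
    (φ₂ := fun t => -w ^ 2 * (Real.sin (w * t) * E t) + 2 * w * (Real.cos (w * t) * E₁ t)
      + Real.sin (w * t) * E₂ t) (M := M) (by fun_prop)
    (fun t => ((ds t).mul (d1 t)).congr_deriv (by ring))
    (fun t => ((((dc t).mul (d1 t)).const_mul w).add ((ds t).mul (d2 t))).congr_deriv (by ring))
    (by fun_prop) (fun t ht => by simp [hM t ht])
  -- Adding the two phases removes the oscillating factors through `sin² + cos² = 1`.
  have hsum := add_le_add hcos hsin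
  rw [← mul_add, ← integral_add, ← integral_add] at hsum
  · refine (le_of_eq ?_).trans (hsum.trans (le_of_eq ?_))
    · congr 2
      ext t
      linear_combination (-((E₁ t - k * E t) ^ 2 + w ^ 2 * E t ^ 2
        + 4 * (E₁ t - k * E t) * E t + 6 * E t ^ 2)) * Real.sin_sq_add_cos_sq (w * t)
    · congr 1
      ext t
      linear_combination ((E₂ t - 2 * k * E₁ t + (k ^ 2 - w ^ 2) * E t) ^ 2
        + (2 * w * E₁ t - 2 * k * w * E t) ^ 2
        + 4 * ((E₁ t - k * E t) * (E₂ t - 2 * k * E₁ t + (k ^ 2 - w ^ 2) * E t)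
          + w * E t * (2 * w * E₁ t - 2 * k * w * E t))
        + 8 * ((E₁ t - k * E t) ^ 2 + w ^ 2 * E t ^ 2)) * Real.sin_sq_add_cos_sq (w * t)
  all_goals
    exact integrable_of_forall_le_abs_eq_zero (M := M) (by fun_prop)
      fun t ht => by simp [hM t ht]

-- With the envelope `η(εt)` and `ε → 0`, every term with a derivative of the envelope disappears.
-- What is left on both sides is the Fourier symbol at frequency `w` times `∫ η²`.
open Filter Topology in
lemma le_symbol {γ C : ℝ} (hC : 0 ≤ C) (h : ∀ u ∈ swirlFreeFields γ, HardyLerayIneq γ C u)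
    {k : ℝ} (hk : k = γ + 1 / 2) (w : ℝ) :
    C * (k ^ 2 + w ^ 2 - 4 * k + 6) ≤ (k ^ 2 + w ^ 2) * (k ^ 2 + w ^ 2 - 4 * k + 8) := by
  let b : ContDiffBump (0 : ℝ) := ⟨1, 2, one_pos, one_lt_two⟩
  set η : ℝ → ℝ := fun t => b t with hη
  have sη : ContDiff ℝ ∞ η := b.contDiff
  obtain ⟨M, hM⟩ := exists_forall_le_abs_eq_zero (φ := η) b.hasCompactSupport
  have s1 : ContDiff ℝ ∞ (deriv η) := (contDiff_infty_iff_deriv.1 sη).2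
  have s2 : ContDiff ℝ ∞ (deriv (deriv η)) := (contDiff_infty_iff_deriv.1 s1).2
  have d1 : ∀ t, HasDerivAt η (deriv η t) t := fun t =>
    (sη.differentiable (by simp) t).hasDerivAt
  have d2 : ∀ t, HasDerivAt (deriv η) (deriv (deriv η) t) t := fun t =>
    (s1.differentiable (by simp) t).hasDerivAt
  have c0 := sη.continuous
  have c1 := s1.continuous
  have c2 := s2.continuous
  set η₁ := deriv η
  set η₂ := deriv η₁
  have hpos : 0 < ∫ t, η t ^ 2 := by
    refine (c0.pow 2).integral_pos_of_hasCompactSupport_nonneg_nonzero (x := 0) ?_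
      (fun t => sq_nonneg _) ?_
    · refine HasCompactSupport.intro (isCompact_closedBall 0 M) fun t ht => ?_
      rw [mem_closedBall_zero_iff, Real.norm_eq_abs, not_le] at ht
      simp [hM t ht.le]
    · have : η 0 = 1 := b.one_of_mem_closedBall (by simp [b])
      simp [this]
  have hcont : ∀ f : ℝ → ℝ → ℝ, Continuous (Function.uncurry f) →
      (∀ ε t, M ≤ |t| → f ε t = 0) → Continuous fun ε => ∫ t, f ε t := fun f hf h0 => by
    have := continuous_parametric_integral_of_continuous (μ := volume) hf
      (isCompact_closedBall (0 : ℝ) M)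
    refine this.congr fun ε => setIntegral_eq_integral_of_forall_compl_eq_zero fun t ht => ?_
    rw [mem_closedBall_zero_iff, Real.norm_eq_abs, not_le] at ht
    exact h0 ε t ht.le
  set H : ℝ → ℝ → ℝ := fun ε t => (ε * η₁ t - k * η t) ^ 2 + w ^ 2 * η t ^ 2
    + 4 * (ε * η₁ t - k * η t) * η t + 6 * η t ^ 2 with hH
  set G : ℝ → ℝ → ℝ := fun ε t => (ε ^ 2 * η₂ t - 2 * k * (ε * η₁ t) + (k ^ 2 - w ^ 2) * η t) ^ 2
        + (2 * w * (ε * η₁ t) - 2 * k * w * η t) ^ 2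
        + 4 * ((ε * η₁ t - k * η t) * (ε ^ 2 * η₂ t - 2 * k * (ε * η₁ t) + (k ^ 2 - w ^ 2) * η t)
          + w * η t * (2 * w * (ε * η₁ t) - 2 * k * w * η t))
        + 8 * ((ε * η₁ t - k * η t) ^ 2 + w ^ 2 * η t ^ 2) with hG
  have cH : Continuous fun ε => ∫ t, H ε t :=
    hcont H (by simp only [hH, Function.uncurry_def]; fun_prop) fun ε t ht => by
      simp [hH, hM t ht]
  have cG : Continuous fun ε => ∫ t, G ε t :=
    hcont G (by simp only [hG, Function.uncurry_def]; fun_prop) fun ε t ht => by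
      simp [hG, hM t ht]
  have hle : ∀ ε, 0 < ε → C * ∫ t, H ε t ≤ ∫ t, G ε t := fun ε hε => by
    have dm : ∀ t, HasDerivAt (fun t => ε * t) ε t := fun t => by
      simpa using (hasDerivAt_id t).const_mul ε
    have := modulated_ineq hC h hk w (E := fun t => η (ε * t)) (E₁ := fun t => ε * η₁ (ε * t))
      (E₂ := fun t => ε ^ 2 * η₂ (ε * t)) (M := M / ε) (by fun_prop)
      (fun t => ((d1 (ε * t)).comp t (dm t)).congr_deriv (by ring))
      (fun t => (((d2 (ε * t)).comp t (dm t)).const_mul ε).congr_deriv (by ring))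
      (by fun_prop) (fun t ht => by
        have : M ≤ |ε * t| := by
          rw [abs_mul, abs_of_pos hε, mul_comm]
          exact (div_le_iff₀ hε).1 ht
        simp [hM _ this])
    have eH := Measure.integral_comp_mul_left (H ε) ε
    have eG := Measure.integral_comp_mul_left (G ε) ε
    have hp : 0 < |ε⁻¹| := abs_pos.2 (inv_ne_zero hε.ne')
    change C * ∫ t, H ε (ε * t) ≤ ∫ t, G ε (ε * t) at this
    rw [eH, eG, smul_eq_mul, smul_eq_mul, mul_left_comm] at this
    exact le_of_mul_le_mul_left this hp
  have hlim : C * ∫ t, H 0 t ≤ ∫ t, G 0 t := by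
    refine le_of_tendsto_of_tendsto
      (((cH.tendsto 0).const_mul C).mono_left (nhdsWithin_le_nhds (s := Ioi 0)))
      ((cG.tendsto 0).mono_left nhdsWithin_le_nhds) ?_
    filter_upwards [self_mem_nhdsWithin] with ε hε using hle ε hε
  have e1 : ∀ t, H 0 t = (k ^ 2 + w ^ 2 - 4 * k + 6) * η t ^ 2 := fun t => by
    simp only [hH]; ring
  have e2 : ∀ t, G 0 t = ((k ^ 2 + w ^ 2) * (k ^ 2 + w ^ 2 - 4 * k + 8)) * η t ^ 2 := fun t => by
    simp only [hG]; ring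
  simp only [e1, e2, integral_const_mul] at hlim
  rw [← mul_assoc] at hlim
  exact le_of_mul_le_mul_right hlim hpos

/-- Optimality of the constant for swirl-free fields. -/
lemma le_constSwirlFree {γ C : ℝ} (h : ∀ u ∈ swirlFreeFields γ, HardyLerayIneq γ C u) :
    C ≤ constSwirlFree γ := by
  rcases le_or_gt C 0 with hC | hC
  -- `ENNReal.ofReal` sends nonpositive `C` to 0, so the hypothesis says nothing about them.
  · exact hC.trans (constSwirlFree_nonneg γ)
  · have h0 := auxArgmin_nonneg γ
    -- The frequency is chosen so that its square is the minimiser; `k² + w² - 4k + 6` is then the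
    -- denominator in `auxFun`.
    have hs := le_symbol hC.le h rfl (Real.sqrt (auxArgmin γ))
    rw [Real.sq_sqrt h0] at hs
    rw [constSwirlFree_eq, auxFun]
    set x := auxArgmin γ
    have hden : 0 < x + 2 + (γ - 3 / 2) ^ 2 := by positivity
    refine le_of_mul_le_mul_right ?_ hden
    have : ((γ + 1 / 2) ^ 2 + 2 + (x + 8 * (γ - 1) / (x + 2 + (γ - 3 / 2) ^ 2)))
        * (x + 2 + (γ - 3 / 2) ^ 2)
        = ((γ + 1 / 2) ^ 2 + 2 + x) * (x + 2 + (γ - 3 / 2) ^ 2) + 8 * (γ - 1) := by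
      rw [add_mul, add_mul (_ ^ 2 + 2) _ _, add_mul x, div_mul_cancel₀ _ hden.ne']
      ring
    rw [this]
    nlinarith [hs]

/-! ### The sharp constant with prescribed swirl -/

lemma hardyIntegral_smul (c γ : ℝ) (u : E3 → E3) :
    hardyIntegral γ (fun x => c • u x) = ENNReal.ofReal (c ^ 2) * hardyIntegral γ u := by
  rw [hardyIntegral, hardyIntegral, ← lintegral_const_mul' _ _ ENNReal.ofReal_ne_top]
  refine lintegral_congr fun x => ?_
  rw [← ENNReal.ofReal_mul (sq_nonneg c), norm_smul, mul_pow, Real.norm_eq_abs, sq_abs, mul_assoc]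

lemma pderiv_smul {u : E3 → E3} (hu : Differentiable ℝ u) (c : ℝ) (j : Fin 3) (x : E3) :
    pderiv j (fun x => c • u x) x = c • pderiv j u x := by
  rw [pderiv, fderiv_fun_const_smul (hu x)]; rfl

lemma gradIntegral_smul {u : E3 → E3} (hu : Differentiable ℝ u) (c γ : ℝ) :
    gradIntegral γ (fun x => c • u x) = ENNReal.ofReal (c ^ 2) * gradIntegral γ u := by
  rw [gradIntegral, gradIntegral, ← lintegral_const_mul' _ _ ENNReal.ofReal_ne_top]
  refine lintegral_congr fun x => ?_
  have : gradSq (fun x => c • u x) x = c ^ 2 * gradSq u x := by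
    simp only [gradSq, pderiv_smul hu, PiLp.smul_apply, smul_eq_mul, mul_pow, Finset.mul_sum]
  rw [← ENNReal.ofReal_mul (sq_nonneg c), this, mul_assoc]

lemma smul_mem_swirlFreeFields {γ : ℝ} {u : E3 → E3} (hu : u ∈ swirlFreeFields γ) (c : ℝ) :
    (fun x => c • u x) ∈ swirlFreeFields γ := by
  obtain ⟨⟨h1, h2, h3⟩, h4, h5⟩ := hu
  refine ⟨⟨h1.const_smul c, h2.smul_left (f := fun _ => c), fun h => by simp [h3 h]⟩,
    fun x => ?_, fun x => ?_⟩
  · have := h4 x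
    simp only [divergence] at this ⊢
    simp only [pderiv_smul (h1.differentiable (by simp)), PiLp.smul_apply, smul_eq_mul,
      ← Finset.mul_sum, this, mul_zero]
  · have := h5 x
    simp only [swirlPart, swirlComponent] at this ⊢
    rw [real_inner_smul_left, mul_smul, this, smul_zero]

lemma zero_mem_swirlFreeFields (γ : ℝ) : (fun _ => 0) ∈ swirlFreeFields γ := by
  refine ⟨⟨contDiff_const, HasCompactSupport.zero, fun _ => rfl⟩, fun x => ?_, fun x => ?_⟩
  · simp [divergence, pderiv]
  · simp [swirlPart, swirlComponent]

/-- Division by `n²` and `n → ∞`: the fixed contribution `c` of the swirl is negligible against a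
swirl-free part scaled by `n`. -/
lemma le_of_forall_sq_mul_le_sq_mul_add {b c d : ℝ≥0∞} (hc : c ≠ ⊤)
    (h : ∀ n : ℕ, ENNReal.ofReal ((n : ℝ) ^ 2) * b ≤ ENNReal.ofReal ((n : ℝ) ^ 2) * d + c) :
    b ≤ d := by
  refine ENNReal.le_of_forall_pos_le_add fun ε hε _ => ?_
  obtain ⟨n, hn⟩ := exists_nat_gt (c.toReal / ε)
  have hε' : (0 : ℝ) < ε := hε
  have hn0 : (0 : ℝ) < n := (div_nonneg ENNReal.toReal_nonneg hε'.le).trans_lt hn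
  have hn1 : (1 : ℝ) ≤ n := by
    have : 0 < n := by exact_mod_cast hn0
    exact_mod_cast this
  have hne : ENNReal.ofReal ((n : ℝ) ^ 2) ≠ 0 := by
    simpa using (pow_pos hn0 2).ne'
  have hcε : c ≤ ENNReal.ofReal ((n : ℝ) ^ 2) * ε := by
    rw [← ENNReal.ofReal_toReal hc, ← ENNReal.ofReal_coe_nnreal,
      ← ENNReal.ofReal_mul (by positivity)]
    refine ENNReal.ofReal_le_ofReal ?_
    rw [div_lt_iff₀ hε'] at hn
    have h2 : (n : ℝ) * ε ≤ n ^ 2 * ε := by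
      have : (n : ℝ) ≤ n ^ 2 := by nlinarith
      gcongr
    exact hn.le.trans h2
  have := (h n).trans (add_le_add_right hcε _)
  rw [← mul_add] at this
  exact (ENNReal.mul_le_mul_iff_right hne ENNReal.ofReal_ne_top).1 this

section

variable {γ : ℝ} {g : E3 → ℝ}

lemma gradIntegral_eq_top_of_mem_fieldsWithSwirl (hg : IndepOfPhi g)
    (hG : (fun x => g x • ePhi x) ∈ testFields γ)
    (htop : gradIntegral γ (fun x => g x • ePhi x) = ⊤) {u : E3 → E3}
    (hu : u ∈ fieldsWithSwirl γ (fun x => g x • ePhi x)) : gradIntegral γ u = ⊤ := by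
  have hm := sub_swirl_mem hg hG hu
  have := gradIntegral_add_swirl hg hG.1 hm.1.1 hm.2.2 γ
  simpa [htop] using this

/-- Both integrals split, and each entry of the minimum is an admissible constant for its own
summand. -/
lemma hardyLerayIneq_constWithSwirl (hg : IndepOfPhi g)
    (hG : (fun x => g x • ePhi x) ∈ testFields γ)
    (hfin : gradIntegral γ (fun x => g x • ePhi x) < ⊤) {u : E3 → E3}
    (hu : u ∈ fieldsWithSwirl γ (fun x => g x • ePhi x)) :
    HardyLerayIneq γ (constWithSwirl γ (fun x => g x • ePhi x)) u := by
  have hm := sub_swirl_mem hg hG hu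
  have e1 := gradIntegral_add_swirl hg hG.1 hm.1.1 hm.2.2 γ
  have e2 := hardyIntegral_add_swirl (g := g) hm.1.1.continuous hm.2.2 γ
  simp only [sub_add_cancel] at e1 e2
  rw [HardyLerayIneq, e1, e2, mul_add]
  refine add_le_add ?_ ?_
  · refine le_trans ?_ (hardyLerayIneq_of_swirlFree hm)
    gcongr
    exact min_le_left _ _
  · have hh := hardyIntegral_lt_top hG hfin
    refine (mul_le_mul_left (ENNReal.ofReal_le_ofReal (min_le_right _ _)) _).trans ?_
    rw [← ENNReal.ofReal_toReal hfin.ne, ← ENNReal.ofReal_toReal hh.ne,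
      ENNReal.toReal_ofReal ENNReal.toReal_nonneg, ENNReal.toReal_ofReal ENNReal.toReal_nonneg,
      ← ENNReal.ofReal_mul (by positivity)]
    refine ENNReal.ofReal_le_ofReal ?_
    rcases eq_or_ne (hardyIntegral γ fun x => g x • ePhi x).toReal 0 with h | h
    · rw [h]; simp
    · rw [div_mul_cancel₀ _ h]

/-- Two test families: swirl-free fields scaled by `n`, for which the zeroth-order swirl term is
dropped and the gradient term is negligible, give the bound by `constSwirlFree γ`; the swirl alone
gives the quotient. -/
lemma le_constWithSwirl (hg : IndepOfPhi g)
    (hG : (fun x => g x • ePhi x) ∈ testFields γ)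
    (hfin : gradIntegral γ (fun x => g x • ePhi x) < ⊤)
    (hpos : 0 < hardyIntegral γ (fun x => g x • ePhi x)) {C : ℝ}
    (h : ∀ u ∈ fieldsWithSwirl γ (fun x => g x • ePhi x), HardyLerayIneq γ C u) :
    C ≤ constWithSwirl γ (fun x => g x • ePhi x) := by
  have hh := hardyIntegral_lt_top hG hfin
  refine le_min (le_constSwirlFree fun u hu => ?_) ?_
  · refine le_of_forall_sq_mul_le_sq_mul_add hfin.ne fun n => ?_
    have hn := smul_mem_swirlFreeFields hu (n : ℝ)
    have := h _ (add_swirl_mem hg hG hn)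
    rw [HardyLerayIneq, gradIntegral_add_swirl hg hG.1 hn.1.1 hn.2.2,
      hardyIntegral_add_swirl hn.1.1.continuous hn.2.2, hardyIntegral_smul,
      gradIntegral_smul (hu.1.1.differentiable (by simp)), mul_add, mul_left_comm] at this
    exact le_self_add.trans this
  · have h0 := zero_mem_swirlFreeFields γ
    have := h _ (add_swirl_mem hg hG h0)
    simp only [zero_add] at this
    rw [le_div_iff₀ (ENNReal.toReal_pos hpos.ne' hh.ne)]
    rcases le_or_gt C 0 with hC | hC
    · exact (mul_nonpos_of_nonpos_of_nonneg hC ENNReal.toReal_nonneg).trans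
        ENNReal.toReal_nonneg
    · have := ENNReal.toReal_mono hfin.ne this
      rwa [ENNReal.toReal_mul, ENNReal.toReal_ofReal hC.le] at this

end

end HardyLeray

open HardyLeray in
theorem theorem2 (γ : ℝ) :
    -- the minimum in the definition of the constant is attained
    (∃ x₀ : ℝ, 0 ≤ x₀ ∧ (∀ x : ℝ, 0 ≤ x → auxFun γ x₀ ≤ auxFun γ x) ∧
      constSwirlFree γ = (γ + 1 / 2) ^ 2 + 2 + auxFun γ x₀) ∧
    -- explicit value of the constant
    (3 / 2 ≤ γ ∧ γ ≤ gammaZero →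
      constSwirlFree γ = (2 * Real.sqrt (γ - 1) + Real.sqrt 2) ^ 2) ∧
    (¬ (3 / 2 ≤ γ ∧ γ ≤ gammaZero) →
      constSwirlFree γ =
        (γ + 1 / 2) ^ 2 * ((4 + (γ - 3 / 2) ^ 2) / (2 + (γ - 3 / 2) ^ 2))) ∧
    |gammaZero - 2.8646556| < 0.0000001 ∧
    -- swirl-free fields: the inequality, and optimality of the constant
    IsGreatest {C : ℝ | ∀ u ∈ swirlFreeFields γ, HardyLerayIneq γ C u} (constSwirlFree γ) ∧
    -- fields with prescribed axisymmetric swirl part `g e_φ`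
    ∀ g : E3 → ℝ, IndepOfPhi g →
      (fun x => g x • ePhi x) ∈ testFields γ → (∃ x, g x • ePhi x ≠ 0) →
      (gradIntegral γ (fun x => g x • ePhi x) < ⊤ →
        0 < hardyIntegral γ (fun x => g x • ePhi x) ∧
        hardyIntegral γ (fun x => g x • ePhi x) < ⊤ ∧
        IsGreatest
          {C : ℝ | ∀ u ∈ fieldsWithSwirl γ (fun x => g x • ePhi x), HardyLerayIneq γ C u}
          (constWithSwirl γ (fun x => g x • ePhi x))) ∧
      (gradIntegral γ (fun x => g x • ePhi x) = ⊤ →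
        ∀ u ∈ fieldsWithSwirl γ (fun x => g x • ePhi x), gradIntegral γ u = ⊤) := by
  exact ⟨⟨auxArgmin γ, auxArgmin_nonneg γ, fun _ hx => auxFun_auxArgmin_le γ hx,
      constSwirlFree_eq γ⟩, constSwirlFree_explicit_interior, constSwirlFree_explicit_boundary,
    abs_gammaZero_sub_lt, ⟨fun _ hu => hardyLerayIneq_of_swirlFree hu, fun _ => le_constSwirlFree⟩,
    fun g hg hG hne => ⟨fun hfin =>
      have hpos := hardyIntegral_pos hG.1.continuous hne
      ⟨hpos, hardyIntegral_lt_top hG hfin,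
        fun _ hu => hardyLerayIneq_constWithSwirl hg hG hfin hu,
        fun _ => le_constWithSwirl hg hG hfin hpos⟩,
      fun htop _ hu => gradIntegral_eq_top_of_mem_fieldsWithSwirl hg hG htop hu⟩⟩
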